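/- **Setting.** Let $W_i=(Y_i,X_i,Z_i)$, $i\ge1$, be i.i.d. with law $F_0$, $W=(Y,X,Z)\sim F_0$, and $Y=\gamma_0(X)+\varepsilon$, $E[\varepsilon\mid Z]=0$, $E[\varepsilon^2]<\infty$, $E[\gamma_0(X)^2]<\infty$. Write $\|f\|=(E f^2)^{1/2}$, $|v|_1=\sum_k|v_k|$, $\|A\|_{\ell_\infty}=\max_i\sum_j|A_{ij}|$. Let $m(w,\gamma)$ be a possibly nonlinear functional that is Gateaux differentiable, with derivative $D(w,\gamma,\zeta)=\frac{d}{d\tau}m(w,\gamma+\tau\zeta)|_{\tau=0}$ linear in $\zeta$ (for square integrable $\gamma,\zeta$ and $F_0$-almost every $w$). Assume there is $\alpha_0(Z)$ with $E[D(W,\gamma_0,\zeta)]=E[\alpha_0(Z)\zeta(X)]$ for all $\zeta$ with $E[\zeta(X)^2]<\infty$. Let $\theta_0=E[m(W,\gamma_0)]$ and $\psi_0(w)=m(w,\gamma_0)-\theta_0+\alpha_0(z)[y-\gamma_0(x)]$. **Estimator.** For fixed $L\ge2$ let $I_1,\dots,I_L$ partition $\{1,\dots,n\}$, $n_\ell=|I_\ell|$,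 $n_\ell/n\to1/L$. Let $b=(b_1,\dots,b_p)$ and $d=(d_1,\dots,d_q)$ be dictionaries of functions of $Z$ and of $X$; $p\le q$, $q\ge2$, and $b,d,p,q$ may depend on $n$. Let $\hat\gamma_\ell$ and the symmetric positive semidefinite $q\times q$ matrix $\hat\Omega_\ell$ be computed from the observations outside $I_\ell$, and $\hat\gamma_{\ell,\ell'}$ ($\ell\ne\ell'$) from those outside $I_\ell\cup I_{\ell'}$; $\hat\gamma_\ell,\hat\gamma_{\ell,\ell'}$ are square integrable functions of $x$. Put $$\hat G_\ell=\frac1{n-n_\ell}\sum_{i\notin I_\ell}d(X_i)b(Z_i)',\qquad \hat M_{\ell j}=\frac1{n-n_\ell}\sum_{\ell'\ne\ell}\sum_{i\in I_{\ell'}}D(W_i,\hat\gamma_{\ell,\ell'},d_j),$$ $$\hat\rho_\ell\in\operatorname*{argmin}_{\rho\in\mathbb R^p}\ (\hat M_\ell-\hat G_\ell\rho)'\tfrac{\hat\Omega_\ell}{q}(\hat M_\ell-\hat G_\ell\rho)+2\lambda_n|\rho|_1,\qquad \hat\alpha_\ell(z)=b(z)'\hat\rho_\ell,$$ where $\lambda_n>0$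 and the minimizer is also chosen from the observations outside $I_\ell$. With $\hat\psi_{i\ell}(\theta)=m(W_i,\hat\gamma_\ell)-\theta+\hat\alpha_\ell(Z_i)[Y_i-\hat\gamma_\ell(X_i)]$, let $\hat\theta=\frac1n\sum_\ell\sum_{i\in I_\ell}\hat\psi_{i\ell}(0)$ and $\hat V=\frac1n\sum_\ell\sum_{i\in I_\ell}\hat\psi_{i\ell}(\hat\theta)^2$. Estimators are assumed jointly measurable in the sample and their arguments. **Assumptions.** There are $\kappa_n^\gamma\ge0$ and integers $\bar s=\bar s_n\ge1$; put $\varepsilon_n=\max\{\sqrt{\log q/n},\kappa^\gamma_n\}$ and $G=E[d(X)b(Z)']$. All constants do not depend on $n$; 2, 4 and 5 are needed only for large $n$, apart from the $O_p$ condition in 2. 1. $\alpha_0(Z)$ and $E[(Y-\gamma_0(X))^2\mid Z]$ are almost surely bounded, and $E[m(W,\gamma_0)^2]<\infty$. 2. There are non-random matrices $\Omega=\Omega_n$ with $\|\Omega\|_{\ell_\infty}\le C$ and $\|\hat\Omega_\ell-\Omega\|_{\ell_\infty}=O_p(\sqrt{\log q/n})$ for all $\ell$. 3. Almost surely $\max_k|b_k(Z)|\le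 C_b$ and $\max_j|d_j(X)|\le C_d$. 4. There is $\bar\rho\in\mathbb R^p$ with at most $\bar s$ non-zero entries, $|\bar\rho|_1\le\bar A$ and $\|\alpha_0-b'\bar\rho\|^2\le C\bar s\varepsilon_n^2$. 5. The eigenvalues of $H=G'(\Omega/q)G$ are at most $C$, and for some $c>0$: $\delta'H\delta\ge c\sum_{j\in S}\delta_j^2$ for all $S\subseteq\{1,\dots,p\}$ with $|S|\le\bar s$ and all $\delta\in\mathbb R^p$ with $\sum_{j\notin S}|\delta_j|\le3\sum_{j\in S}|\delta_j|$. 6. There are $C,r>0$ such that for every square integrable $\gamma$ with $\|\gamma-\gamma_0\|\le r$ and every $n$: $\max_{j\le q}|D(W,\gamma,d_j)|\le C$ almost surely, and $\max_{j\le q}|E[D(W,\gamma,d_j)-D(W,\gamma_0,d_j)]|\le C\|\gamma-\gamma_0\|$. 7. There are $C,r>0$ such that for every square integrable $\gamma$ with $\|\gamma-\gamma_0\|\le r$: $m(W,\gamma)$ is integrable and $|E[m(W,\gamma)-m(W,\gamma_0)-D(W,\gamma_0,\gamma-\gamma_0)]|\le C\|\gamma-\gamma_0\|^2$. 8. $\|\hat\gamma_\ell-\gamma_0\|=O_p(\kappa_n^\gamma)$,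 $\|\hat\gamma_{\ell,\ell'}-\gamma_0\|=O_p(\kappa_n^\gamma)$ for $\ell\ne\ell'$, $n^{1/4}\|\hat\gamma_\ell-\gamma_0\|\to_p0$, and $\int[m(w,\hat\gamma_\ell)-m(w,\gamma_0)]^2F_0(dw)\to_p0$. 9. $\sqrt{\log q/n}=o(\lambda_n)$, $\kappa_n^\gamma=o(\lambda_n)$, $\bar s\lambda_n=o(1)$, and $\sqrt n\,\kappa_n^\alpha\kappa_n^\gamma=o(1)$ with $\kappa_n^\alpha=\bar s\lambda_n$. **Theorem.** Then $E[\psi_0(W)^2]<\infty$, $\hat\theta-\theta_0=O_p(n^{-1/2})$, and $$\sqrt n(\hat\theta-\theta_0)\xrightarrow{d}\mathcal N(0,V),\qquad \hat V\xrightarrow{p}V=E[\psi_0(W)^2].$$ -/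

import Mathlib

open MeasureTheory ProbabilityTheory Filter Topology Asymptotics Finset
open scoped ENNReal Matrix

noncomputable section

/-- An observation `w = (y, x, z)`: outcome, regressors, instruments. -/
abbrev Obs (𝒳 𝒵 : Type*) : Type _ := ℝ × 𝒳 × 𝒵

/-! ### Stochastic order and norms -/

/-- `f n = O_p(r n)`. -/
def IsBigOInProb {Ω : Type*} [MeasurableSpace Ω] (P : Measure Ω)
    (f : ℕ → Ω → ℝ) (r : ℕ → ℝ) : Prop :=
  ∀ ε : ℝ≥0∞, 0 < ε → ∃ K : ℝ, 0 < K ∧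
    ∀ᶠ n in atTop, P {ω | K * r n < |f n ω|} ≤ ε

/-- The induced `ℓ_∞` matrix norm: the largest absolute row sum. -/
def rowSumNorm {q r : ℕ} (A : Matrix (Fin q) (Fin r) ℝ) : ℝ :=
  ⨆ i, ∑ j, |A i j|

section Population

variable {𝒳 𝒵 : Type*} [MeasurableSpace 𝒳] [MeasurableSpace 𝒵]

/-- `f` is measurable and `E[f(X)²] < ∞`. -/
def IsSquareIntegrable (F₀ : Measure (Obs 𝒳 𝒵)) (f : 𝒳 → ℝ) : Prop :=
  Measurable f ∧ Integrable (fun w : Obs 𝒳 𝒵 => f w.2.1 ^ 2) F₀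

/-- The mean square norm `‖f‖ = (E[f(X)²])^{1/2}`. -/
def msNorm (F₀ : Measure (Obs 𝒳 𝒵)) (f : 𝒳 → ℝ) : ℝ :=
  Real.sqrt (∫ w, f w.2.1 ^ 2 ∂F₀)

/-- The `σ`-algebra on observations generated by the instrument `Z`. -/
abbrev instrumentSigma (𝒳 𝒵 : Type*) [MeasurableSpace 𝒵] : MeasurableSpace (Obs 𝒳 𝒵) :=
  MeasurableSpace.comap (fun w : Obs 𝒳 𝒵 => w.2.2) inferInstance

/-- The Gateaux derivative `D(w, γ, ζ) = d/dτ m(w, γ + τ ζ)` at `τ = 0`. -/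
def gateaux {𝒳 𝒵 : Type*} (m : Obs 𝒳 𝒵 → (𝒳 → ℝ) → ℝ)
    (w : Obs 𝒳 𝒵) (γ ζ : 𝒳 → ℝ) : ℝ :=
  deriv (fun τ : ℝ => m w (γ + τ • ζ)) 0

/-- `θ₀ = E[m(W, γ₀)]`. -/
def thetaZero (F₀ : Measure (Obs 𝒳 𝒵)) (m : Obs 𝒳 𝒵 → (𝒳 → ℝ) → ℝ) (γ₀ : 𝒳 → ℝ) : ℝ :=
  ∫ w, m w γ₀ ∂F₀

/-- `ψ₀(w) = m(w, γ₀) - θ₀ + α₀(z) (y - γ₀(x))`. -/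
def psiZero (F₀ : Measure (Obs 𝒳 𝒵)) (m : Obs 𝒳 𝒵 → (𝒳 → ℝ) → ℝ) (γ₀ : 𝒳 → ℝ)
    (α₀ : 𝒵 → ℝ) (w : Obs 𝒳 𝒵) : ℝ :=
  m w γ₀ - thetaZero F₀ m γ₀ + α₀ w.2.2 * (w.1 - γ₀ w.2.1)

end Population

/-- The restricted eigenvalue `φ²(s)` of `A`: the infimum of `δ' A δ / ‖δ_S‖²` over index sets `S`
with `|S| ≤ s` and `δ ≠ 0` with `|δ_{Sᶜ}|₁ ≤ 3 |δ_S|₁`.  It is taken in the extended reals, so that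
the infimum over an empty set is `⊤`. -/
def restrictedEigenvalueSq {p : ℕ} (A : Matrix (Fin p) (Fin p) ℝ) (s : ℕ) : EReal :=
  ⨅ (S : Finset (Fin p)) (δ : Fin p → ℝ)
    (_ : S.card ≤ s ∧ δ ≠ 0 ∧ ∑ j ∈ Sᶜ, |δ j| ≤ 3 * ∑ j ∈ S, |δ j|),
    (((δ ⬝ᵥ (A *ᵥ δ)) / ∑ j ∈ S, δ j ^ 2 : ℝ) : EReal)

/-! ### The double cross-fitted procedure at sample size `n` -/

/-- All ingredients at sample size `n` with `L` folds: the dictionaries `b` and `d`, the fold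
`fold i` of each observation `i`, the estimators `γ̂_ℓ` and `γ̂_{ℓ,ℓ'}`, the weight matrices
`Ω̂_ℓ`, the penalty `λ_n` and the coefficients `ρ̂_ℓ`.  Estimators are functions of the sample. -/
structure CrossFit (𝒳 𝒵 : Type*) (L n : ℕ) where
  p : ℕ
  q : ℕ
  b : Fin p → 𝒵 → ℝ
  d : Fin q → 𝒳 → ℝ
  fold : Fin n → Fin L
  gammaHat : Fin L → (Fin n → Obs 𝒳 𝒵) → 𝒳 → ℝ
  gammaHat₂ : Fin L → Fin L → (Fin n → Obs 𝒳 𝒵) → 𝒳 → ℝ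
  OmegaHat : Fin L → (Fin n → Obs 𝒳 𝒵) → Matrix (Fin q) (Fin q) ℝ
  lam : ℝ
  rhoHat : Fin L → (Fin n → Obs 𝒳 𝒵) → Fin p → ℝ

namespace CrossFit

variable {𝒳 𝒵 : Type*} {L n : ℕ}

/-- The fold `I_ℓ`. -/
def block (S : CrossFit 𝒳 𝒵 L n) (ℓ : Fin L) : Finset (Fin n) :=
  {i | S.fold i = ℓ}

/-- The fold size `n_ℓ`. -/
def blockSize (S : CrossFit 𝒳 𝒵 L n) (ℓ : Fin L) : ℕ := (S.block ℓ).card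

/-- `Ĝ_ℓ = (n - n_ℓ)⁻¹ ∑_{i ∉ I_ℓ} d(X_i) b(Z_i)'`. -/
def GHat (S : CrossFit 𝒳 𝒵 L n) (ℓ : Fin L) (w : Fin n → Obs 𝒳 𝒵) :
    Matrix (Fin S.q) (Fin S.p) ℝ :=
  Matrix.of fun j k =>
    ((n : ℝ) - S.blockSize ℓ)⁻¹ * ∑ i ∈ (S.block ℓ)ᶜ, S.d j (w i).2.1 * S.b k (w i).2.2

/-- `M̂_{ℓ j} = (n - n_ℓ)⁻¹ ∑_{ℓ' ≠ ℓ} ∑_{i ∈ I_ℓ'} D(W_i, γ̂_{ℓ,ℓ'}, d_j)`. -/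
def MHat (m : Obs 𝒳 𝒵 → (𝒳 → ℝ) → ℝ) (S : CrossFit 𝒳 𝒵 L n) (ℓ : Fin L)
    (w : Fin n → Obs 𝒳 𝒵) (j : Fin S.q) : ℝ :=
  ((n : ℝ) - S.blockSize ℓ)⁻¹ * ∑ ℓ' ∈ Finset.univ.erase ℓ, ∑ i ∈ S.block ℓ',
    gateaux m (w i) (S.gammaHat₂ ℓ ℓ' w) (S.d j)

/-- The PGMM criterion
`(M̂_ℓ - Ĝ_ℓ ρ)' (Ω̂_ℓ / q) (M̂_ℓ - Ĝ_ℓ ρ) + 2 λ_n |ρ|₁`. -/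
def criterion (m : Obs 𝒳 𝒵 → (𝒳 → ℝ) → ℝ) (S : CrossFit 𝒳 𝒵 L n) (ℓ : Fin L)
    (w : Fin n → Obs 𝒳 𝒵) (ρ : Fin S.p → ℝ) : ℝ :=
  (S.MHat m ℓ w - S.GHat ℓ w *ᵥ ρ) ⬝ᵥ
      (((S.q : ℝ)⁻¹ • S.OmegaHat ℓ w) *ᵥ (S.MHat m ℓ w - S.GHat ℓ w *ᵥ ρ))
    + 2 * S.lam * ∑ k, |ρ k|

/-- `α̂_ℓ(z) = b(z)' ρ̂_ℓ`. -/
def alphaHat (S : CrossFit 𝒳 𝒵 L n) (ℓ : Fin L) (w : Fin n → Obs 𝒳 𝒵) (z : 𝒵) : ℝ :=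
  ∑ k, S.b k z * S.rhoHat ℓ w k

/-- The debiased estimator
`θ̂ = n⁻¹ ∑_ℓ ∑_{i ∈ I_ℓ} {m(W_i, γ̂_ℓ) + α̂_ℓ(Z_i) (Y_i - γ̂_ℓ(X_i))}`. -/
def thetaHat (m : Obs 𝒳 𝒵 → (𝒳 → ℝ) → ℝ) (S : CrossFit 𝒳 𝒵 L n)
    (w : Fin n → Obs 𝒳 𝒵) : ℝ :=
  (n : ℝ)⁻¹ * ∑ ℓ, ∑ i ∈ S.block ℓ,
    (m (w i) (S.gammaHat ℓ w)
      + S.alphaHat ℓ w (w i).2.2 * ((w i).1 - S.gammaHat ℓ w (w i).2.1))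

/-- The variance estimator `V̂ = n⁻¹ ∑_ℓ ∑_{i ∈ I_ℓ} ψ̂_{iℓ}²` with
`ψ̂_{iℓ} = m(W_i, γ̂_ℓ) - θ̂ + α̂_ℓ(Z_i) (Y_i - γ̂_ℓ(X_i))`. -/
def VHat (m : Obs 𝒳 𝒵 → (𝒳 → ℝ) → ℝ) (S : CrossFit 𝒳 𝒵 L n)
    (w : Fin n → Obs 𝒳 𝒵) : ℝ :=
  (n : ℝ)⁻¹ * ∑ ℓ, ∑ i ∈ S.block ℓ,
    (m (w i) (S.gammaHat ℓ w) - S.thetaHat m w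
      + S.alphaHat ℓ w (w i).2.2 * ((w i).1 - S.gammaHat ℓ w (w i).2.1)) ^ 2

variable [MeasurableSpace 𝒳] [MeasurableSpace 𝒵]

/-- `G = E[d(X) b(Z)']`. -/
def GPop (S : CrossFit 𝒳 𝒵 L n) (F₀ : Measure (Obs 𝒳 𝒵)) : Matrix (Fin S.q) (Fin S.p) ℝ :=
  Matrix.of fun j k => ∫ w, S.d j w.2.1 * S.b k w.2.2 ∂F₀

/-- `G' (Ω / q) G`. -/
def popHessian (S : CrossFit 𝒳 𝒵 L n) (F₀ : Measure (Obs 𝒳 𝒵))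
    (Om : Matrix (Fin S.q) (Fin S.q) ℝ) : Matrix (Fin S.p) (Fin S.p) ℝ :=
  (S.GPop F₀)ᵀ * ((S.q : ℝ)⁻¹ • Om) * S.GPop F₀

/-- The defining properties of the double cross-fitted PGMM procedure for the functional `m`:
`γ̂_ℓ`, `Ω̂_ℓ`, `ρ̂_ℓ` use only observations outside `I_ℓ`, and `γ̂_{ℓ,ℓ'}` only observations outside
`I_ℓ ∪ I_ℓ'`; estimated structural functions are square integrable; `Ω̂_ℓ` is positive
semidefinite; `ρ̂_ℓ` minimizes the PGMM criterion; everything is measurable. -/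
structure IsDoubleCrossFitPGMM (F₀ : Measure (Obs 𝒳 𝒵)) (m : Obs 𝒳 𝒵 → (𝒳 → ℝ) → ℝ)
    (S : CrossFit 𝒳 𝒵 L n) : Prop where
  two_le_q : 2 ≤ S.q
  p_le_q : S.p ≤ S.q
  lam_pos : 0 < S.lam
  measurable_b : ∀ k, Measurable (S.b k)
  measurable_d : ∀ j, Measurable (S.d j)
  dependsOn_gammaHat : ∀ ℓ, DependsOn (S.gammaHat ℓ) {i | S.fold i ≠ ℓ}
  dependsOn_gammaHat₂ : ∀ ℓ ℓ', ℓ ≠ ℓ' →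
    DependsOn (S.gammaHat₂ ℓ ℓ') {i | S.fold i ≠ ℓ ∧ S.fold i ≠ ℓ'}
  dependsOn_OmegaHat : ∀ ℓ, DependsOn (S.OmegaHat ℓ) {i | S.fold i ≠ ℓ}
  dependsOn_rhoHat : ∀ ℓ, DependsOn (S.rhoHat ℓ) {i | S.fold i ≠ ℓ}
  gammaHat_sq : ∀ ℓ w, IsSquareIntegrable F₀ (S.gammaHat ℓ w)
  gammaHat₂_sq : ∀ ℓ ℓ', ℓ ≠ ℓ' → ∀ w, IsSquareIntegrable F₀ (S.gammaHat₂ ℓ ℓ' w)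
  posSemidef_OmegaHat : ∀ ℓ w, (S.OmegaHat ℓ w).PosSemidef
  isMinOn_rhoHat : ∀ ℓ w, IsMinOn (S.criterion m ℓ w) Set.univ (S.rhoHat ℓ w)
  measurable_gammaHat : ∀ ℓ,
    Measurable fun s : (Fin n → Obs 𝒳 𝒵) × 𝒳 => S.gammaHat ℓ s.1 s.2
  measurable_gammaHat₂ : ∀ ℓ ℓ', ℓ ≠ ℓ' →
    Measurable fun s : (Fin n → Obs 𝒳 𝒵) × 𝒳 => S.gammaHat₂ ℓ ℓ' s.1 s.2
  measurable_m_gammaHat : ∀ ℓ,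
    Measurable fun s : (Fin n → Obs 𝒳 𝒵) × Obs 𝒳 𝒵 => m s.2 (S.gammaHat ℓ s.1)
  measurable_gateaux_gammaHat₂ : ∀ ℓ ℓ', ℓ ≠ ℓ' → ∀ j,
    Measurable fun s : (Fin n → Obs 𝒳 𝒵) × Obs 𝒳 𝒵 =>
      gateaux m s.2 (S.gammaHat₂ ℓ ℓ' s.1) (S.d j)
  measurable_OmegaHat : ∀ ℓ i j, Measurable fun w => S.OmegaHat ℓ w i j
  measurable_rhoHat : ∀ ℓ, Measurable (S.rhoHat ℓ)

end CrossFit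

/-- The sample of size `n`: the first `n` observations of the sequence. -/
def sample {Ω 𝒳 𝒵 : Type*} (W : ℕ → Ω → Obs 𝒳 𝒵) (n : ℕ) (ω : Ω) : Fin n → Obs 𝒳 𝒵 :=
  fun i => W i ω

/-- `ε_n = max{√(log q / n), κ_n}`. -/
def epsRate (q n : ℕ) (κ : ℝ) : ℝ := max (Real.sqrt (Real.log q / n)) κ

end

/-! ### Independent blocks under a product measure -/

section Blocks

variable {𝒲 ι : Type*} [MeasurableSpace 𝒲] [Fintype ι]
  (μ : Measure 𝒲) [IsProbabilityMeasure μ]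

/-! Write `Δ = γ̂_ℓ - γ₀`, `β = α̂_ℓ - α₀` and `ε = Y - γ₀(X)`. Then `θ̂ - θ₀` is the average of
`ψ₀(W_i)` plus the average of the score errors `m(W, γ̂_ℓ) - m(W, γ₀) - α₀ Δ + β ε - β Δ`. Once the
observations outside `I_ℓ` are frozen, `γ̂_ℓ` and `α̂_ℓ` are fixed functions, so a fold sum of score
errors is a sum of i.i.d. terms and only their first two moments matter. In the mean, the Riesz
identity cancels the first-order effect of `Δ` and exogeneity removes `β ε`. What is left is at most
`C ‖Δ‖² + ‖β‖ ‖Δ‖`, which is `o_p(n^{-1/2})` by the `n^{1/4}` rate and the product rate. The second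
moment is `o_p(1)`, so Chebyshev makes each fold sum `o_p(√n)` (`score_error_bounds`,
`eventually_measure_scoreError_le`). The central limit theorem and the law of large numbers for `ψ₀`
survive such a perturbation.

It remains to see that `‖β‖ = O_p(s̄ λ)`, which follows from `isBigOInProb_sum_abs_rhoHat_sub`. Put
`M_j = E[α₀ d_j]` and split `M̂ - Ĝ ρ̄` into noise and the bias `M - G ρ̄`. The noise has sup norm
`O_p(√(log q / n) + κ) = o_p(λ)`, so the penalty dominates it: Hoeffding and a union bound handle
`Ĝ` and, thanks to the second layer of sample splitting, `M̂`; the Lipschitz condition handles the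
effect of `γ̂_{ℓ,ℓ'}`. The bias is only `O(√s̄ λ)`, possibly too large for the penalty; it is kept
inside the quadratic form, where it costs `s̄ λ²`. The restricted eigenvalue condition passes from
the population to the sample because `s̄ √(log q / n) → 0`, and the oracle inequality
`sum_abs_sub_le_of_isMinimizer` gives an `ℓ₁` error of order `s̄ λ`. Bounded dictionaries turn this
into a uniform bound on `b'(ρ̂ - ρ̄)`. -/

theorem memLp_comp_eval {g : 𝒲 → ℝ} (hg : MemLp g 2 μ) (i : ι) :
    MemLp (fun u : ι → 𝒲 => g (u i)) 2 (Measure.pi fun _ => μ) :=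
  hg.comp_measurePreserving (measurePreserving_eval (fun _ => μ) i)

theorem integral_comp_eval {g : 𝒲 → ℝ} (hg : AEStronglyMeasurable g μ) (i : ι) :
    ∫ u : ι → 𝒲, g (u i) ∂(Measure.pi fun _ => μ) = ∫ x, g x ∂μ := by
  have hp := measurePreserving_eval (fun _ : ι => μ) i
  have := integral_map (μ := Measure.pi fun _ : ι => μ) hp.measurable.aemeasurable
    (f := g) (by rw [hp.map_eq]; exact hg)
  rw [hp.map_eq] at this
  exact this.symm

theorem iIndepFun_comp_eval {g : 𝒲 → ℝ} (hg : AEMeasurable g μ) :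
    iIndepFun (fun (i : ι) (u : ι → 𝒲) => g (u i)) (Measure.pi fun _ => μ) :=
  iIndepFun_pi (X := fun _ => g) fun _ => hg

/-- Second moment of a sum over a block. -/
theorem integral_sq_sum_le {g : 𝒲 → ℝ} (hg : MemLp g 2 μ) {v b : ℝ} (hv : ∫ x, g x ^ 2 ∂μ ≤ v)
    (hb : |∫ x, g x ∂μ| ≤ b) (B : Finset ι) :
    ∫ u : ι → 𝒲, (∑ i ∈ B, g (u i)) ^ 2 ∂(Measure.pi fun _ => μ)
      ≤ #B * v + (#B * b) ^ 2 := by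
  set ν : Measure (ι → 𝒲) := Measure.pi fun _ => μ
  have hmem : MemLp (∑ i ∈ B, fun u : ι → 𝒲 => g (u i)) 2 ν :=
    memLp_finsetSum' _ fun i _ => memLp_comp_eval μ hg i
  have hvar : Var[∑ i ∈ B, fun u : ι → 𝒲 => g (u i); ν] ≤ #B * v := by
    rw [IndepFun.variance_sum (fun i _ => memLp_comp_eval μ hg i)
      (fun i _ j _ hij => (iIndepFun_comp_eval μ hg.1.aemeasurable).indepFun hij)]
    rw [← nsmul_eq_mul]
    refine Finset.sum_le_card_nsmul _ _ _ fun i _ => ?_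
    refine (variance_le_expectation_sq (memLp_comp_eval μ hg i).1).trans ?_
    have := integral_comp_eval μ (g := fun x => g x ^ 2) (hg.1.pow 2) i
    simp only [Pi.pow_apply]
    exact this.le.trans hv
  have hmean : ν[∑ i ∈ B, fun u : ι → 𝒲 => g (u i)] = #B * ∫ x, g x ∂μ := by
    simp only [Finset.sum_apply]
    rw [integral_finsetSum _ fun i _ => (memLp_comp_eval μ hg i).integrable (by norm_num)]
    rw [Finset.sum_congr rfl fun i _ => integral_comp_eval μ hg.1 i]
    simp
  -- Second moment = variance + squared mean: the noise enters linearly in `#B`, only the bias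
  -- quadratically.
  have h := variance_eq_sub hmem
  rw [hmean] at h
  have h2 : ν[(∑ i ∈ B, fun u : ι → 𝒲 => g (u i)) ^ 2]
      = ∫ u : ι → 𝒲, (∑ i ∈ B, g (u i)) ^ 2 ∂ν := by
    simp
  rw [h2] at h
  have h3 : (#B * ∫ x, g x ∂μ) ^ 2 ≤ (#B * b) ^ 2 := by
    rw [mul_pow, mul_pow, ← sq_abs (∫ x, g x ∂μ)]
    gcongr
  linarith

/-- Chebyshev's inequality for the sum over a block. -/
theorem measure_le_abs_sum_le {g : 𝒲 → ℝ} (hg : MemLp g 2 μ) {v b : ℝ}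
    (hv : ∫ x, g x ^ 2 ∂μ ≤ v) (hb : |∫ x, g x ∂μ| ≤ b) (B : Finset ι) {t : ℝ} (ht : 0 < t) :
    (Measure.pi fun _ : ι => μ) {u | t ≤ |∑ i ∈ B, g (u i)|}
      ≤ ENNReal.ofReal ((#B * v + (#B * b) ^ 2) / t ^ 2) := by
  set ν : Measure (ι → 𝒲) := Measure.pi fun _ => μ
  have hmem : MemLp (fun u : ι → 𝒲 => ∑ i ∈ B, g (u i)) 2 ν :=
    memLp_finsetSum _ fun i _ => memLp_comp_eval μ hg i
  have h := mul_meas_ge_le_integral_of_nonneg (μ := ν)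
    (f := fun u : ι → 𝒲 => (∑ i ∈ B, g (u i)) ^ 2) (ae_of_all _ fun u => sq_nonneg _)
    hmem.integrable_sq (t ^ 2)
  have h2 := h.trans (integral_sq_sum_le μ hg hv hb B)
  have hset : {u : ι → 𝒲 | t ≤ |∑ i ∈ B, g (u i)|} = {u | t ^ 2 ≤ (∑ i ∈ B, g (u i)) ^ 2} := by
    ext u
    simp only [Set.mem_ofPred_eq]
    rw [sq_le_sq, abs_of_pos ht]
  rw [hset, ← ofReal_measureReal]
  refine ENNReal.ofReal_le_ofReal ?_
  rw [le_div_iff₀ (by positivity), mul_comm]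
  exact h2

/-- Hoeffding's inequality for the centered sum over a block. -/
theorem measure_lt_abs_sum_sub_le {g : 𝒲 → ℝ} (hg : AEMeasurable g μ) {C : ℝ} (hC : 0 < C)
    (hb : ∀ᵐ x ∂μ, |g x| ≤ C) (B : Finset ι) {N : ℕ} (hN : #B ≤ N) {t : ℝ}
    (ht : 0 ≤ t) :
    (Measure.pi fun _ : ι => μ) {u | t < |∑ i ∈ B, (g (u i) - ∫ x, g x ∂μ)|}
      ≤ ENNReal.ofReal (2 * Real.exp (-t ^ 2 / (2 * (N * C ^ 2)))) := by
  set ν : Measure (ι → 𝒲) := Measure.pi fun _ => μ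
  -- The interval `[-C, C]` has half-length `C`, so the sub-Gaussian parameter is `C ^ 2`.
  have hsub : HasSubgaussianMGF (fun x => g x - ∫ x, g x ∂μ) ((‖C - -C‖₊ / 2) ^ 2) μ :=
    hasSubgaussianMGF_of_mem_Icc hg (by filter_upwards [hb] with x hx using abs_le.1 hx)
  have hc : (((‖C - -C‖₊ / 2) ^ 2 : NNReal) : ℝ) = C ^ 2 := by
    push_cast
    rw [Real.norm_eq_abs, sub_neg_eq_add, div_pow, sq_abs]; ring
  have hsub' : ∀ i : ι, HasSubgaussianMGF (fun u : ι → 𝒲 => g (u i) - ∫ x, g x ∂μ)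
      ((‖C - -C‖₊ / 2) ^ 2) ν := fun i => by
    have hp := measurePreserving_eval (fun _ : ι => μ) i
    refine HasSubgaussianMGF.of_map (Y := fun u : ι → 𝒲 => u i)
      (X := fun x => g x - ∫ x, g x ∂μ) hp.measurable.aemeasurable ?_
    rw [show Measure.map (fun u : ι → 𝒲 => u i) ν = μ from hp.map_eq]
    exact hsub
  have hind : iIndepFun (fun (i : ι) (u : ι → 𝒲) => g (u i) - ∫ x, g x ∂μ) ν :=
    iIndepFun_comp_eval μ (g := fun x => g x - ∫ x, g x ∂μ) (hg.sub_const _)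
  have hind' : iIndepFun (fun (i : ι) (u : ι → 𝒲) => -(g (u i) - ∫ x, g x ∂μ)) ν :=
    iIndepFun_comp_eval μ (g := fun x => -(g x - ∫ x, g x ∂μ)) (hg.sub_const _).neg
  -- An empty block is set apart: its exponent is a division by zero, equal to `0`, and the
  -- comparison with `N` fails. The event itself is then empty, because its inequality is strict and
  -- `0 ≤ t`.
  have key : Real.exp (-t ^ 2 / (2 * ((∑ i ∈ B, (‖C - -C‖₊ / 2) ^ 2 : NNReal) : ℝ)))
      ≤ Real.exp (-t ^ 2 / (2 * (N * C ^ 2))) ∨ #B = 0 := by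
    rcases Nat.eq_zero_or_pos #B with h0 | h0
    · exact Or.inr h0
    · left
      rw [NNReal.coe_sum, hc, Finset.sum_const, nsmul_eq_mul]
      refine Real.exp_le_exp.2 ?_
      rw [neg_div, neg_div, neg_le_neg_iff]
      have : (0 : ℝ) < #B := by exact_mod_cast h0
      gcongr
  rcases key with key | h0
  · have h1 := HasSubgaussianMGF.measure_sum_ge_le_of_iIndepFun hind (s := B)
      (fun i _ => hsub' i) ht
    have h2 := HasSubgaussianMGF.measure_sum_ge_le_of_iIndepFun hind' (s := B)
      (fun i _ => (hsub' i).neg) ht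
    rw [← ofReal_measureReal]
    refine ENNReal.ofReal_le_ofReal ?_
    calc ν.real {u | t < |∑ i ∈ B, (g (u i) - ∫ x, g x ∂μ)|}
        ≤ ν.real ({u | t ≤ ∑ i ∈ B, (g (u i) - ∫ x, g x ∂μ)} ∪
            {u | t ≤ ∑ i ∈ B, -(g (u i) - ∫ x, g x ∂μ)}) := by
          refine measureReal_mono fun u hu => ?_
          rcases lt_abs.1 (show t < |_| from hu) with h | h
          · exact Or.inl h.le
          · right
            simp only [Set.mem_ofPred_eq, Finset.sum_neg_distrib]
            exact h.le
      _ ≤ _ := measureReal_union_le _ _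
      _ ≤ _ := by
          rw [two_mul]
          exact add_le_add (h1.trans key) (h2.trans key)
  · rw [Finset.card_eq_zero] at h0
    subst h0
    have : {u : ι → 𝒲 | t < |∑ i ∈ (∅ : Finset ι), (g (u i) - ∫ x, g x ∂μ)|} = ∅ := by
      ext u; simp [ht]
    rw [this]; simp

variable [DecidableEq ι] (B : Finset ι)

omit [Fintype ι] in
theorem measurable_piecewise_prod :
    Measurable fun x : (ι → 𝒲) × (ι → 𝒲) => B.piecewise x.2 x.1 := by
  refine measurable_pi_lambda _ fun i => ?_
  by_cases hi : i ∈ B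
  · simp only [Finset.piecewise, hi, if_true]; fun_prop
  · simp only [Finset.piecewise, hi, if_false]; fun_prop

/-- Replacing the coordinates in `B` by those of an independent copy preserves the product
measure. -/
theorem measurePreserving_piecewise_pi :
    MeasurePreserving (fun x : (ι → 𝒲) × (ι → 𝒲) => B.piecewise x.2 x.1)
      ((Measure.pi fun _ => μ).prod (Measure.pi fun _ => μ)) (Measure.pi fun _ => μ) := by
  refine ⟨measurable_piecewise_prod B, (Measure.pi_eq fun s hs => ?_).symm⟩
  rw [Measure.map_apply (measurable_piecewise_prod B) (MeasurableSet.univ_pi hs)]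
  have h : (fun x : (ι → 𝒲) × (ι → 𝒲) => B.piecewise x.2 x.1) ⁻¹' Set.univ.pi s
      = (Set.univ.pi fun i => if i ∈ B then Set.univ else s i) ×ˢ
        (Set.univ.pi fun i => if i ∈ B then s i else Set.univ) := by
    ext x
    simp only [Set.mem_preimage, Set.mem_pi, Set.mem_univ, true_imp_iff, Set.mem_prod,
      ← forall_and]
    refine forall_congr' fun i => ?_
    by_cases hi : i ∈ B <;> simp [Finset.piecewise, hi]
  rw [h, Measure.prod_prod, Measure.pi_pi, Measure.pi_pi, ← Finset.prod_mul_distrib]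
  refine Finset.prod_congr rfl fun i _ => ?_
  by_cases hi : i ∈ B <;> simp [hi]

/-- A bound on the probability of an event given the coordinates outside `B` holds
unconditionally. -/
theorem pi_measure_le_of_forall_piecewise {A : Set (ι → 𝒲)} (hA : MeasurableSet A) {ε : ℝ≥0∞}
    (h : ∀ w, (Measure.pi fun _ => μ) {u : ι → 𝒲 | B.piecewise u w ∈ A} ≤ ε) :
    (Measure.pi fun _ => μ) A ≤ ε := by
  have hp := measurePreserving_piecewise_pi μ B
  -- Fubini on the pair of copies: `w` is frozen and `u` refreshes the coordinates in `B`.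
  rw [← hp.measure_preimage hA.nullMeasurableSet, Measure.prod_apply (hp.measurable hA)]
  calc ∫⁻ w, (Measure.pi fun _ => μ)
        (Prod.mk w ⁻¹' ((fun x : (ι → 𝒲) × (ι → 𝒲) => B.piecewise x.2 x.1) ⁻¹' A))
        ∂(Measure.pi fun _ => μ)
      ≤ ∫⁻ _, ε ∂(Measure.pi fun _ => μ) := lintegral_mono fun w => h w
    _ = ε := by simp

variable {B}

/-- Chebyshev's inequality for a block sum of a function estimated on the complementary
block. -/
theorem pi_measure_le_abs_sum_le {F : (ι → 𝒲) → 𝒲 → ℝ}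
    (hFm : Measurable fun s : (ι → 𝒲) × 𝒲 => F s.1 s.2) (hF : DependsOn F (B : Set ι)ᶜ)
    {A : Set (ι → 𝒲)} (hAm : MeasurableSet A) (hA : DependsOn (· ∈ A) (B : Set ι)ᶜ)
    {v b t : ℝ} (ht : 0 < t)
    (h : ∀ w ∈ A, MemLp (F w) 2 μ ∧ ∫ x, F w x ^ 2 ∂μ ≤ v ∧ |∫ x, F w x ∂μ| ≤ b) :
    (Measure.pi fun _ : ι => μ) {w | w ∈ A ∧ t ≤ |∑ i ∈ B, F w (w i)|}
      ≤ ENNReal.ofReal ((#B * v + (#B * b) ^ 2) / t ^ 2) := by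
  refine pi_measure_le_of_forall_piecewise μ B ?_ fun w => ?_
  · refine hAm.inter (s₂ := {w | t ≤ |∑ i ∈ B, F w (w i)|}) (measurableSet_le measurable_const ?_)
    refine (Finset.measurable_fun_sum _ fun i _ => ?_).abs
    exact hFm.comp (measurable_id.prodMk (measurable_pi_apply i))
  -- Neither `F` nor `A` sees the block, so refreshing it leaves the function `F w` fixed and only
  -- replaces its arguments by independent draws.
  · have hF' : ∀ u : ι → 𝒲, F (B.piecewise u w) = F w := fun u =>
      hF fun i hi => Finset.piecewise_eq_of_notMem _ _ _ hi
    have hA' : ∀ u : ι → 𝒲, (B.piecewise u w ∈ A) = (w ∈ A) := fun u =>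
      hA fun i hi => Finset.piecewise_eq_of_notMem _ _ _ hi
    by_cases hw : w ∈ A
    · obtain ⟨h1, h2, h3⟩ := h w hw
      refine le_trans (measure_mono fun u hu => ?_) (measure_le_abs_sum_le μ h1 h2 h3 B ht)
      have := hu.2
      rw [hF' u] at this
      refine this.trans_eq ?_
      rw [Finset.sum_congr rfl fun i hi => by rw [Finset.piecewise_eq_of_mem _ _ _ hi]]
    · have : {u : ι → 𝒲 | B.piecewise u w ∈ {w | w ∈ A ∧ t ≤ |∑ i ∈ B, F w (w i)|}} = ∅ := by
        ext u
        simp [hA' u, hw]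
      rw [this]; simp

/-- Hoeffding's inequality and a union bound for block sums of finitely many functions estimated
on the complementary block. -/
theorem pi_measure_exists_lt_abs_sum_sub_le {J : Type*} [Fintype J] {F : J → (ι → 𝒲) → 𝒲 → ℝ}
    (hFm : ∀ j, Measurable fun s : (ι → 𝒲) × 𝒲 => F j s.1 s.2)
    (hF : ∀ j, DependsOn (F j) (B : Set ι)ᶜ)
    {A : Set (ι → 𝒲)} (hAm : MeasurableSet A) (hA : DependsOn (· ∈ A) (B : Set ι)ᶜ)
    {C t : ℝ} (hC : 0 < C) (ht : 0 ≤ t) {N : ℕ} (hN : #B ≤ N)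
    (h : ∀ w ∈ A, ∀ᵐ x ∂μ, ∀ j, |F j w x| ≤ C) :
    (Measure.pi fun _ : ι => μ)
        {w | w ∈ A ∧ ∃ j, t < |∑ i ∈ B, (F j w (w i) - ∫ x, F j w x ∂μ)|}
      ≤ Fintype.card J * ENNReal.ofReal (2 * Real.exp (-t ^ 2 / (2 * (N * C ^ 2)))) := by
  have hset : {w | w ∈ A ∧ ∃ j, t < |∑ i ∈ B, (F j w (w i) - ∫ x, F j w x ∂μ)|}
      ⊆ ⋃ j, {w | w ∈ A ∧ t < |∑ i ∈ B, (F j w (w i) - ∫ x, F j w x ∂μ)|} := by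
    rintro w ⟨h1, j, h2⟩
    exact Set.mem_iUnion.2 ⟨j, h1, h2⟩
  refine (measure_mono hset).trans ((measure_iUnion_fintype_le _ _).trans ?_)
  rw [← nsmul_eq_mul]
  refine Finset.sum_le_card_nsmul _ _ _ fun j _ => ?_
  refine pi_measure_le_of_forall_piecewise μ B ?_ fun w => ?_
  · refine hAm.inter (s₂ := {w | t < |∑ i ∈ B, (F j w (w i) - ∫ x, F j w x ∂μ)|})
      (measurableSet_lt measurable_const ?_)
    refine (Finset.measurable_fun_sum _ fun i _ => ?_).abs
    refine ((hFm j).comp (measurable_id.prodMk (measurable_pi_apply i))).sub ?_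
    exact ((hFm j).stronglyMeasurable.integral_prod_right (ν := μ)).measurable
  · have hF' : ∀ u : ι → 𝒲, F j (B.piecewise u w) = F j w := fun u =>
      hF j fun i hi => Finset.piecewise_eq_of_notMem _ _ _ hi
    have hA' : ∀ u : ι → 𝒲, (B.piecewise u w ∈ A) = (w ∈ A) := fun u =>
      hA fun i hi => Finset.piecewise_eq_of_notMem _ _ _ hi
    by_cases hw : w ∈ A
    · refine le_trans (measure_mono fun u hu => ?_)
        (measure_lt_abs_sum_sub_le μ (g := F j w) ?_ hC ?_ B hN ht)
      · have := hu.2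
        simp only [hF' u] at this
        refine this.trans_eq ?_
        rw [Finset.sum_congr rfl fun i hi => by rw [Finset.piecewise_eq_of_mem _ _ _ hi]]
      · exact ((hFm j).comp (measurable_const.prodMk measurable_id)).aemeasurable
      · filter_upwards [h w hw] with x hx using hx j
    · have : {u : ι → 𝒲 | B.piecewise u w ∈
          {w | w ∈ A ∧ t < |∑ i ∈ B, (F j w (w i) - ∫ x, F j w x ∂μ)|}} = ∅ := by
        ext u
        simp [hA' u, hw]
      rw [this]; simp

/-- Markov's inequality for a block sum of squares of a function estimated on the complementary
block. -/
theorem pi_measure_le_sum_sq_le {F : (ι → 𝒲) → 𝒲 → ℝ}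
    (hFm : Measurable fun s : (ι → 𝒲) × 𝒲 => F s.1 s.2) (hF : DependsOn F (B : Set ι)ᶜ)
    {A : Set (ι → 𝒲)} (hAm : MeasurableSet A) (hA : DependsOn (· ∈ A) (B : Set ι)ᶜ)
    {v t : ℝ} (ht : 0 < t) (h : ∀ w ∈ A, MemLp (F w) 2 μ ∧ ∫ x, F w x ^ 2 ∂μ ≤ v) :
    (Measure.pi fun _ : ι => μ) {w | w ∈ A ∧ t ≤ ∑ i ∈ B, F w (w i) ^ 2}
      ≤ ENNReal.ofReal (#B * v / t) := by
  refine pi_measure_le_of_forall_piecewise μ B ?_ fun w => ?_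
  · refine hAm.inter (s₂ := {w | t ≤ ∑ i ∈ B, F w (w i) ^ 2})
      (measurableSet_le measurable_const ?_)
    refine Finset.measurable_fun_sum _ fun i _ => ?_
    exact (hFm.comp (measurable_id.prodMk (measurable_pi_apply i))).pow_const 2
  · have hF' : ∀ u : ι → 𝒲, F (B.piecewise u w) = F w := fun u =>
      hF fun i hi => Finset.piecewise_eq_of_notMem _ _ _ hi
    have hA' : ∀ u : ι → 𝒲, (B.piecewise u w ∈ A) = (w ∈ A) := fun u =>
      hA fun i hi => Finset.piecewise_eq_of_notMem _ _ _ hi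
    by_cases hw : w ∈ A
    · obtain ⟨h1, h2⟩ := h w hw
      have hint : ∀ i, Integrable (fun u : ι → 𝒲 => F w (u i) ^ 2) (Measure.pi fun _ => μ) :=
        fun i => (memLp_comp_eval μ h1 i).integrable_sq
      have hM := mul_meas_ge_le_integral_of_nonneg (μ := Measure.pi fun _ : ι => μ)
        (f := fun u : ι → 𝒲 => ∑ i ∈ B, F w (u i) ^ 2)
        (ae_of_all _ fun u => Finset.sum_nonneg fun i _ => sq_nonneg _)
        (integrable_finsetSum _ fun i _ => hint i) t
      have hE : ∫ u : ι → 𝒲, ∑ i ∈ B, F w (u i) ^ 2 ∂(Measure.pi fun _ => μ) ≤ #B * v := by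
        rw [integral_finsetSum _ fun i _ => hint i, ← nsmul_eq_mul]
        refine Finset.sum_le_card_nsmul _ _ _ fun i _ => ?_
        exact (integral_comp_eval μ (g := fun x => F w x ^ 2) (h1.1.pow 2) i).le.trans h2
      have hP : (Measure.pi fun _ : ι => μ) {u | t ≤ ∑ i ∈ B, F w (u i) ^ 2}
          ≤ ENNReal.ofReal (#B * v / t) := by
        rw [← ofReal_measureReal]
        refine ENNReal.ofReal_le_ofReal ?_
        rw [le_div_iff₀ ht, mul_comm]
        exact hM.trans hE
      refine le_trans (measure_mono fun u hu => ?_) hP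
      have := hu.2
      rw [hF' u] at this
      refine this.trans_eq ?_
      rw [Finset.sum_congr rfl fun i hi => by rw [Finset.piecewise_eq_of_mem _ _ _ hi]]
    · have : {u : ι → 𝒲 | B.piecewise u w ∈ {w | w ∈ A ∧ t ≤ ∑ i ∈ B, F w (w i) ^ 2}} = ∅ := by
        ext u
        simp [hA' u, hw]
      rw [this]; simp

end Blocks

/-! ### Deterministic bounds for the penalized criterion -/

section Deterministic

theorem sum_abs_le_rowSumNorm {q r : ℕ} (A : Matrix (Fin q) (Fin r) ℝ) (i : Fin q) :
    ∑ j, |A i j| ≤ rowSumNorm A :=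
  le_ciSup (f := fun i => ∑ j, |A i j|) (Set.finite_range _).bddAbove i

theorem rowSumNorm_nonneg {q r : ℕ} (A : Matrix (Fin q) (Fin r) ℝ) : 0 ≤ rowSumNorm A :=
  Real.iSup_nonneg fun _ => Finset.sum_nonneg fun _ _ => abs_nonneg _

theorem rowSumNorm_le_add {q r : ℕ} (A B : Matrix (Fin q) (Fin r) ℝ) :
    rowSumNorm A ≤ rowSumNorm (A - B) + rowSumNorm B := by
  refine Real.iSup_le (fun i => ?_) (add_nonneg (rowSumNorm_nonneg _) (rowSumNorm_nonneg _))
  refine le_trans ?_ (add_le_add (sum_abs_le_rowSumNorm (A - B) i) (sum_abs_le_rowSumNorm B i))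
  rw [← Finset.sum_add_distrib]
  refine Finset.sum_le_sum fun j _ => ?_
  simpa using abs_add_le (A i j - B i j) (B i j)

theorem abs_mulVec_le {q r : ℕ} (A : Matrix (Fin q) (Fin r) ℝ) {x : Fin r → ℝ} {X : ℝ}
    (hX : 0 ≤ X) (hx : ∀ j, |x j| ≤ X) (i : Fin q) : |(A *ᵥ x) i| ≤ rowSumNorm A * X := by
  calc |(A *ᵥ x) i| ≤ ∑ j, |A i j * x j| := by
        simp only [Matrix.mulVec, dotProduct]; exact Finset.abs_sum_le_sum_abs _ _
    _ ≤ ∑ j, |A i j| * X := by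
        refine Finset.sum_le_sum fun j _ => ?_
        rw [abs_mul]
        exact mul_le_mul_of_nonneg_left (hx j) (abs_nonneg _)
    _ = (∑ j, |A i j|) * X := by rw [Finset.sum_mul]
    _ ≤ _ := mul_le_mul_of_nonneg_right (sum_abs_le_rowSumNorm A i) hX

/-- A normalized bilinear form is bounded by the row sum norm and the sup norms. -/
theorem abs_dotProduct_smul_mulVec_le {q : ℕ} (A : Matrix (Fin q) (Fin q) ℝ) {x y : Fin q → ℝ}
    {X Y : ℝ} (hX : 0 ≤ X) (hY : 0 ≤ Y) (hx : ∀ j, |x j| ≤ X) (hy : ∀ j, |y j| ≤ Y) :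
    |x ⬝ᵥ (((q : ℝ)⁻¹ • A) *ᵥ y)| ≤ X * rowSumNorm A * Y := by
  have hA := rowSumNorm_nonneg A
  rw [Matrix.smul_mulVec, dotProduct_smul, smul_eq_mul, abs_mul, abs_of_nonneg (by positivity)]
  rcases Nat.eq_zero_or_pos q with rfl | hq
  · simp; positivity
  have hq' : (0 : ℝ) < q := by exact_mod_cast hq
  -- Each of the `q` rows contributes at most `X * rowSumNorm A * Y`; the normalization cancels
  -- their number, so the bound is free of the dimension.
  rw [inv_mul_le_iff₀ hq']
  calc |x ⬝ᵥ (A *ᵥ y)| ≤ ∑ i, |x i * (A *ᵥ y) i| := Finset.abs_sum_le_sum_abs _ _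
    _ ≤ ∑ _i : Fin q, X * (rowSumNorm A * Y) := by
        refine Finset.sum_le_sum fun i _ => ?_
        rw [abs_mul]
        exact mul_le_mul (hx i) (abs_mulVec_le A hY hy i) (abs_nonneg _) hX
    _ = q * (X * rowSumNorm A * Y) := by simp [mul_assoc]

theorem abs_mulVec_le_of_entries {q p : ℕ} (G : Matrix (Fin q) (Fin p) ℝ) {g : ℝ}
    (hg : ∀ j k, |G j k| ≤ g) (δ : Fin p → ℝ) (j : Fin q) :
    |(G *ᵥ δ) j| ≤ g * ∑ k, |δ k| := by
  calc |(G *ᵥ δ) j| ≤ ∑ k, |G j k * δ k| := by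
        simp only [Matrix.mulVec, dotProduct]; exact Finset.abs_sum_le_sum_abs _ _
    _ ≤ ∑ k, g * |δ k| := by
        refine Finset.sum_le_sum fun k _ => ?_
        rw [abs_mul]
        exact mul_le_mul_of_nonneg_right (hg j k) (abs_nonneg _)
    _ = _ := by rw [Finset.mul_sum]

/-- Perturbation of the quadratic form `δ' G' (A / q) G δ`. -/
theorem abs_quadForm_sub_le {q p : ℕ} (A B : Matrix (Fin q) (Fin q) ℝ)
    (G H : Matrix (Fin q) (Fin p) ℝ) {K g a o : ℝ} (hK : 0 ≤ K) (hg0 : 0 ≤ g)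
    (hG : ∀ j k, |G j k| ≤ K) (hH : ∀ j k, |H j k| ≤ K) (hGH : ∀ j k, |(G - H) j k| ≤ g)
    (hA : rowSumNorm A ≤ a) (hB : rowSumNorm B ≤ a) (hAB : rowSumNorm (A - B) ≤ o)
    (δ : Fin p → ℝ) :
    |(G *ᵥ δ) ⬝ᵥ (((q : ℝ)⁻¹ • A) *ᵥ (G *ᵥ δ)) - (H *ᵥ δ) ⬝ᵥ (((q : ℝ)⁻¹ • B) *ᵥ (H *ᵥ δ))|
      ≤ (2 * g * a * K + K * o * K) * (∑ k, |δ k|) ^ 2 := by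
  set t := ∑ k, |δ k| with ht
  have ht0 : 0 ≤ t := Finset.sum_nonneg fun _ _ => abs_nonneg _
  -- Telescoping: the left factor, the weight and the right factor are exchanged one at a time.
  have e1 : (G *ᵥ δ) ⬝ᵥ (((q : ℝ)⁻¹ • A) *ᵥ (G *ᵥ δ))
      - (H *ᵥ δ) ⬝ᵥ (((q : ℝ)⁻¹ • B) *ᵥ (H *ᵥ δ))
      = ((G - H) *ᵥ δ) ⬝ᵥ (((q : ℝ)⁻¹ • A) *ᵥ (G *ᵥ δ))
        + (H *ᵥ δ) ⬝ᵥ (((q : ℝ)⁻¹ • (A - B)) *ᵥ (G *ᵥ δ))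
        + (H *ᵥ δ) ⬝ᵥ (((q : ℝ)⁻¹ • B) *ᵥ ((G - H) *ᵥ δ)) := by
    simp only [Matrix.sub_mulVec, smul_sub, sub_dotProduct, dotProduct_sub, Matrix.mulVec_sub]
    ring
  have b1 := abs_dotProduct_smul_mulVec_le A (mul_nonneg hg0 ht0) (mul_nonneg hK ht0)
    (abs_mulVec_le_of_entries (G - H) hGH δ) (abs_mulVec_le_of_entries G hG δ)
  have b2 := abs_dotProduct_smul_mulVec_le (A - B) (mul_nonneg hK ht0) (mul_nonneg hK ht0)
    (abs_mulVec_le_of_entries H hH δ) (abs_mulVec_le_of_entries G hG δ)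
  have b3 := abs_dotProduct_smul_mulVec_le B (mul_nonneg hK ht0) (mul_nonneg hg0 ht0)
    (abs_mulVec_le_of_entries H hH δ) (abs_mulVec_le_of_entries (G - H) hGH δ)
  have c1 : g * t * rowSumNorm A * (K * t) ≤ g * t * a * (K * t) := by gcongr
  have c2 : K * t * rowSumNorm (A - B) * (K * t) ≤ K * t * o * (K * t) := by gcongr
  have c3 : K * t * rowSumNorm B * (g * t) ≤ K * t * a * (g * t) := by gcongr
  rw [e1]
  refine (abs_add_three _ _ _).trans ?_
  calc _ ≤ g * t * a * (K * t) + K * t * o * (K * t) + K * t * a * (g * t) := by linarith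
    _ = _ := by ring

/-- Oracle inequality in `ℓ₁` for a minimizer of a quadratic criterion with `ℓ₁` penalty, under a
restricted eigenvalue condition. -/
theorem sum_abs_sub_le_of_isMinimizer {p q : ℕ} {T : Matrix (Fin q) (Fin q) ℝ}
    (hT : T.PosSemidef) {M v₁ v₂ : Fin q → ℝ} {G : Matrix (Fin q) (Fin p) ℝ}
    {ρ₀ ρ : Fin p → ℝ} {lam c e : ℝ} {s : ℕ} (hlam : 0 < lam) (hc : 0 < c) (he : 0 ≤ e)
    (hs1 : 1 ≤ s)
    (hmin : (M - G *ᵥ ρ) ⬝ᵥ (T *ᵥ (M - G *ᵥ ρ)) + 2 * lam * ∑ k, |ρ k|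
      ≤ (M - G *ᵥ ρ₀) ⬝ᵥ (T *ᵥ (M - G *ᵥ ρ₀)) + 2 * lam * ∑ k, |ρ₀ k|)
    (hv : M - G *ᵥ ρ₀ = v₁ + v₂)
    (h₁ : ∀ δ : Fin p → ℝ, |(G *ᵥ δ) ⬝ᵥ (T *ᵥ v₁)| ≤ lam / 8 * ∑ k, |δ k|)
    (h₂ : v₂ ⬝ᵥ (T *ᵥ v₂) ≤ e * s * lam ^ 2)
    (hs : (Finset.univ.filter fun k => ρ₀ k ≠ 0).card ≤ s)
    (hRE : ∀ (S : Finset (Fin p)) (δ : Fin p → ℝ), S.card ≤ s →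
      ∑ j ∈ Sᶜ, |δ j| ≤ 3 * ∑ j ∈ S, |δ j| →
      c * ∑ j ∈ S, δ j ^ 2 - c / (32 * s) * (∑ k, |δ k|) ^ 2 ≤ (G *ᵥ δ) ⬝ᵥ (T *ᵥ (G *ᵥ δ))) :
    ∑ k, |ρ k - ρ₀ k| ≤ (8 * e + 160 / c) * (s * lam) := by
  have hs0 : (0 : ℝ) < s := by exact_mod_cast hs1
  have hsymm : ∀ x y : Fin q → ℝ, x ⬝ᵥ (T *ᵥ y) = y ⬝ᵥ (T *ᵥ x) := fun x y => by
    have hT' : Tᵀ = T := by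
      rw [← Matrix.conjTranspose_eq_transpose_of_trivial]; exact hT.1
    rw [Matrix.dotProduct_mulVec, dotProduct_comm, ← Matrix.mulVec_transpose, hT']
  have hpos : ∀ x : Fin q → ℝ, 0 ≤ x ⬝ᵥ (T *ᵥ x) := fun x => by
    simpa using hT.dotProduct_mulVec_nonneg x
  set δ : Fin p → ℝ := ρ - ρ₀ with hδ
  have hδk : ∀ k, ρ k - ρ₀ k = δ k := fun k => rfl
  simp only [hδk]
  set t := ∑ k, |δ k| with ht
  have ht0 : 0 ≤ t := Finset.sum_nonneg fun _ _ => abs_nonneg _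
  set x := G *ᵥ δ with hx
  set Q := x ⬝ᵥ (T *ᵥ x) with hQ
  have hQ0 : 0 ≤ Q := hpos x
  have hMρ : M - G *ᵥ ρ = v₁ + v₂ - x := by
    rw [← hv, hx, hδ, Matrix.mulVec_sub]; abel
  rw [hMρ, hv] at hmin
  have hexp : (v₁ + v₂ - x) ⬝ᵥ (T *ᵥ (v₁ + v₂ - x))
      = (v₁ + v₂) ⬝ᵥ (T *ᵥ (v₁ + v₂)) - 2 * (x ⬝ᵥ (T *ᵥ v₁)) - 2 * (x ⬝ᵥ (T *ᵥ v₂)) + Q := by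
    simp only [Matrix.mulVec_sub, Matrix.mulVec_add, sub_dotProduct, dotProduct_sub,
      dotProduct_add, add_dotProduct, hQ]
    rw [hsymm v₁ x, hsymm v₂ x]
    ring
  rw [hexp] at hmin
  have hx1 := (abs_le.1 (h₁ δ)).2
  -- Young's inequality in the seminorm of `T`, from `0 ≤ (x - 2 v₂)' T (x - 2 v₂)`. Half of `Q`
  -- absorbs the cross term, so `v₂` never has to compete with the penalty.
  have hx2 : 2 * (x ⬝ᵥ (T *ᵥ v₂)) ≤ Q / 2 + 2 * (v₂ ⬝ᵥ (T *ᵥ v₂)) := by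
    have := hpos (x - (2 : ℝ) • v₂)
    simp only [Matrix.mulVec_sub, sub_dotProduct, dotProduct_sub, Matrix.mulVec_smul,
      dotProduct_smul, smul_dotProduct, smul_eq_mul] at this
    rw [hsymm v₂ x] at this
    linarith
  have hbasic : Q / 2 + 2 * lam * ∑ k, |ρ k|
      ≤ 2 * lam * ∑ k, |ρ₀ k| + lam / 4 * t + 2 * (e * s * lam ^ 2) := by
    linarith
  -- Either the approximation error dominates, and `t` is bounded at once, or it is absorbed by a
  -- second `lam / 4 * t`.
  by_cases hcase : lam / 4 * t ≤ 2 * (e * s * lam ^ 2)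
  · have h1 : t ≤ 8 * e * (s * lam) := by
      have : lam * t ≤ lam * (8 * e * (s * lam)) := by nlinarith
      exact le_of_mul_le_mul_left this hlam
    have h2 : 0 ≤ 160 / c * (s * lam) := by positivity
    linarith
  · push Not at hcase
    have hbasic2 : Q / 2 + 2 * lam * ∑ k, |ρ k| ≤ 2 * lam * ∑ k, |ρ₀ k| + lam / 2 * t := by
      linarith
    set S := Finset.univ.filter fun k => ρ₀ k ≠ 0 with hS
    have hsplit : t = ∑ k ∈ S, |δ k| + ∑ k ∈ Sᶜ, |δ k| := (Finset.sum_add_sum_compl S _).symm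
    have hρ : ∑ k, |ρ₀ k| - ∑ k ∈ S, |δ k| + ∑ k ∈ Sᶜ, |δ k| ≤ ∑ k, |ρ k| := by
      rw [← Finset.sum_add_sum_compl S fun k => |ρ₀ k|,
        ← Finset.sum_add_sum_compl S fun k => |ρ k|]
      have z : ∀ k ∈ Sᶜ, ρ₀ k = 0 := fun k hk => by
        simpa [hS] using hk
      have z1 : ∑ k ∈ Sᶜ, |ρ₀ k| = 0 := Finset.sum_eq_zero fun k hk => by simp [z k hk]
      have z2 : ∑ k ∈ Sᶜ, |δ k| = ∑ k ∈ Sᶜ, |ρ k| := Finset.sum_congr rfl fun k hk => by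
        simp [hδ, z k hk]
      have z3 : ∑ k ∈ S, |ρ₀ k| ≤ ∑ k ∈ S, |ρ k| + ∑ k ∈ S, |δ k| := by
        rw [← Finset.sum_add_distrib]
        refine Finset.sum_le_sum fun k _ => ?_
        have := abs_sub_abs_le_abs_sub (ρ₀ k) (ρ k)
        rw [abs_sub_comm] at this
        have e : |ρ k - ρ₀ k| = |δ k| := rfl
        linarith
      linarith
    set a := ∑ k ∈ S, |δ k| with ha
    set b := ∑ k ∈ Sᶜ, |δ k| with hb
    have hb0 : 0 ≤ b := Finset.sum_nonneg fun _ _ => abs_nonneg _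
    have ha0 : 0 ≤ a := Finset.sum_nonneg fun _ _ => abs_nonneg _
    have hlρ := mul_le_mul_of_nonneg_left hρ (by positivity : 0 ≤ 2 * lam)
    have hmain : Q / 2 + 2 * lam * b ≤ 2 * lam * a + lam / 2 * t := by
      rw [mul_add, mul_sub] at hlρ
      linarith
    -- From `2 b ≤ 2 a + (a + b) / 2` one even gets `b ≤ 5 / 3 * a`; the cone constant `3` leaves
    -- slack.
    have hcone : b ≤ 3 * a := by
      have : lam * (3 / 2 * b) ≤ lam * (5 / 2 * a) := by
        rw [hsplit] at hmain; nlinarith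
      have := le_of_mul_le_mul_left this hlam
      linarith
    have hre := hRE S δ hs hcone
    have hcs : a ^ 2 ≤ s * ∑ j ∈ S, δ j ^ 2 := by
      have := sq_sum_le_card_mul_sum_sq (s := S) (f := fun k => |δ k|)
      simp only [sq_abs] at this
      refine this.trans ?_
      have : (#S : ℝ) ≤ s := by exact_mod_cast hs
      gcongr
    have hta : t ≤ 4 * a := by linarith
    have hta2 : t ^ 2 ≤ 16 * a ^ 2 := by nlinarith
    -- On the cone `t ≤ 4 a`, and Cauchy–Schwarz on `S` gives `a ^ 2 ≤ s * ∑ δ j ^ 2`. The curvature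
    -- is thus at least `c / (16 s) * t ^ 2`, twice the loss `c / (32 s) * t ^ 2` allowed in `hRE`.
    have h3 : c / (16 * s) * t ^ 2 ≤ c * ∑ j ∈ S, δ j ^ 2 := by
      rw [div_mul_eq_mul_div, div_le_iff₀ (by positivity)]
      calc c * t ^ 2 ≤ c * (16 * (s * ∑ j ∈ S, δ j ^ 2)) := by
            gcongr; exact hta2.trans (by gcongr)
        _ = (c * ∑ j ∈ S, δ j ^ 2) * (16 * s) := by ring
    have h4 : c / (32 * s) * t ^ 2 ≤ Q := by
      have : c / (16 * s) * t ^ 2 = 2 * (c / (32 * s) * t ^ 2) := by field_simp; ring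
      linarith
    have h5 : Q / 2 ≤ 5 / 2 * lam * t := by
      have : 2 * lam * a ≤ 2 * lam * t := by
        have : a ≤ t := by linarith
        gcongr
      have : 0 ≤ lam * b := by positivity
      linarith
    -- `160 = 5 * 32`: the upper bound `Q ≤ 5 lam t` meets the lower bound `c / (32 s) * t ^ 2 ≤ Q`.
    have h6 : c * t * t ≤ 160 * (s * lam) * t := by
      have : c / (32 * s) * t ^ 2 ≤ 5 * lam * t := by linarith
      rw [div_mul_eq_mul_div, div_le_iff₀ (by positivity)] at this
      calc c * t * t = c * t ^ 2 := by ring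
        _ ≤ 5 * lam * t * (32 * s) := this
        _ = 160 * (s * lam) * t := by ring
    have h7 : t ≤ 160 / c * (s * lam) := by
      rcases ht0.eq_or_lt with h | h
      · rw [← h]; positivity
      · have := le_of_mul_le_mul_right h6 h
        rw [div_mul_eq_mul_div, le_div_iff₀ hc]
        linarith
    have h8 : 0 ≤ 8 * e * (s * lam) := by positivity
    linarith

/-- A lower bound on the restricted eigenvalue bounds the quadratic form on the cone. -/
theorem mul_sum_sq_le_of_le_restrictedEigenvalueSq {p : ℕ} {A : Matrix (Fin p) (Fin p) ℝ}
    {s : ℕ} {c : ℝ} (h : (c : EReal) ≤ restrictedEigenvalueSq A s) {S : Finset (Fin p)}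
    {δ : Fin p → ℝ} (hS : S.card ≤ s) (hδ : ∑ j ∈ Sᶜ, |δ j| ≤ 3 * ∑ j ∈ S, |δ j|) :
    c * ∑ j ∈ S, δ j ^ 2 ≤ δ ⬝ᵥ (A *ᵥ δ) := by
  by_cases h0 : δ = 0
  · subst h0; simp
  have hle : (c : EReal) ≤ (((δ ⬝ᵥ (A *ᵥ δ)) / ∑ j ∈ S, δ j ^ 2 : ℝ) : EReal) :=
    h.trans (iInf₂_le_of_le S δ (iInf_le_of_le ⟨hS, h0, hδ⟩ le_rfl))
  have hle' := EReal.coe_le_coe_iff.1 hle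
  -- The quotient is genuine: if `δ` vanishes on `S`, the cone condition makes it vanish off `S` as
  -- well.
  have hpos : 0 < ∑ j ∈ S, δ j ^ 2 := by
    refine (Finset.sum_nonneg fun _ _ => sq_nonneg _).lt_of_ne' fun hz => h0 ?_
    have hz' := (Finset.sum_eq_zero_iff_of_nonneg fun j _ => sq_nonneg (δ j)).1 hz
    have hzS : ∀ j ∈ S, |δ j| = 0 := fun j hj => by simpa using hz' j hj
    rw [Finset.sum_eq_zero hzS, mul_zero] at hδ
    have hzc := (Finset.sum_eq_zero_iff_of_nonneg fun j _ => abs_nonneg (δ j)).1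
      (le_antisymm hδ (Finset.sum_nonneg fun _ _ => abs_nonneg _))
    ext j
    by_cases hj : j ∈ S
    · exact abs_eq_zero.1 (hzS j hj)
    · exact abs_eq_zero.1 (hzc j (by simpa using hj))
  exact (le_div_iff₀ hpos).1 hle'

end Deterministic

/-! ### Population bounds -/

section PopulationBounds

theorem MemLp.two_mul_of_ae_bound {α : Type*} [MeasurableSpace α] {μ : Measure α} {f g : α → ℝ}
    (hg : MemLp g 2 μ) (hf : AEStronglyMeasurable f μ) {K : ℝ} (hK : ∀ᵐ x ∂μ, |f x| ≤ K) :
    MemLp (fun x => f x * g x) 2 μ :=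
  MemLp.mul (p := ∞) (q := 2) (r := 2) hg (memLp_top_of_bound hf K hK)

theorem abs_integral_mul_le_sqrt_mul_sqrt {α : Type*} [MeasurableSpace α] {μ : Measure α}
    {f g : α → ℝ} (hf : MemLp f 2 μ) (hg : MemLp g 2 μ) :
    |∫ x, f x * g x ∂μ| ≤ Real.sqrt (∫ x, f x ^ 2 ∂μ) * Real.sqrt (∫ x, g x ^ 2 ∂μ) := by
  have h := integral_mul_norm_le_Lp_mul_Lq (μ := μ) (f := f) (g := g) (p := 2) (q := 2)
    Real.HolderConjugate.two_two (by simpa using hf) (by simpa using hg)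
  simp only [Real.norm_eq_abs, Real.rpow_two, sq_abs, ← Real.sqrt_eq_rpow] at h
  refine (abs_integral_le_integral_abs).trans ?_
  simpa only [abs_mul] using h

theorem integral_mul_sq_le_of_ae_bound {α : Type*} [MeasurableSpace α] {μ : Measure α}
    {f g : α → ℝ} (hg : MemLp g 2 μ) (hf : AEStronglyMeasurable f μ) {K : ℝ}
    (hK : ∀ᵐ x ∂μ, |f x| ≤ K) :
    ∫ x, (f x * g x) ^ 2 ∂μ ≤ K ^ 2 * ∫ x, g x ^ 2 ∂μ := by
  rw [← integral_const_mul]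
  refine integral_mono_ae (MemLp.two_mul_of_ae_bound hg hf hK).integrable_sq
    (hg.integrable_sq.const_mul _) ?_
  filter_upwards [hK] with x hx
  rw [mul_pow, ← sq_abs (f x)]
  gcongr

variable {𝒳 𝒵 : Type*} [MeasurableSpace 𝒳] [MeasurableSpace 𝒵]
  {F₀ : Measure (Obs 𝒳 𝒵)}

theorem IsSquareIntegrable.memLp {f : 𝒳 → ℝ} (hf : IsSquareIntegrable F₀ f) :
    MemLp (fun w : Obs 𝒳 𝒵 => f w.2.1) 2 F₀ :=
  (memLp_two_iff_integrable_sq (hf.1.comp measurable_snd.fst).aestronglyMeasurable).2 hf.2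

theorem IsSquareIntegrable.sub {f g : 𝒳 → ℝ} (hf : IsSquareIntegrable F₀ f)
    (hg : IsSquareIntegrable F₀ g) : IsSquareIntegrable F₀ (f - g) :=
  ⟨hf.1.sub hg.1, (hf.memLp.sub hg.memLp).integrable_sq⟩

variable [IsProbabilityMeasure F₀]

theorem IsSquareIntegrable.of_ae_bound {f : 𝒳 → ℝ} (hf : Measurable f) {C : ℝ}
    (hC : ∀ᵐ w ∂F₀, |f w.2.1| ≤ C) : IsSquareIntegrable F₀ f :=
  ⟨hf, (MemLp.of_bound (p := 2)
    (hf.comp measurable_snd.fst : Measurable fun w : Obs 𝒳 𝒵 => f w.2.1).aestronglyMeasurable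
    C hC).integrable_sq⟩

theorem instrumentSigma_le :
    instrumentSigma 𝒳 𝒵 ≤ (inferInstance : MeasurableSpace (Obs 𝒳 𝒵)) :=
  measurable_snd.snd.comap_le

/-- A bounded function of `Z` is pulled out of the conditional expectation, followed by the tower
property. Both conditional moment conditions on `ε` are used through this identity. -/
theorem integral_instrument_mul_eq {e : Obs 𝒳 𝒵 → ℝ} (he : Integrable e F₀) {g : 𝒵 → ℝ}
    (hg : Measurable g) {K : ℝ} (hK : ∀ᵐ w ∂F₀, |g w.2.2| ≤ K) :
    ∫ w, g w.2.2 * e w ∂F₀ = ∫ w, g w.2.2 * (F₀[e | instrumentSigma 𝒳 𝒵]) w ∂F₀ := by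
  have hgm : Measurable[instrumentSigma 𝒳 𝒵] fun w : Obs 𝒳 𝒵 => g w.2.2 :=
    hg.comp (comap_measurable _)
  have hgm' : Measurable fun w : Obs 𝒳 𝒵 => g w.2.2 := hg.comp measurable_snd.snd
  have h := condExp_mul_of_stronglyMeasurable_left (μ := F₀) (m := instrumentSigma 𝒳 𝒵)
    (f := fun w : Obs 𝒳 𝒵 => g w.2.2) (g := e) hgm.stronglyMeasurable
    (he.bdd_mul hgm'.aestronglyMeasurable hK) he
  have h2 := integral_condExp (μ := F₀) (f := (fun w : Obs 𝒳 𝒵 => g w.2.2) * e)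
    (instrumentSigma_le (𝒳 := 𝒳) (𝒵 := 𝒵))
  rw [integral_congr_ae h] at h2
  exact h2.symm

theorem integral_instrument_mul_eq_zero {e : Obs 𝒳 𝒵 → ℝ} (he : Integrable e F₀)
    (h_exog : F₀[e | instrumentSigma 𝒳 𝒵] =ᵐ[F₀] 0) {g : 𝒵 → ℝ}
    (hg : Measurable g) {K : ℝ} (hK : ∀ᵐ w ∂F₀, |g w.2.2| ≤ K) :
    ∫ w, g w.2.2 * e w ∂F₀ = 0 := by
  rw [integral_instrument_mul_eq he hg hK]
  refine integral_eq_zero_of_ae ?_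
  filter_upwards [h_exog] with w hw
  simp [hw]

/-- Conditioning on `Z` replaces `e ^ 2` by its bounded conditional mean, so `β ε` is small in mean
square as soon as `β` is, with no moment of `ε` beyond the second. The bound `K` on `g` serves
integrability only and does not enter the conclusion. -/
theorem integral_instrument_mul_sq_le {e : Obs 𝒳 𝒵 → ℝ} (he : MemLp e 2 F₀) {Cv : ℝ}
    (h_var : ∀ᵐ w ∂F₀, (F₀[fun w => e w ^ 2 | instrumentSigma 𝒳 𝒵]) w ≤ Cv) {g : 𝒵 → ℝ}
    (hg : Measurable g) {K : ℝ} (hK : ∀ᵐ w ∂F₀, |g w.2.2| ≤ K) :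
    ∫ w, (g w.2.2 * e w) ^ 2 ∂F₀ ≤ Cv * ∫ w, g w.2.2 ^ 2 ∂F₀ := by
  have hK2 : ∀ᵐ w ∂F₀, |(fun z => g z ^ 2) w.2.2| ≤ K ^ 2 := by
    filter_upwards [hK] with w hw
    simp only [abs_pow]
    gcongr
  have hgm : Measurable fun w : Obs 𝒳 𝒵 => g w.2.2 ^ 2 :=
    (hg.comp measurable_snd.snd).pow_const 2
  simp only [mul_pow]
  rw [integral_instrument_mul_eq (g := fun z => g z ^ 2) he.integrable_sq (hg.pow_const 2) hK2,
    ← integral_const_mul]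
  refine integral_mono_ae ?_ ?_ ?_
  · exact integrable_condExp.bdd_mul hgm.aestronglyMeasurable hK2
  · refine Integrable.const_mul ?_ _
    exact Integrable.of_bound hgm.aestronglyMeasurable (K ^ 2) hK2
  · filter_upwards [h_var] with w hw
    have := mul_le_mul_of_nonneg_left hw (sq_nonneg (g w.2.2))
    linarith

/-- Mean and mean square of the estimation error of the orthogonal score, in terms of the errors
of its ingredients. -/
theorem score_error_bounds {u e : Obs 𝒳 𝒵 → ℝ} {Δ : 𝒳 → ℝ} {β α₀ : 𝒵 → ℝ}
    (hu : MemLp u 2 F₀) (he : MemLp e 2 F₀) (hΔ : IsSquareIntegrable F₀ Δ) (hβ : Measurable β)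
    (hα₀ : Measurable α₀) (h_exog : F₀[e | instrumentSigma 𝒳 𝒵] =ᵐ[F₀] 0) {Cv Cα K : ℝ}
    (h_var : ∀ᵐ w ∂F₀, (F₀[fun w => e w ^ 2 | instrumentSigma 𝒳 𝒵]) w ≤ Cv)
    (hCα : ∀ᵐ w ∂F₀, |α₀ w.2.2| ≤ Cα) (hK : ∀ᵐ w ∂F₀, |β w.2.2| ≤ K) :
    let f : Obs 𝒳 𝒵 → ℝ := fun w =>
      u w - α₀ w.2.2 * Δ w.2.1 + (β w.2.2 * e w - β w.2.2 * Δ w.2.1)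
    MemLp f 2 F₀ ∧
    ∫ w, f w ^ 2 ∂F₀ ≤ 4 * (∫ w, u w ^ 2 ∂F₀ + Cα ^ 2 * msNorm F₀ Δ ^ 2
      + Cv * ∫ w, β w.2.2 ^ 2 ∂F₀ + K ^ 2 * msNorm F₀ Δ ^ 2) ∧
    |∫ w, f w ∂F₀| ≤ |∫ w, u w ∂F₀ - ∫ w, α₀ w.2.2 * Δ w.2.1 ∂F₀|
      + Real.sqrt (∫ w, β w.2.2 ^ 2 ∂F₀) * msNorm F₀ Δ := by
  intro f
  have hΔL := hΔ.memLp
  have hβm : AEStronglyMeasurable (fun w : Obs 𝒳 𝒵 => β w.2.2) F₀ :=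
    (hβ.comp measurable_snd.snd).aestronglyMeasurable
  have hαm : AEStronglyMeasurable (fun w : Obs 𝒳 𝒵 => α₀ w.2.2) F₀ :=
    (hα₀.comp measurable_snd.snd).aestronglyMeasurable
  have hβL : MemLp (fun w : Obs 𝒳 𝒵 => β w.2.2) 2 F₀ :=
    MemLp.of_bound hβm K hK
  have h1 := MemLp.two_mul_of_ae_bound hΔL hαm hCα
  have h2 := MemLp.two_mul_of_ae_bound he hβm hK
  have h3 := MemLp.two_mul_of_ae_bound hΔL hβm hK
  have hf : MemLp f 2 F₀ := (hu.sub h1).add (h2.sub h3)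
  have hms : msNorm F₀ Δ ^ 2 = ∫ w, Δ w.2.1 ^ 2 ∂F₀ :=
    Real.sq_sqrt (integral_nonneg fun _ => sq_nonneg _)
  refine ⟨hf, ?_, ?_⟩
  · have b1 := integral_mul_sq_le_of_ae_bound hΔL hαm hCα
    have b2 := integral_instrument_mul_sq_le he h_var hβ hK
    have b3 := integral_mul_sq_le_of_ae_bound hΔL hβm hK
    rw [hms]
    have i0 := hu.integrable_sq
    have i1 := h1.integrable_sq
    have i2 := h2.integrable_sq
    have i3 := h3.integrable_sq
    calc ∫ w, f w ^ 2 ∂F₀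
        ≤ ∫ w, 4 * (u w ^ 2 + (α₀ w.2.2 * Δ w.2.1) ^ 2 + (β w.2.2 * e w) ^ 2
            + (β w.2.2 * Δ w.2.1) ^ 2) ∂F₀ := by
          refine integral_mono hf.integrable_sq ((((i0.add i1).add i2).add i3).const_mul 4)
            fun w => ?_
          simp only [f]
          generalize u w = a
          generalize α₀ w.2.2 * Δ w.2.1 = b
          generalize β w.2.2 * e w = c
          generalize β w.2.2 * Δ w.2.1 = d
          -- The difference of the two sides is the sum of the squared pairwise differences of `a,
          -- -b, c, -d`.
          nlinarith [sq_nonneg (a + b), sq_nonneg (a - c), sq_nonneg (a + d), sq_nonneg (b + c),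
            sq_nonneg (b - d), sq_nonneg (c + d)]
      _ = 4 * (∫ w, u w ^ 2 ∂F₀ + ∫ w, (α₀ w.2.2 * Δ w.2.1) ^ 2 ∂F₀
            + ∫ w, (β w.2.2 * e w) ^ 2 ∂F₀ + ∫ w, (β w.2.2 * Δ w.2.1) ^ 2 ∂F₀) := by
          have i01 : Integrable (fun w => u w ^ 2 + (α₀ w.2.2 * Δ w.2.1) ^ 2) F₀ := i0.add i1
          have i012 : Integrable (fun w => u w ^ 2 + (α₀ w.2.2 * Δ w.2.1) ^ 2
            + (β w.2.2 * e w) ^ 2) F₀ := i01.add i2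
          rw [integral_const_mul, integral_add i012 i3, integral_add i01 i2, integral_add i0 i1]
      _ ≤ _ := by linarith
  · have j0 := hu.integrable one_le_two
    have j1 := h1.integrable one_le_two
    have j2 := h2.integrable one_le_two
    have j3 := h3.integrable one_le_two
    -- Orthogonality: exogeneity removes `β e` from the mean, so `β` survives only multiplied by
    -- `Δ`.
    have hE : ∫ w, f w ∂F₀ = (∫ w, u w ∂F₀ - ∫ w, α₀ w.2.2 * Δ w.2.1 ∂F₀)
        - ∫ w, β w.2.2 * Δ w.2.1 ∂F₀ := by
      have z := integral_instrument_mul_eq_zero (he.integrable one_le_two) h_exog hβ hK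
      simp only [f]
      have j01 : Integrable (fun w => u w - α₀ w.2.2 * Δ w.2.1) F₀ := j0.sub j1
      have j23 : Integrable (fun w => β w.2.2 * e w - β w.2.2 * Δ w.2.1) F₀ := j2.sub j3
      rw [integral_add j01 j23, integral_sub j0 j1, integral_sub j2 j3, z]
      ring
    rw [hE]
    refine (abs_sub _ _).trans (add_le_add le_rfl ?_)
    exact abs_integral_mul_le_sqrt_mul_sqrt hβL hΔL

end PopulationBounds

/-! ### Samples and convergence in probability -/

section SampleLaw

variable {Ω : Type*} [MeasurableSpace Ω] {P : Measure Ω}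

theorem tendstoInMeasure_const_iff_eventually_le {f : ℕ → Ω → ℝ} {c : ℝ} :
    TendstoInMeasure P f atTop (fun _ => c) ↔
      ∀ η : ℝ, 0 < η → ∀ ε : ℝ≥0∞, 0 < ε → ∀ᶠ n in atTop, P {ω | η ≤ |f n ω - c|} ≤ ε := by
  rw [tendstoInMeasure_iff_norm]
  simp only [Real.norm_eq_abs, ENNReal.tendsto_nhds_zero, gt_iff_lt]

theorem exists_pos_ofReal_le {ε : ℝ≥0∞} (hε : 0 < ε) : ∃ r : ℝ, 0 < r ∧ ENNReal.ofReal r ≤ ε := by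
  -- The minimum with `1` covers `ε = ∞`, whose `toReal` is `0`.
  refine ⟨(min ε 1).toReal, ENNReal.toReal_pos (by simp [hε.ne']) (by simp), ?_⟩
  rw [ENNReal.ofReal_toReal (by simp)]
  exact min_le_left _ _

theorem measure_iUnion_fin_le_mul {L : ℕ} {A : Fin L → Set Ω} {ε : ℝ≥0∞}
    (h : ∀ ℓ, P (A ℓ) ≤ ε) : P (⋃ ℓ, A ℓ) ≤ L * ε := by
  refine (measure_iUnion_fintype_le _ _).trans ?_
  rw [← nsmul_eq_mul]
  simpa using Finset.sum_le_card_nsmul Finset.univ (fun ℓ => P (A ℓ)) ε fun ℓ _ => h ℓ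

theorem IsBigOInProb.tendstoInMeasure_zero {f : ℕ → Ω → ℝ} {r : ℕ → ℝ} (h : IsBigOInProb P f r)
    (hr : Tendsto r atTop (𝓝 0)) : TendstoInMeasure P f atTop (fun _ => 0) := by
  rw [tendstoInMeasure_const_iff_eventually_le]
  intro η hη ε hε
  obtain ⟨K, hK, hev⟩ := h ε hε
  have hKr : Tendsto (fun n => K * r n) atTop (𝓝 0) := by simpa using hr.const_mul K
  filter_upwards [hev, hKr.eventually_lt_const hη] with n hn hlt
  refine (measure_mono fun ω (hω : η ≤ |f n ω - 0|) => ?_).trans hn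
  rw [sub_zero] at hω
  exact hlt.trans_le hω

variable {𝒳 𝒵 : Type*} [MeasurableSpace 𝒳] [MeasurableSpace 𝒵]
  {F₀ : Measure (Obs 𝒳 𝒵)} {W : ℕ → Ω → Obs 𝒳 𝒵}

theorem hasLaw_sample [IsProbabilityMeasure P] (hind : iIndepFun W P)
    (hW : ∀ i, HasLaw (W i) F₀ P) (n : ℕ) :
    HasLaw (sample W n) (Measure.pi fun _ : Fin n => F₀) P where
  aemeasurable := aemeasurable_pi_lambda _ fun i => (hW i).aemeasurable
  map_eq := by
    have h := iIndepFun.map_fun_eq_pi_map (f := fun i : Fin n => W i)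
      (fun i => (hW i).aemeasurable)
      (hind.precomp (g := fun i : Fin n => (i : ℕ)) Fin.val_injective)
    simp only [(hW _).map_eq] at h
    exact h

theorem measure_sample_mem [IsProbabilityMeasure P] (hind : iIndepFun W P)
    (hW : ∀ i, HasLaw (W i) F₀ P) (n : ℕ) {A : Set (Fin n → Obs 𝒳 𝒵)} (hA : MeasurableSet A) :
    P {ω | sample W n ω ∈ A} = (Measure.pi fun _ : Fin n => F₀) A :=
  (hasLaw_sample hind hW n).measure_eq hA

/-- Passing to a measurable hull costs nothing for upper bounds and spares measurability proofs for
the exceptional events. -/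
theorem measure_sample_mem_le [IsProbabilityMeasure P] (hind : iIndepFun W P)
    (hW : ∀ i, HasLaw (W i) F₀ P) (n : ℕ) (A : Set (Fin n → Obs 𝒳 𝒵)) :
    P {ω | sample W n ω ∈ A} ≤ (Measure.pi fun _ : Fin n => F₀) A := by
  set A' := toMeasurable (Measure.pi fun _ : Fin n => F₀) A
  calc P {ω | sample W n ω ∈ A} ≤ P {ω | sample W n ω ∈ A'} :=
        measure_mono fun ω hω => subset_toMeasurable _ _ hω
    _ = (Measure.pi fun _ : Fin n => F₀) A' :=
        measure_sample_mem hind hW n (measurableSet_toMeasurable _ _)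
    _ = _ := measure_toMeasurable _

end SampleLaw

/-! ### Calibration of the Hoeffding threshold. -/

section UnionBound

/-- The Hoeffding union bound over `q²` events is small for a large enough multiple of
`√(n log q)`, uniformly in `n ≥ 1` and `q ≥ 2`. -/
theorem exists_sq_mul_exp_le {C : ℝ} (hC : 0 < C) {ε : ℝ≥0∞} (hε : 0 < ε) :
    ∃ K : ℝ, 0 < K ∧ ∀ n q : ℕ, 1 ≤ n → 2 ≤ q →
      ((q ^ 2 : ℕ) : ℝ≥0∞) * ENNReal.ofReal
        (2 * Real.exp (-(K * Real.sqrt (n * Real.log q)) ^ 2 / (2 * (n * C ^ 2)))) ≤ ε := by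
  obtain ⟨r, hr, hrε⟩ := exists_pos_ofReal_le hε
  obtain ⟨a, ha⟩ := exists_pow_lt_of_lt_one (half_pos hr) (by norm_num : (1 / 2 : ℝ) < 1)
  -- With `K ^ 2 = 2 (2 + a) C ^ 2` the exponential equals `q ^ (-(2 + a))`. Two powers pay for the
  -- union over `q ^ 2` events, and the rest is at most `2 * (1 / 2) ^ a < r` since `q ≥ 2`.
  refine ⟨C * Real.sqrt (2 * (2 + a)), by positivity, fun n q hn hq => ?_⟩
  have hq0 : (0 : ℝ) < q := by exact_mod_cast (by lia : 0 < q)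
  have hq2 : (2 : ℝ) ≤ q := by exact_mod_cast hq
  have hn0 : (0 : ℝ) < n := by exact_mod_cast hn
  have hlog : 0 ≤ Real.log q := Real.log_nonneg (by linarith)
  have hexp : -(C * Real.sqrt (2 * (2 + a)) * Real.sqrt (n * Real.log q)) ^ 2
      / (2 * (n * C ^ 2)) = -(((2 + a : ℕ) : ℝ) * Real.log q) := by
    rw [mul_pow, mul_pow, Real.sq_sqrt (by positivity), Real.sq_sqrt (by positivity)]
    field_simp
    push_cast
    ring
  rw [hexp, Real.exp_neg, Real.exp_nat_mul, Real.exp_log hq0, ← ENNReal.ofReal_natCast,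
    ← ENNReal.ofReal_mul (by positivity)]
  refine (ENNReal.ofReal_le_ofReal ?_).trans hrε
  have h1 : ((q ^ 2 : ℕ) : ℝ) * (2 * ((q : ℝ) ^ (2 + a))⁻¹) = 2 * ((q : ℝ) ^ a)⁻¹ := by
    push_cast
    rw [pow_add]
    field_simp
  rw [h1]
  have h2 : ((q : ℝ) ^ a)⁻¹ ≤ (1 / 2) ^ a := by
    rw [one_div, inv_pow]
    gcongr
  linarith

end UnionBound

/-! ### Measurability of the ingredients -/

section Measurability

variable {𝒳 𝒵 𝒮 : Type*} [MeasurableSpace 𝒳] [MeasurableSpace 𝒵] [MeasurableSpace 𝒮]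
  {F₀ : Measure (Obs 𝒳 𝒵)}

/-- The events `‖γ̂ - γ₀‖ ≤ r` are conditioned on in the Fubini argument for blocks, hence must be
measurable. -/
theorem measurable_msNorm_sub [SFinite F₀] {γ : 𝒮 → 𝒳 → ℝ}
    (hγ : Measurable fun s : 𝒮 × 𝒳 => γ s.1 s.2) {γ₀ : 𝒳 → ℝ} (hγ₀ : Measurable γ₀) :
    Measurable fun w => msNorm F₀ (γ w - γ₀) := by
  have h : Measurable fun s : 𝒮 × Obs 𝒳 𝒵 => (γ s.1 s.2.2.1 - γ₀ s.2.2.1) ^ 2 :=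
    ((hγ.comp (measurable_fst.prodMk measurable_snd.snd.fst)).sub
      (hγ₀.comp measurable_snd.snd.fst)).pow_const 2
  exact (h.stronglyMeasurable.integral_prod_right (ν := F₀)).measurable.sqrt

end Measurability

/-! ### Fold algebra, concentration of `Ĝ` and `M̂`, and the error of `ρ̂` on a good event. -/

namespace CrossFit

variable {𝒳 𝒵 : Type*} {L n : ℕ} {S : CrossFit 𝒳 𝒵 L n} {ℓ : Fin L}

theorem mem_block {i : Fin n} : i ∈ S.block ℓ ↔ S.fold i = ℓ := by
  simp [block]

theorem card_compl_block : (((S.block ℓ)ᶜ).card : ℝ) = (n : ℝ) - S.blockSize ℓ := by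
  rw [Finset.card_compl, Fintype.card_fin, Nat.cast_sub (card_finset_fin_le _)]
  rfl

theorem sum_sum_block_eq (f : Fin n → ℝ) : ∑ ℓ, ∑ i ∈ S.block ℓ, f i = ∑ i, f i :=
  Finset.sum_fiberwise _ _ _

theorem sum_erase_card_block :
    ∑ ℓ' ∈ Finset.univ.erase ℓ, ((S.block ℓ').card : ℝ) = (n : ℝ) - S.blockSize ℓ := by
  have h := sum_sum_block_eq (S := S) fun _ => (1 : ℝ)
  simp only [Finset.sum_const, nsmul_eq_mul, mul_one, Finset.card_univ, Fintype.card_fin] at h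
  rw [← Finset.add_sum_erase _ _ (Finset.mem_univ ℓ)] at h
  rw [← h, blockSize]
  ring

variable [MeasurableSpace 𝒳] [MeasurableSpace 𝒵] {F₀ : Measure (Obs 𝒳 𝒵)}
  [IsProbabilityMeasure F₀] {m : Obs 𝒳 𝒵 → (𝒳 → ℝ) → ℝ}

/-- Concentration of the entries of `Ĝ_ℓ`. -/
theorem measure_GHat_sub_le (hS : S.IsDoubleCrossFitPGMM F₀ m) {Cb Cd : ℝ} (hCb : 0 < Cb)
    (hCd : 0 < Cd) (hb : ∀ᵐ w ∂F₀, ∀ k, |S.b k w.2.2| ≤ Cb)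
    (hd : ∀ᵐ w ∂F₀, ∀ j, |S.d j w.2.1| ≤ Cd) (hn : 1 ≤ n)
    (hfold : (n : ℝ) / 4 ≤ (n : ℝ) - S.blockSize ℓ) {t : ℝ} (ht : 0 ≤ t) :
    (Measure.pi fun _ : Fin n => F₀)
        {w | ∃ j k, 4 / n * t < |(S.GHat ℓ w - S.GPop F₀) j k|}
      ≤ ((S.q ^ 2 : ℕ) : ℝ≥0∞) *
        ENNReal.ofReal (2 * Real.exp (-t ^ 2 / (2 * (n * (Cd * Cb) ^ 2)))) := by
  have hn0 : (0 : ℝ) < n := by exact_mod_cast hn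
  have hN : (0 : ℝ) < (n : ℝ) - S.blockSize ℓ := by linarith [div_pos hn0 (by norm_num : (0:ℝ) < 4)]
  have key := pi_measure_exists_lt_abs_sum_sub_le F₀ (ι := Fin n) (B := (S.block ℓ)ᶜ)
    (J := Fin S.q × Fin S.p) (F := fun jk _ w => S.d jk.1 w.2.1 * S.b jk.2 w.2.2)
    (fun jk => ((hS.measurable_d jk.1).comp measurable_snd.snd.fst).mul
      ((hS.measurable_b jk.2).comp measurable_snd.snd.snd))
    (fun jk => fun _ _ _ => rfl) (A := Set.univ) MeasurableSet.univ (fun _ _ _ => rfl)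
    (C := Cd * Cb) (mul_pos hCd hCb) ht (N := n) (card_finset_fin_le _) ?_
  · refine (measure_mono ?_).trans (key.trans ?_)
    · rintro w ⟨j, k, h⟩
      refine ⟨Set.mem_univ _, (j, k), ?_⟩
      have e : (S.GHat ℓ w - S.GPop F₀) j k = ((n : ℝ) - S.blockSize ℓ)⁻¹ *
          ∑ i ∈ (S.block ℓ)ᶜ, (S.d j (w i).2.1 * S.b k (w i).2.2
            - ∫ x, S.d j x.2.1 * S.b k x.2.2 ∂F₀) := by
        simp only [GHat, GPop, Matrix.sub_apply, Matrix.of_apply, Finset.sum_sub_distrib,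
          Finset.sum_const, nsmul_eq_mul]
        rw [card_compl_block]
        field_simp
      rw [e, abs_mul, abs_of_pos (inv_pos.2 hN)] at h
      have h2 : ((n : ℝ) - S.blockSize ℓ)⁻¹ ≤ 4 / n := by
        rw [inv_le_comm₀ hN (by positivity), inv_div]
        exact hfold
      exact lt_of_mul_lt_mul_left (h.trans_le (mul_le_mul_of_nonneg_right h2 (abs_nonneg _)))
        (by positivity)
    -- The union is over `q * p` entries, at most `q ^ 2` because `p ≤ q`.
    · gcongr
      simp only [Fintype.card_prod, Fintype.card_fin]
      rw [sq]
      exact Nat.mul_le_mul_left _ hS.p_le_q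
  · intro w _
    filter_upwards [hb, hd] with x hx hy
    intro jk
    rw [abs_mul]
    exact mul_le_mul (hy _) (hx _) (abs_nonneg _) hCd.le

theorem abs_GPop_le {Cb Cd : ℝ} (hCd : 0 ≤ Cd) (hb : ∀ᵐ w ∂F₀, ∀ k, |S.b k w.2.2| ≤ Cb)
    (hd : ∀ᵐ w ∂F₀, ∀ j, |S.d j w.2.1| ≤ Cd) (j : Fin S.q) (k : Fin S.p) :
    |S.GPop F₀ j k| ≤ Cd * Cb := by
  have h := norm_integral_le_of_norm_le_const (μ := F₀)
    (f := fun w => S.d j w.2.1 * S.b k w.2.2) (C := Cd * Cb) (by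
      filter_upwards [hb, hd] with x hx hy
      rw [norm_mul]
      exact mul_le_mul (hy _) (hx _) (abs_nonneg _) hCd)
  simpa [GPop] using h

/-- Concentration, for a fold `ℓ'`, of the sums that enter `M̂_ℓ`. -/
theorem measure_gateaux_sum_sub_le (hS : S.IsDoubleCrossFitPGMM F₀ m) {γ₀ : 𝒳 → ℝ}
    (hγ₀ : Measurable γ₀) {C r : ℝ} (hC : 0 < C)
    (hD : ∀ γ : 𝒳 → ℝ, IsSquareIntegrable F₀ γ → msNorm F₀ (γ - γ₀) ≤ r →
      ∀ᵐ w ∂F₀, ∀ j, |gateaux m w γ (S.d j)| ≤ C) {ℓ' : Fin L} (hℓ : ℓ ≠ ℓ') {t : ℝ}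
    (ht : 0 ≤ t) :
    (Measure.pi fun _ : Fin n => F₀)
        {w | msNorm F₀ (S.gammaHat₂ ℓ ℓ' w - γ₀) ≤ r ∧ ∃ j, t < |∑ i ∈ S.block ℓ',
          (gateaux m (w i) (S.gammaHat₂ ℓ ℓ' w) (S.d j)
            - ∫ x, gateaux m x (S.gammaHat₂ ℓ ℓ' w) (S.d j) ∂F₀)|}
      ≤ ((S.q ^ 2 : ℕ) : ℝ≥0∞) *
        ENNReal.ofReal (2 * Real.exp (-t ^ 2 / (2 * (n * C ^ 2)))) := by
  -- The point of the double cross-fit: `γ̂_{ℓ,ℓ'}` also ignores fold `ℓ'`, so given the other folds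
  -- the summands over `I_ℓ'` are i.i.d. and, on the event below, bounded.
  have hsub : {i | S.fold i ≠ ℓ ∧ S.fold i ≠ ℓ'} ⊆ ((S.block ℓ' : Finset (Fin n)) : Set (Fin n))ᶜ :=
    fun i hi hi' => hi.2 (mem_block.1 hi')
  have hdep := (hS.dependsOn_gammaHat₂ ℓ ℓ' hℓ).mono hsub
  have key := pi_measure_exists_lt_abs_sum_sub_le F₀ (ι := Fin n) (B := S.block ℓ')
    (J := Fin S.q) (F := fun j w x => gateaux m x (S.gammaHat₂ ℓ ℓ' w) (S.d j))
    (fun j => hS.measurable_gateaux_gammaHat₂ ℓ ℓ' hℓ j)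
    (fun j x y h => by simp only [hdep h])
    (A := {w | msNorm F₀ (S.gammaHat₂ ℓ ℓ' w - γ₀) ≤ r})
    (measurableSet_le (measurable_msNorm_sub (hS.measurable_gammaHat₂ ℓ ℓ' hℓ) hγ₀)
      measurable_const)
    (fun x y h => by simp only [Set.mem_ofPred_eq, hdep h])
    (C := C) hC ht (N := n) (card_finset_fin_le _)
    (fun w hw => hD _ (hS.gammaHat₂_sq ℓ ℓ' hℓ w) hw)
  refine key.trans ?_
  gcongr
  simp only [Fintype.card_fin]
  exact Nat.le_self_pow two_ne_zero _

omit [IsProbabilityMeasure F₀] in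
/-- Deterministic bound for `M̂_ℓ` on the event that the fold sums concentrate. -/
theorem abs_MHat_sub_le (hn : 1 ≤ n) (hfold : (n : ℝ) / 4 ≤ (n : ℝ) - S.blockSize ℓ)
    {w : Fin n → Obs 𝒳 𝒵} {M : Fin S.q → ℝ} {t g : ℝ} (ht : 0 ≤ t)
    (h₁ : ∀ ℓ', ℓ ≠ ℓ' → ∀ j, |∑ i ∈ S.block ℓ',
          (gateaux m (w i) (S.gammaHat₂ ℓ ℓ' w) (S.d j)
            - ∫ x, gateaux m x (S.gammaHat₂ ℓ ℓ' w) (S.d j) ∂F₀)| ≤ t)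
    (h₂ : ∀ ℓ', ℓ ≠ ℓ' → ∀ j,
      |∫ x, gateaux m x (S.gammaHat₂ ℓ ℓ' w) (S.d j) ∂F₀ - M j| ≤ g) (j : Fin S.q) :
    |S.MHat m ℓ w j - M j| ≤ 4 / n * (L * t) + g := by
  have hn0 : (0 : ℝ) < n := by exact_mod_cast hn
  have hN : (0 : ℝ) < (n : ℝ) - S.blockSize ℓ := by linarith [div_pos hn0 (by norm_num : (0:ℝ) < 4)]
  set N := (n : ℝ) - S.blockSize ℓ with hNdef
  -- Fluctuation plus bias, fold by fold. The block sizes in the bias part add up to `N`, so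
  -- averaging does not inflate the bias.
  have e : S.MHat m ℓ w j - M j = N⁻¹ * (∑ ℓ' ∈ Finset.univ.erase ℓ, ∑ i ∈ S.block ℓ',
        (gateaux m (w i) (S.gammaHat₂ ℓ ℓ' w) (S.d j)
          - ∫ x, gateaux m x (S.gammaHat₂ ℓ ℓ' w) (S.d j) ∂F₀)
      + ∑ ℓ' ∈ Finset.univ.erase ℓ, ((S.block ℓ').card : ℝ) *
        (∫ x, gateaux m x (S.gammaHat₂ ℓ ℓ' w) (S.d j) ∂F₀ - M j)) := by
    have e1 : ∑ ℓ' ∈ Finset.univ.erase ℓ, ((S.block ℓ').card : ℝ) * M j = N * M j := by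
      rw [← Finset.sum_mul, sum_erase_card_block]
    simp only [MHat, Finset.sum_sub_distrib, Finset.sum_const, nsmul_eq_mul, mul_sub]
    rw [e1, ← hNdef]
    field_simp
    ring
  have hne : ∀ ℓ' ∈ Finset.univ.erase ℓ, ℓ ≠ ℓ' := fun ℓ' h => (Finset.ne_of_mem_erase h).symm
  have b1 : |∑ ℓ' ∈ Finset.univ.erase ℓ, ∑ i ∈ S.block ℓ',
        (gateaux m (w i) (S.gammaHat₂ ℓ ℓ' w) (S.d j)
          - ∫ x, gateaux m x (S.gammaHat₂ ℓ ℓ' w) (S.d j) ∂F₀)| ≤ L * t := by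
    refine (Finset.abs_sum_le_sum_abs _ _).trans
      ((Finset.sum_le_sum fun ℓ' h => h₁ ℓ' (hne ℓ' h) j).trans ?_)
    rw [Finset.sum_const, nsmul_eq_mul]
    have : (#(Finset.univ.erase ℓ) : ℝ) ≤ L := by
      exact_mod_cast (card_finset_fin_le _)
    gcongr
  have b2 : |∑ ℓ' ∈ Finset.univ.erase ℓ, ((S.block ℓ').card : ℝ) *
        (∫ x, gateaux m x (S.gammaHat₂ ℓ ℓ' w) (S.d j) ∂F₀ - M j)| ≤ N * g := by
    refine (Finset.abs_sum_le_sum_abs _ _).trans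
      ((Finset.sum_le_sum fun ℓ' h => ?_).trans
        (?_ : ∑ ℓ' ∈ Finset.univ.erase ℓ, ((S.block ℓ').card : ℝ) * g ≤ N * g))
    · rw [abs_mul, Nat.abs_cast]
      exact mul_le_mul_of_nonneg_left (h₂ ℓ' (hne ℓ' h) j) (Nat.cast_nonneg _)
    · rw [← Finset.sum_mul, sum_erase_card_block]
  have hinv : N⁻¹ ≤ 4 / n := by
    rw [inv_le_comm₀ hN (by positivity), inv_div]
    exact hfold
  rw [e, abs_mul, abs_of_pos (inv_pos.2 hN)]
  calc N⁻¹ * |_ + _| ≤ N⁻¹ * (L * t + N * g) := by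
        gcongr
        exact (abs_add_le _ _).trans (add_le_add b1 b2)
    _ = N⁻¹ * (L * t) + g := by field_simp
    _ ≤ 4 / n * (L * t) + g := by gcongr

omit [IsProbabilityMeasure F₀] in
/-- The `ℓ₁` error of `ρ̂_ℓ` on the event that its ingredients are close to their population
counterparts. -/
theorem sum_abs_rhoHat_sub_le (hS : S.IsDoubleCrossFitPGMM F₀ m) {w : Fin n → Obs 𝒳 𝒵}
    {Om : Matrix (Fin S.q) (Fin S.q) ℝ} {M : Fin S.q → ℝ} {ρ₀ : Fin S.p → ℝ} {s : ℕ}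
    {a K A c C g o e δM : ℝ} (hs1 : 1 ≤ s) (hK : 0 ≤ K) (hg0 : 0 ≤ g)
    (hC : 0 ≤ C) (ha : 0 ≤ a) (hc : 0 < c) (hδM : 0 ≤ δM)
    (hOm : rowSumNorm Om ≤ a) (hOm' : rowSumNorm (S.OmegaHat ℓ w) ≤ a)
    (hOmo : rowSumNorm (S.OmegaHat ℓ w - Om) ≤ o)
    (hG : ∀ j k, |S.GPop F₀ j k| ≤ K) (hG' : ∀ j k, |S.GHat ℓ w j k| ≤ K)
    (hGg : ∀ j k, |(S.GHat ℓ w - S.GPop F₀) j k| ≤ g)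
    (hM : ∀ j, |S.MHat m ℓ w j - M j| ≤ δM)
    (hv : ∀ j, |(M - S.GPop F₀ *ᵥ ρ₀) j| ≤ e) (he0 : 0 ≤ e) (he : e ^ 2 ≤ C * s * S.lam ^ 2)
    (hρs : (Finset.univ.filter fun k => ρ₀ k ≠ 0).card ≤ s) (hρA : ∑ k, |ρ₀ k| ≤ A)
    (hRE : (c : EReal) ≤ restrictedEigenvalueSq (S.popHessian F₀ Om) s)
    (hsmall : K * a * (δM + g * A) ≤ S.lam / 8)
    (hsmall' : (2 * g * a * K + K * o * K) * s ≤ c / 32) :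
    ∑ k, |S.rhoHat ℓ w k - ρ₀ k| ≤ (8 * (a * C) + 160 / c) * (s * S.lam) := by
  have hA0 : 0 ≤ A := (Finset.sum_nonneg fun _ _ => abs_nonneg _).trans hρA
  have hs0 : (0 : ℝ) < s := by exact_mod_cast hs1
  have hq0 : (0 : ℝ) ≤ (S.q : ℝ)⁻¹ := by positivity
  set G := S.GHat ℓ w with hGdef
  set H := S.GPop F₀ with hHdef
  have hT : ((S.q : ℝ)⁻¹ • S.OmegaHat ℓ w).PosSemidef := (hS.posSemidef_OmegaHat ℓ w).smul hq0
  -- `v₁` is estimation noise, uniformly below a fraction of `λ` and paired with `δ` by `ℓ_∞`–`ℓ₁`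
  -- duality. `v₂` is the population approximation error, of order `√s λ` entrywise, and is measured
  -- by the quadratic form instead.
  refine sum_abs_sub_le_of_isMinimizer hT (M := S.MHat m ℓ w) (G := G)
    (v₁ := fun j => (S.MHat m ℓ w j - M j) - ((G - H) *ᵥ ρ₀) j) (v₂ := M - H *ᵥ ρ₀)
    hS.lam_pos hc (mul_nonneg ha hC) hs1 (hS.isMinOn_rhoHat ℓ w (Set.mem_univ ρ₀)) ?_ ?_ ?_ hρs ?_
  · ext j
    simp only [Matrix.sub_mulVec, Pi.sub_apply, Pi.add_apply]
    ring
  · intro δ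
    have ht : 0 ≤ ∑ k, |δ k| := Finset.sum_nonneg fun _ _ => abs_nonneg _
    have h := abs_dotProduct_smul_mulVec_le (S.OmegaHat ℓ w) (mul_nonneg hK ht)
      (Y := δM + g * A) (by positivity) (abs_mulVec_le_of_entries G hG' δ)
      (y := fun j => (S.MHat m ℓ w j - M j) - ((G - H) *ᵥ ρ₀) j) fun j => by
        refine (abs_sub _ _).trans (add_le_add (hM j) ?_)
        refine (abs_mulVec_le_of_entries (G - H) hGg ρ₀ j).trans ?_
        gcongr
    refine h.trans ?_
    calc K * (∑ k, |δ k|) * rowSumNorm (S.OmegaHat ℓ w) * (δM + g * A)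
        ≤ K * (∑ k, |δ k|) * a * (δM + g * A) := by gcongr
      _ = K * a * (δM + g * A) * ∑ k, |δ k| := by ring
      _ ≤ _ := by gcongr
  · have h := (le_abs_self _).trans
      (abs_dotProduct_smul_mulVec_le (S.OmegaHat ℓ w) he0 he0 hv hv)
    refine h.trans ?_
    calc e * rowSumNorm (S.OmegaHat ℓ w) * e ≤ e * a * e := by gcongr
      _ = a * e ^ 2 := by ring
      _ ≤ a * (C * s * S.lam ^ 2) := by gcongr
      _ = _ := by ring
  · intro J δ hJ hδ
    have h1 := mul_sum_sq_le_of_le_restrictedEigenvalueSq hRE hJ hδ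
    have h2 : δ ⬝ᵥ (S.popHessian F₀ Om *ᵥ δ) = (H *ᵥ δ) ⬝ᵥ (((S.q : ℝ)⁻¹ • Om) *ᵥ (H *ᵥ δ)) := by
      rw [popHessian, ← Matrix.mulVec_mulVec, ← Matrix.mulVec_mulVec, Matrix.dotProduct_mulVec,
        Matrix.vecMul_transpose]
    -- The restricted eigenvalue belongs to the population form. Replacing it by the sample form
    -- costs a multiple of `|δ|₁ ^ 2`, which `hsmall'` keeps within `c / (32 s)`.
    have h3 := (abs_le.1 (abs_quadForm_sub_le (S.OmegaHat ℓ w) Om G H hK hg0 hG' hG hGg hOm' hOm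
      hOmo δ)).1
    rw [h2] at h1
    have h4 : (2 * g * a * K + K * o * K) * (∑ k, |δ k|) ^ 2
        ≤ c / (32 * s) * (∑ k, |δ k|) ^ 2 := by
      refine mul_le_mul_of_nonneg_right ?_ (sq_nonneg _)
      rw [← div_div, le_div_iff₀ hs0]
      exact hsmall'
    linarith

end CrossFit

/-! ### The rate of the penalized coefficients -/

section CoefficientRate

variable {Ω 𝒳 𝒵 : Type*} [MeasurableSpace Ω] [MeasurableSpace 𝒳] [MeasurableSpace 𝒵]
  {P : Measure Ω} [IsProbabilityMeasure P] {F₀ : Measure (Obs 𝒳 𝒵)} [IsProbabilityMeasure F₀]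
  {m : Obs 𝒳 𝒵 → (𝒳 → ℝ) → ℝ}

namespace CrossFit

variable {L n : ℕ} {S : CrossFit 𝒳 𝒵 L n} {ℓ : Fin L}

theorem memLp_instrument_comb {Cb : ℝ} (hbm : ∀ k, Measurable (S.b k))
    (hb : ∀ᵐ w ∂F₀, ∀ k, |S.b k w.2.2| ≤ Cb) (ρ : Fin S.p → ℝ) :
    MemLp (fun w : Obs 𝒳 𝒵 => ∑ k, S.b k w.2.2 * ρ k) 2 F₀ := by
  refine memLp_finsetSum _ fun k _ => MemLp.mul_const ?_ _
  refine MemLp.of_bound ((hbm k).comp measurable_snd.snd).aestronglyMeasurable Cb ?_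
  filter_upwards [hb] with w hw using hw k

/-- The approximation error of the moments is bounded by that of the Riesz representer. -/
theorem abs_moment_sub_le (hS : S.IsDoubleCrossFitPGMM F₀ m) {Cb Cd : ℝ}
    (hb : ∀ᵐ w ∂F₀, ∀ k, |S.b k w.2.2| ≤ Cb) (hd : ∀ᵐ w ∂F₀, ∀ j, |S.d j w.2.1| ≤ Cd)
    (hCd : 0 ≤ Cd) {α₀ : 𝒵 → ℝ} (hα₀ : MemLp (fun w : Obs 𝒳 𝒵 => α₀ w.2.2) 2 F₀)
    (ρ : Fin S.p → ℝ) (j : Fin S.q) :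
    |((fun j => ∫ w, α₀ w.2.2 * S.d j w.2.1 ∂F₀) - S.GPop F₀ *ᵥ ρ) j|
      ≤ Cd * Real.sqrt (∫ w, (α₀ w.2.2 - ∑ k, S.b k w.2.2 * ρ k) ^ 2 ∂F₀) := by
  have hdL : MemLp (fun w : Obs 𝒳 𝒵 => S.d j w.2.1) 2 F₀ :=
    MemLp.of_bound ((hS.measurable_d j).comp measurable_snd.fst).aestronglyMeasurable Cd
      (by filter_upwards [hd] with w hw using hw j)
  have hbL : ∀ k, MemLp (fun w : Obs 𝒳 𝒵 => S.b k w.2.2) 2 F₀ := fun k =>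
    MemLp.of_bound ((hS.measurable_b k).comp measurable_snd.snd).aestronglyMeasurable Cb
      (by filter_upwards [hb] with w hw using hw k)
  have hsum := memLp_instrument_comb hS.measurable_b hb ρ
  have hi : ∀ k ∈ (Finset.univ : Finset (Fin S.p)),
      Integrable (fun w : Obs 𝒳 𝒵 => S.d j w.2.1 * S.b k w.2.2 * ρ k) F₀ := fun k _ =>
    (MemLp.integrable_mul hdL (hbL k)).mul_const _
  -- `M - G ρ` lists the inner products of `α₀ - b'ρ` with the `d_j`; Cauchy–Schwarz then applies.
  have e : ((fun j => ∫ w, α₀ w.2.2 * S.d j w.2.1 ∂F₀) - S.GPop F₀ *ᵥ ρ) j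
      = ∫ w, (α₀ w.2.2 - ∑ k, S.b k w.2.2 * ρ k) * S.d j w.2.1 ∂F₀ := by
    have i1 : Integrable (fun w : Obs 𝒳 𝒵 => α₀ w.2.2 * S.d j w.2.1) F₀ :=
      MemLp.integrable_mul hα₀ hdL
    have e1 : ∀ w : Obs 𝒳 𝒵, (α₀ w.2.2 - ∑ k, S.b k w.2.2 * ρ k) * S.d j w.2.1
        = α₀ w.2.2 * S.d j w.2.1 - ∑ k, S.d j w.2.1 * S.b k w.2.2 * ρ k := fun w => by
      rw [sub_mul, Finset.sum_mul]
      congr 1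
      exact Finset.sum_congr rfl fun k _ => by ring
    simp only [e1]
    rw [integral_sub i1 (integrable_finsetSum _ hi), integral_finsetSum _ hi]
    simp only [Pi.sub_apply, Matrix.mulVec, dotProduct, GPop, Matrix.of_apply,
      integral_mul_const]
  rw [e]
  refine (abs_integral_mul_le_sqrt_mul_sqrt (hα₀.sub hsum) hdL).trans ?_
  rw [mul_comm]
  refine mul_le_mul_of_nonneg_right ?_ (Real.sqrt_nonneg _)
  rw [Real.sqrt_le_left hCd]
  have h := integral_mono_ae hdL.integrable_sq (integrable_const (Cd ^ 2)) (by
    filter_upwards [hd] with w hw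
    rw [← sq_abs]
    have := hw j
    gcongr)
  simpa using h

/-- The bias of the derivative moments at an estimated structural function. -/
theorem abs_integral_gateaux_sub_le (hS : S.IsDoubleCrossFitPGMM F₀ m) {Cd : ℝ}
    (hd : ∀ᵐ w ∂F₀, ∀ j, |S.d j w.2.1| ≤ Cd) {γ₀ : 𝒳 → ℝ} {α₀ : 𝒵 → ℝ}
    (h_riesz : ∀ ζ : 𝒳 → ℝ, IsSquareIntegrable F₀ ζ →
      Integrable (fun w => gateaux m w γ₀ ζ) F₀ ∧
        ∫ w, gateaux m w γ₀ ζ ∂F₀ = ∫ w, α₀ w.2.2 * ζ w.2.1 ∂F₀) {C r : ℝ}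
    (hD : ∀ γ : 𝒳 → ℝ, IsSquareIntegrable F₀ γ → msNorm F₀ (γ - γ₀) ≤ r →
        (∀ᵐ w ∂F₀, ∀ j, |gateaux m w γ (S.d j)| ≤ C) ∧
        ∀ j, |∫ w, (gateaux m w γ (S.d j) - gateaux m w γ₀ (S.d j)) ∂F₀|
          ≤ C * msNorm F₀ (γ - γ₀)) {ℓ' : Fin L} (hℓ : ℓ ≠ ℓ') {w : Fin n → Obs 𝒳 𝒵}
    (hr : msNorm F₀ (S.gammaHat₂ ℓ ℓ' w - γ₀) ≤ r) (j : Fin S.q) :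
    |∫ x, gateaux m x (S.gammaHat₂ ℓ ℓ' w) (S.d j) ∂F₀ - ∫ x, α₀ x.2.2 * S.d j x.2.1 ∂F₀|
      ≤ C * msNorm F₀ (S.gammaHat₂ ℓ ℓ' w - γ₀) := by
  obtain ⟨h1, h2⟩ := hD _ (hS.gammaHat₂_sq ℓ ℓ' hℓ w) hr
  obtain ⟨h3, h4⟩ := h_riesz (S.d j) (IsSquareIntegrable.of_ae_bound (hS.measurable_d j)
    (by filter_upwards [hd] with w hw using hw j))
  have hm : Measurable fun x => gateaux m x (S.gammaHat₂ ℓ ℓ' w) (S.d j) :=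
    (hS.measurable_gateaux_gammaHat₂ ℓ ℓ' hℓ j).comp (measurable_const.prodMk measurable_id)
  have h5 : Integrable (fun x => gateaux m x (S.gammaHat₂ ℓ ℓ' w) (S.d j)) F₀ :=
    Integrable.of_bound hm.aestronglyMeasurable C (by filter_upwards [h1] with w hw using hw j)
  have h6 := h2 j
  rw [integral_sub h5 h3, h4] at h6
  exact h6

end CrossFit

/-- Converts a Hoeffding threshold `K √(n log q)` for a sum into the rate `√(log q / n)` for the
average. -/
theorem four_div_mul_sqrt {n : ℕ} (hn : 1 ≤ n) (K x : ℝ) :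
    4 / (n : ℝ) * (K * Real.sqrt (n * x)) = 4 * K * Real.sqrt (x / n) := by
  have hn0 : (0 : ℝ) < n := by exact_mod_cast hn
  have h : (n : ℝ) * x = (n : ℝ) ^ 2 * (x / n) := by field_simp
  rw [h, Real.sqrt_mul (by positivity), Real.sqrt_sq hn0.le]
  field_simp

-- The limiting share `1 / L` is at most `1 / 2 < 3 / 4`, so at least a quarter of the sample
-- eventually lies outside the fold.
omit [MeasurableSpace 𝒳] [MeasurableSpace 𝒵] in
theorem eventually_div_four_le_sub_blockSize {L : ℕ} (hL : 2 ≤ L) {S : ∀ n, CrossFit 𝒳 𝒵 L n}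
    {ℓ : Fin L}
    (h : Tendsto (fun n : ℕ => ((S n).blockSize ℓ : ℝ) / n) atTop (𝓝 (1 / (L : ℝ)))) :
    ∀ᶠ n : ℕ in atTop, (n : ℝ) / 4 ≤ (n : ℝ) - (S n).blockSize ℓ := by
  have hL' : (2 : ℝ) ≤ L := by exact_mod_cast hL
  have hlt : 1 / (L : ℝ) < 3 / 4 := by
    rw [div_lt_div_iff₀ (by linarith) (by norm_num)]
    linarith
  filter_upwards [h.eventually_lt_const hlt, eventually_ge_atTop 1] with n hn hn1
  have hn0 : (0 : ℝ) < n := by exact_mod_cast hn1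
  rw [div_lt_iff₀ hn0] at hn
  linarith

/-- `|ρ̂_ℓ - ρ̄|₁ = O_p(s̄ λ)`. -/
theorem isBigOInProb_sum_abs_rhoHat_sub
    {W : ℕ → Ω → Obs 𝒳 𝒵} (hW_indep : iIndepFun W P) (hW_law : ∀ i, HasLaw (W i) F₀ P)
    {γ₀ : 𝒳 → ℝ} (hγ₀ : IsSquareIntegrable F₀ γ₀)
    {α₀ : 𝒵 → ℝ} (hα₀ : MemLp (fun w : Obs 𝒳 𝒵 => α₀ w.2.2) 2 F₀)
    (h_riesz : ∀ ζ : 𝒳 → ℝ, IsSquareIntegrable F₀ ζ →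
      Integrable (fun w => gateaux m w γ₀ ζ) F₀ ∧
        ∫ w, gateaux m w γ₀ ζ ∂F₀ = ∫ w, α₀ w.2.2 * ζ w.2.1 ∂F₀)
    {L : ℕ} (hL : 2 ≤ L) {S : ∀ n, CrossFit 𝒳 𝒵 L n}
    (hS : ∀ n, (S n).IsDoubleCrossFitPGMM F₀ m)
    {ℓ : Fin L}
    (h_folds : Tendsto (fun n : ℕ => ((S n).blockSize ℓ : ℝ) / n) atTop (𝓝 (1 / (L : ℝ))))
    {κ : ℕ → ℝ} (hκ_nonneg : ∀ n, 0 ≤ κ n) {s : ℕ → ℕ} (hs : ∀ n, 1 ≤ s n)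
    {Om : ∀ n, Matrix (Fin (S n).q) (Fin (S n).q) ℝ}
    (hOm_rate : IsBigOInProb P
      (fun n ω => rowSumNorm ((S n).OmegaHat ℓ (sample W n ω) - Om n))
      (fun n => Real.sqrt (Real.log (S n).q / n)))
    {COm : ℝ} (hOm_bdd : ∀ᶠ n in atTop, rowSumNorm (Om n) ≤ COm)
    {Cb : ℝ} (hb_bdd : ∀ n, ∀ᵐ w ∂F₀, ∀ k, |(S n).b k w.2.2| ≤ Cb)
    {Cd : ℝ} (hd_bdd : ∀ n, ∀ᵐ w ∂F₀, ∀ j, |(S n).d j w.2.1| ≤ Cd)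
    {C A : ℝ} {ρ₀ : ∀ n, Fin (S n).p → ℝ} (h_sparse : ∀ᶠ n in atTop,
      (Finset.univ.filter fun k => ρ₀ n k ≠ 0).card ≤ s n ∧ ∑ k, |ρ₀ n k| ≤ A ∧
        ∫ w, (α₀ w.2.2 - ∑ k, (S n).b k w.2.2 * ρ₀ n k) ^ 2 ∂F₀
          ≤ C * s n * epsRate (S n).q n (κ n) ^ 2)
    {c : ℝ} (hc : 0 < c) (h_restrEig : ∀ᶠ n in atTop,
      (c : EReal) ≤ restrictedEigenvalueSq ((S n).popHessian F₀ (Om n)) (s n))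
    {CD rD : ℝ} (hCD : 0 < CD) (hrD : 0 < rD)
    (h_deriv : ∀ γ : 𝒳 → ℝ, IsSquareIntegrable F₀ γ →
      msNorm F₀ (γ - γ₀) ≤ rD → ∀ n,
        (∀ᵐ w ∂F₀, ∀ j, |gateaux m w γ ((S n).d j)| ≤ CD) ∧
        ∀ j, |∫ w, (gateaux m w γ ((S n).d j) - gateaux m w γ₀ ((S n).d j)) ∂F₀|
          ≤ CD * msNorm F₀ (γ - γ₀))
    (hγ₂_rate : ∀ ℓ', ℓ ≠ ℓ' → IsBigOInProb P
      (fun n ω => msNorm F₀ ((S n).gammaHat₂ ℓ ℓ' (sample W n ω) - γ₀)) κ)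
    (h_rate_q : (fun n : ℕ => Real.sqrt (Real.log (S n).q / n)) =o[atTop] fun n => (S n).lam)
    (h_rate_κ : κ =o[atTop] fun n => (S n).lam)
    (h_rate_s : Tendsto (fun n => (s n : ℝ) * (S n).lam) atTop (𝓝 0)) :
    IsBigOInProb P (fun n ω => ∑ k, |(S n).rhoHat ℓ (sample W n ω) k - ρ₀ n k|)
      (fun n => s n * (S n).lam) := by
  intro ε hε
  -- constants made positive
  obtain ⟨Cb', hCb', hb⟩ : ∃ C : ℝ, 0 < C ∧ ∀ n, ∀ᵐ w ∂F₀, ∀ k, |(S n).b k w.2.2| ≤ C :=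
    ⟨max Cb 1, by positivity, fun n => (hb_bdd n).mono fun w hw k => (hw k).trans (le_max_left _ _)⟩
  obtain ⟨Cd', hCd', hd⟩ : ∃ C : ℝ, 0 < C ∧ ∀ n, ∀ᵐ w ∂F₀, ∀ j, |(S n).d j w.2.1| ≤ C :=
    ⟨max Cd 1, by positivity, fun n => (hd_bdd n).mono fun w hw j => (hw j).trans (le_max_left _ _)⟩
  set r : ℕ → ℝ := fun n => Real.sqrt (Real.log (S n).q / n) with hr
  have hr0 : ∀ n, 0 ≤ r n := fun n => Real.sqrt_nonneg _
  have hlam : ∀ n, 0 < (S n).lam := fun n => (hS n).lam_pos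
  obtain ⟨n₁, hn₁⟩ := h_sparse.exists
  have hA : 0 ≤ A := (Finset.sum_nonneg fun _ _ => abs_nonneg _).trans hn₁.2.1
  -- probability budget
  have hN0 : ((2 + 2 * L : ℕ) : ℝ≥0∞) ≠ 0 := by
    rw [Nat.cast_ne_zero]; lia
  have hNt : ((2 + 2 * L : ℕ) : ℝ≥0∞) ≠ ∞ := ENNReal.natCast_ne_top _
  set ε' : ℝ≥0∞ := ε / ((2 + 2 * L : ℕ) : ℝ≥0∞) with hε'
  have hε'0 : 0 < ε' := ENNReal.div_pos hε.ne' hNt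
  have hbudget : ε' + ε' + L * ε' + L * ε' = ε := by
    have : ε' + ε' + L * ε' + L * ε' = ((2 + 2 * L : ℕ) : ℝ≥0∞) * ε' := by push_cast; ring
    rw [this, hε', ENNReal.mul_div_cancel hN0 hNt]
  obtain ⟨K₁, hK₁, hev₁⟩ := hOm_rate ε' hε'0
  obtain ⟨K₂, hK₂, hH₂⟩ := exists_sq_mul_exp_le (mul_pos hCd' hCb') hε'0
  obtain ⟨K₄, hK₄, hH₄⟩ := exists_sq_mul_exp_le hCD hε'0
  have h3 : ∀ ℓ', ∃ K : ℝ, 0 < K ∧ ∀ᶠ n in atTop, ℓ ≠ ℓ' →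
      P {ω | K * κ n < |msNorm F₀ ((S n).gammaHat₂ ℓ ℓ' (sample W n ω) - γ₀)|} ≤ ε' := fun ℓ' => by
    by_cases h : ℓ = ℓ'
    · exact ⟨1, one_pos, Eventually.of_forall fun n h' => absurd h h'⟩
    · obtain ⟨K, hK, hev⟩ := hγ₂_rate ℓ' h ε' hε'0
      exact ⟨K, hK, hev.mono fun n hn _ => hn⟩
  choose k₃ hk₃ hev₃ using h3
  set K₃ := ∑ ℓ', k₃ ℓ' with hK₃
  have hk₃K : ∀ ℓ', k₃ ℓ' ≤ K₃ := fun ℓ' =>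
    Finset.single_le_sum (f := k₃) (fun i _ => (hk₃ i).le) (Finset.mem_univ ℓ')
  have hK₃0 : 0 ≤ K₃ := Finset.sum_nonneg fun i _ => (hk₃ i).le
  -- constants of the deterministic bound
  set a := max COm 0 + 1 with ha
  have ha0 : 0 < a := by positivity
  set Kg := Cd' * Cb' + 1 with hKg
  have hKg0 : 0 < Kg := by positivity
  set C' := Cd' ^ 2 * max C 0 with hC'
  have hC'0 : 0 ≤ C' := by positivity
  -- `B₁` and `B₂` carry the coefficients of the two smallness conditions of
  -- `CrossFit.sum_abs_rhoHat_sub_le`: `r n` and `κ n` below `B₁⁻¹ λ` give the first, `s λ < c / 32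
  -- / B₂` the second.
  set B₁ := 8 * (Kg * a * (4 * L * K₄ + CD * K₃ + 4 * K₂ * A)) + 1 with hB₁
  have hB₁0 : 0 < B₁ := by positivity
  set B₂ := (2 * (4 * K₂) * a * Kg + Kg * K₁ * Kg) with hB₂
  have hB₂0 : 0 < B₂ := by positivity
  -- eventual inequalities
  have hr_le : ∀ τ : ℝ, 0 < τ → ∀ᶠ n in atTop, r n ≤ τ * (S n).lam := fun τ hτ => by
    filter_upwards [h_rate_q.bound hτ] with n hn
    rwa [Real.norm_of_nonneg (hr0 n), Real.norm_of_nonneg (hlam n).le] at hn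
  have hκ_le : ∀ τ : ℝ, 0 < τ → ∀ᶠ n in atTop, κ n ≤ τ * (S n).lam := fun τ hτ => by
    filter_upwards [h_rate_κ.bound hτ] with n hn
    rwa [Real.norm_of_nonneg (hκ_nonneg n), Real.norm_of_nonneg (hlam n).le] at hn
  have hs_lam : ∀ n, (S n).lam ≤ s n * (S n).lam := fun n => by
    have : (1 : ℝ) ≤ s n := by exact_mod_cast hs n
    nlinarith [hlam n]
  have hlam0 : ∀ τ : ℝ, 0 < τ → ∀ᶠ n in atTop, (s n : ℝ) * (S n).lam < τ := fun τ hτ =>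
    h_rate_s.eventually_lt_const hτ
  refine ⟨8 * (a * C') + 160 / c, by positivity, ?_⟩
  filter_upwards [hev₁, eventually_all.2 hev₃, hOm_bdd, h_sparse, h_restrEig,
    eventually_ge_atTop 1, eventually_div_four_le_sub_blockSize hL h_folds,
    hr_le 1 one_pos, hκ_le 1 one_pos, hr_le B₁⁻¹ (inv_pos.2 hB₁0), hκ_le B₁⁻¹ (inv_pos.2 hB₁0),
    hlam0 (rD / (K₃ + 1)) (by positivity), hlam0 (K₁⁻¹) (by positivity),
    hlam0 ((4 * K₂)⁻¹) (by positivity), hlam0 (c / 32 / B₂) (by positivity)]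
    with n e₁ e₃ eOm eSp eRE en1 efold er1 eκ1 erB eκB elr elK₁ elK₂ elc
  obtain ⟨hρs, hρA, hρe⟩ := eSp
  have hSn := hS n
  have hn0 : (0 : ℝ) < n := by exact_mod_cast en1
  have hs1 : (1 : ℝ) ≤ s n := by exact_mod_cast hs n
  rw [one_mul] at er1 eκ1
  have hlamn := hlam n
  have hsl := hs_lam n
  set t₂ := K₂ * Real.sqrt (n * Real.log (S n).q) with ht₂
  set t₄ := K₄ * Real.sqrt (n * Real.log (S n).q) with ht₄
  have ht₂0 : 0 ≤ t₂ := by positivity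
  have ht₄0 : 0 ≤ t₄ := by positivity
  have hf₂ : 4 / (n : ℝ) * t₂ = 4 * K₂ * r n := four_div_mul_sqrt en1 _ _
  have hf₄ : 4 / (n : ℝ) * (L * t₄) = 4 * L * K₄ * r n := by
    have := four_div_mul_sqrt en1 K₄ (Real.log (S n).q)
    calc 4 / (n : ℝ) * (L * t₄) = L * (4 / (n : ℝ) * t₄) := by ring
      _ = _ := by rw [ht₄, this]; ring
  have hr1 : r n ≤ s n * (S n).lam := er1.trans hsl
  have hκ1 : κ n ≤ s n * (S n).lam := eκ1.trans hsl
  -- This puts the `γ̂_{ℓ,ℓ'}` in the neighbourhood where the derivative is bounded and Lipschitz in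
  -- mean.
  have hK₃κ : K₃ * κ n ≤ rD := by
    rw [lt_div_iff₀ (by positivity)] at elr
    have h0 : 0 ≤ (s n : ℝ) * (S n).lam := by positivity
    have h1 := mul_le_mul_of_nonneg_left hκ1 hK₃0
    rw [mul_add, mul_one, mul_comm _ K₃] at elr
    linarith
  have hK₁r : K₁ * r n ≤ 1 := by
    have := mul_le_mul_of_nonneg_left (hr1.trans elK₁.le) hK₁.le
    rwa [mul_inv_cancel₀ hK₁.ne'] at this
  have hK₂r : 4 * K₂ * r n ≤ 1 := by
    have := mul_le_mul_of_nonneg_left (hr1.trans elK₂.le) (by positivity : 0 ≤ 4 * K₂)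
    rwa [mul_inv_cancel₀ (by positivity)] at this
  -- exceptional events
  set E₁ := {ω | K₁ * r n < |rowSumNorm ((S n).OmegaHat ℓ (sample W n ω) - Om n)|} with hE₁
  set G₂ := {w | ∃ j k, 4 / (n : ℝ) * t₂ < |((S n).GHat ℓ w - (S n).GPop F₀) j k|} with hG₂
  set E₃ : Fin L → Set Ω := fun ℓ' => {ω | ℓ ≠ ℓ' ∧
    k₃ ℓ' * κ n < |msNorm F₀ ((S n).gammaHat₂ ℓ ℓ' (sample W n ω) - γ₀)|} with hE₃
  set G₄ : Fin L → Set (Fin n → Obs 𝒳 𝒵) := fun ℓ' => {w | ℓ ≠ ℓ' ∧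
    (msNorm F₀ ((S n).gammaHat₂ ℓ ℓ' w - γ₀) ≤ rD ∧ ∃ j, t₄ < |∑ i ∈ (S n).block ℓ',
          (gateaux m (w i) ((S n).gammaHat₂ ℓ ℓ' w) ((S n).d j)
            - ∫ x, gateaux m x ((S n).gammaHat₂ ℓ ℓ' w) ((S n).d j) ∂F₀)|)} with hG₄
  have p₂ : P {ω | sample W n ω ∈ G₂} ≤ ε' :=
    (measure_sample_mem_le hW_indep hW_law n G₂).trans
      ((CrossFit.measure_GHat_sub_le hSn hCb' hCd' (hb n) (hd n) en1 efold ht₂0).trans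
        (hH₂ n _ en1 hSn.two_le_q))
  have p₃ : ∀ ℓ', P (E₃ ℓ') ≤ ε' := fun ℓ' => by
    by_cases h : ℓ = ℓ'
    · have : E₃ ℓ' = ∅ := by ext ω; simp [hE₃, h]
      rw [this]; simp
    · exact (measure_mono fun ω hω => hω.2).trans (e₃ ℓ' h)
  have p₄ : ∀ ℓ', P {ω | sample W n ω ∈ G₄ ℓ'} ≤ ε' := fun ℓ' => by
    by_cases h : ℓ = ℓ'
    · have : {ω | sample W n ω ∈ G₄ ℓ'} = ∅ := by ext ω; simp [hG₄, h]
      rw [this]; simp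
    · refine (measure_sample_mem_le hW_indep hW_law n _).trans
        ((measure_mono fun w hw => hw.2).trans
        ((CrossFit.measure_gateaux_sum_sub_le hSn hγ₀.1 hCD
          (fun γ h1 h2 => (h_deriv γ h1 h2 n).1) h ht₄0).trans (hH₄ n _ en1 hSn.two_le_q)))
  have hsubset : {ω | (8 * (a * C') + 160 / c) * (s n * (S n).lam)
      < |∑ k, (|(S n).rhoHat ℓ (sample W n ω) k - ρ₀ n k|)|}
      ⊆ E₁ ∪ {ω | sample W n ω ∈ G₂} ∪ (⋃ ℓ', E₃ ℓ') ∪ ⋃ ℓ', {ω | sample W n ω ∈ G₄ ℓ'} := by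
    intro ω hω
    by_contra hnot
    simp only [Set.mem_union, Set.mem_iUnion, not_or, not_exists] at hnot
    obtain ⟨⟨⟨n₁, n₂⟩, n₃⟩, n₄⟩ := hnot
    rw [Set.mem_ofPred_eq] at hω
    refine absurd hω (not_lt.2 ?_)
    rw [abs_of_nonneg (Finset.sum_nonneg fun _ _ => abs_nonneg _)]
    set w := sample W n ω with hw
    have q₁ : rowSumNorm ((S n).OmegaHat ℓ w - Om n) ≤ K₁ * r n :=
      (le_abs_self _).trans (not_lt.1 n₁)
    have q₂ : ∀ j k, |((S n).GHat ℓ w - (S n).GPop F₀) j k| ≤ 4 * K₂ * r n := fun j k => by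
      by_contra h
      exact n₂ ⟨j, k, by rw [hf₂]; exact not_le.1 h⟩
    have q₃ : ∀ ℓ', ℓ ≠ ℓ' → msNorm F₀ ((S n).gammaHat₂ ℓ ℓ' w - γ₀) ≤ K₃ * κ n := fun ℓ' h => by
      by_contra h'
      refine n₃ ℓ' ⟨h, lt_of_le_of_lt ?_ ((not_le.1 h').trans_le (le_abs_self _))⟩
      exact mul_le_mul_of_nonneg_right (hk₃K ℓ') (hκ_nonneg n)
    have hOm1 : rowSumNorm (Om n) ≤ a := by
      have := le_max_left COm 0
      linarith
    have hOm2 : rowSumNorm ((S n).OmegaHat ℓ w) ≤ a := by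
      have h1 := rowSumNorm_le_add ((S n).OmegaHat ℓ w) (Om n)
      have := le_max_left COm 0
      linarith
    have hG1 : ∀ j k, |(S n).GPop F₀ j k| ≤ Kg := fun j k => by
      have := CrossFit.abs_GPop_le (S := S n) hCd'.le (hb n) (hd n) j k
      linarith
    have hG2 : ∀ j k, |(S n).GHat ℓ w j k| ≤ Kg := fun j k => by
      have h1 := CrossFit.abs_GPop_le (S := S n) hCd'.le (hb n) (hd n) j k
      have h2 := q₂ j k
      rw [Matrix.sub_apply] at h2
      have h3 := abs_sub_abs_le_abs_sub ((S n).GHat ℓ w j k) ((S n).GPop F₀ j k)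
      linarith
    have hM : ∀ j, |(S n).MHat m ℓ w j - ∫ x, α₀ x.2.2 * (S n).d j x.2.1 ∂F₀|
        ≤ 4 * L * K₄ * r n + CD * (K₃ * κ n) := by
      rw [← hf₄]
      refine CrossFit.abs_MHat_sub_le (M := fun j => ∫ x, α₀ x.2.2 * (S n).d j x.2.1 ∂F₀)
        (F₀ := F₀) en1 efold ht₄0 (fun ℓ' h j => ?_) (fun ℓ' h j => ?_)
      · by_contra h'
        exact n₄ ℓ' ⟨h, (q₃ ℓ' h).trans hK₃κ, j, not_le.1 h'⟩
      · refine (CrossFit.abs_integral_gateaux_sub_le hSn (hd n) h_riesz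
          (fun γ h1 h2 => h_deriv γ h1 h2 n) h ((q₃ ℓ' h).trans hK₃κ) j).trans ?_
        exact mul_le_mul_of_nonneg_left (q₃ ℓ' h) hCD.le
    -- Both parts of `ε_n` are eventually below `λ`, which turns `C s ε_n²` into the `C s λ²`
    -- required of the bias.
    have heps : epsRate (S n).q n (κ n) ≤ (S n).lam := max_le er1 eκ1
    have heps0 : 0 ≤ epsRate (S n).q n (κ n) := le_max_of_le_right (hκ_nonneg n)
    have hIerr : ∫ w, (α₀ w.2.2 - ∑ k, (S n).b k w.2.2 * ρ₀ n k) ^ 2 ∂F₀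
        ≤ max C 0 * s n * (S n).lam ^ 2 := by
      refine hρe.trans ?_
      calc C * s n * epsRate (S n).q n (κ n) ^ 2
          ≤ max C 0 * s n * epsRate (S n).q n (κ n) ^ 2 := by
            gcongr; exact le_max_left _ _
        _ ≤ _ := by gcongr
    refine CrossFit.sum_abs_rhoHat_sub_le hSn (M := fun j => ∫ x, α₀ x.2.2 * (S n).d j x.2.1 ∂F₀)
      (K := Kg) (A := A) (g := 4 * K₂ * r n) (o := K₁ * r n)
      (δM := 4 * L * K₄ * r n + CD * (K₃ * κ n))
      (e := Cd' * Real.sqrt (∫ w, (α₀ w.2.2 - ∑ k, (S n).b k w.2.2 * ρ₀ n k) ^ 2 ∂F₀))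
      (hs n) hKg0.le (by have := hr0 n; positivity) hC'0 ha0.le hc
      (by have := hr0 n; have := hκ_nonneg n; positivity) hOm1 hOm2 q₁ hG1 hG2 q₂ hM
      (CrossFit.abs_moment_sub_le hSn (hb n) (hd n) hCd'.le hα₀ (ρ₀ n)) (by positivity) ?_
      hρs hρA eRE ?_ ?_
    · rw [mul_pow, Real.sq_sqrt (integral_nonneg fun _ => sq_nonneg _)]
      calc Cd' ^ 2 * _ ≤ Cd' ^ 2 * (max C 0 * s n * (S n).lam ^ 2) := by gcongr
        _ = _ := by rw [hC']; ring
    · set X := 4 * L * K₄ + CD * K₃ + 4 * K₂ * A with hX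
      have hX0 : 0 ≤ X := by positivity
      have h1 : 4 * L * K₄ * r n + CD * (K₃ * κ n) + 4 * K₂ * r n * A
          ≤ X * (B₁⁻¹ * (S n).lam) := by
        have i1 : 4 * L * K₄ * r n ≤ 4 * L * K₄ * (B₁⁻¹ * (S n).lam) := by gcongr
        have i2 : CD * (K₃ * κ n) ≤ CD * (K₃ * (B₁⁻¹ * (S n).lam)) := by gcongr
        have i3 : 4 * K₂ * r n * A ≤ 4 * K₂ * (B₁⁻¹ * (S n).lam) * A := by gcongr
        calc _ ≤ _ := add_le_add (add_le_add i1 i2) i3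
          _ = _ := by rw [hX]; ring
      calc Kg * a * _ ≤ Kg * a * (X * (B₁⁻¹ * (S n).lam)) := by gcongr
        _ = (Kg * a * X) * B₁⁻¹ * (S n).lam := by ring
        _ ≤ 1 / 8 * (S n).lam := by
            refine mul_le_mul_of_nonneg_right ?_ hlamn.le
            rw [← div_eq_mul_inv, div_le_iff₀ hB₁0, hB₁]
            linarith
        _ = _ := by ring
    · have h1 : (2 * (4 * K₂ * r n) * a * Kg + Kg * (K₁ * r n) * Kg) * s n
          = B₂ * (s n * r n) := by rw [hB₂]; ring
      rw [h1]
      rw [lt_div_iff₀ hB₂0] at elc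
      have h2 : (s n : ℝ) * r n ≤ s n * (S n).lam := by gcongr
      have := mul_le_mul_of_nonneg_left h2 hB₂0.le
      linarith
  refine (measure_mono hsubset).trans ?_
  refine (measure_union_le _ _).trans ?_
  rw [← hbudget]
  refine add_le_add ((measure_union_le _ _).trans (add_le_add ((measure_union_le _ _).trans
    (add_le_add e₁ p₂)) ?_)) ?_
  · exact measure_iUnion_fin_le_mul p₃
  · exact measure_iUnion_fin_le_mul p₄

end CoefficientRate

/-! ### The estimation error of the orthogonal score -/

namespace CrossFit

variable {𝒳 𝒵 : Type*} {L n : ℕ}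

/-- The difference between the estimated and the true uncentered score at `x`, where `g` is a
version of `m(·, γ₀)` and the estimators are computed from the sample `w`. -/
noncomputable def scoreError (m : Obs 𝒳 𝒵 → (𝒳 → ℝ) → ℝ) (g : Obs 𝒳 𝒵 → ℝ) (γ₀ : 𝒳 → ℝ)
    (α₀ : 𝒵 → ℝ) (S : CrossFit 𝒳 𝒵 L n) (ℓ : Fin L) (w : Fin n → Obs 𝒳 𝒵) (x : Obs 𝒳 𝒵) : ℝ :=
  m x (S.gammaHat ℓ w) - g x
    + (S.alphaHat ℓ w x.2.2 * (x.1 - S.gammaHat ℓ w x.2.1) - α₀ x.2.2 * (x.1 - γ₀ x.2.1))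

variable [MeasurableSpace 𝒳] [MeasurableSpace 𝒵] {F₀ : Measure (Obs 𝒳 𝒵)}
  [IsProbabilityMeasure F₀] {m : Obs 𝒳 𝒵 → (𝒳 → ℝ) → ℝ} {S : CrossFit 𝒳 𝒵 L n} {ℓ : Fin L}
  {g : Obs 𝒳 𝒵 → ℝ} {γ₀ : 𝒳 → ℝ} {α₀ : 𝒵 → ℝ}

omit [IsProbabilityMeasure F₀] in
theorem measurable_alphaHat (hS : S.IsDoubleCrossFitPGMM F₀ m) :
    Measurable fun s : (Fin n → Obs 𝒳 𝒵) × Obs 𝒳 𝒵 => S.alphaHat ℓ s.1 s.2.2.2 :=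
  Finset.measurable_fun_sum _ fun k _ =>
    ((hS.measurable_b k).comp measurable_snd.snd.snd).mul
      ((measurable_pi_apply k).comp ((hS.measurable_rhoHat ℓ).comp measurable_fst))

omit [IsProbabilityMeasure F₀] in
theorem measurable_scoreError (hS : S.IsDoubleCrossFitPGMM F₀ m) (hg : Measurable g)
    (hγ₀ : Measurable γ₀) (hα₀ : Measurable α₀) :
    Measurable fun s : (Fin n → Obs 𝒳 𝒵) × Obs 𝒳 𝒵 => scoreError m g γ₀ α₀ S ℓ s.1 s.2 := by
  have hγ : Measurable fun s : (Fin n → Obs 𝒳 𝒵) × Obs 𝒳 𝒵 => S.gammaHat ℓ s.1 s.2.2.1 :=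
    (hS.measurable_gammaHat ℓ).comp (measurable_fst.prodMk measurable_snd.snd.fst)
  have hy : Measurable fun s : (Fin n → Obs 𝒳 𝒵) × Obs 𝒳 𝒵 => s.2.1 := measurable_snd.fst
  exact ((hS.measurable_m_gammaHat ℓ).sub (hg.comp measurable_snd)).add
    (((measurable_alphaHat hS).mul (hy.sub hγ)).sub
      ((hα₀.comp measurable_snd.snd.snd).mul (hy.sub (hγ₀.comp measurable_snd.snd.fst))))

omit [MeasurableSpace 𝒳] [MeasurableSpace 𝒵] in
theorem compl_block_coe :
    ((S.block ℓ : Finset (Fin n)) : Set (Fin n))ᶜ = {i | S.fold i ≠ ℓ} := by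
  ext i
  simp [mem_block]

-- The only estimates inside are `γ̂_ℓ` and `ρ̂_ℓ`, both computed outside `I_ℓ`. This is what opens
-- the block inequalities to the score error.
omit [IsProbabilityMeasure F₀] in
theorem dependsOn_scoreError (hS : S.IsDoubleCrossFitPGMM F₀ m) :
    DependsOn (scoreError m g γ₀ α₀ S ℓ) ((S.block ℓ : Finset (Fin n)) : Set (Fin n))ᶜ := by
  rw [compl_block_coe]
  intro w w' h
  ext x
  simp only [scoreError, alphaHat, hS.dependsOn_gammaHat ℓ h, hS.dependsOn_rhoHat ℓ h]

omit [MeasurableSpace 𝒳] [MeasurableSpace 𝒵] in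
theorem abs_instrument_comb_le {b : Fin S.p → ℝ} {Cb : ℝ} (hb : ∀ k, |b k| ≤ Cb)
    (ρ : Fin S.p → ℝ) : |∑ k, b k * ρ k| ≤ Cb * ∑ k, |ρ k| := by
  rw [Finset.mul_sum]
  refine (Finset.abs_sum_le_sum_abs _ _).trans (Finset.sum_le_sum fun k _ => ?_)
  rw [abs_mul]
  exact mul_le_mul_of_nonneg_right (hb k) (abs_nonneg _)

/-- First and second population moments of the score error when the ingredients are close to
their limits. -/
theorem scoreError_moments (hS : S.IsDoubleCrossFitPGMM F₀ m) (hg : Measurable g)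
    (hgm : g =ᵐ[F₀] fun w => m w γ₀) (hγ₀ : IsSquareIntegrable F₀ γ₀) (hα₀ : Measurable α₀)
    (hm_int : Integrable (fun w => m w γ₀) F₀)
    (hε_sq : MemLp (fun w : Obs 𝒳 𝒵 => w.1 - γ₀ w.2.1) 2 F₀)
    (h_exog : F₀[fun w : Obs 𝒳 𝒵 => w.1 - γ₀ w.2.1 | instrumentSigma 𝒳 𝒵] =ᵐ[F₀] 0)
    (h_riesz : ∀ ζ : 𝒳 → ℝ, IsSquareIntegrable F₀ ζ →
      Integrable (fun w => gateaux m w γ₀ ζ) F₀ ∧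
        ∫ w, gateaux m w γ₀ ζ ∂F₀ = ∫ w, α₀ w.2.2 * ζ w.2.1 ∂F₀)
    {Cα Cv Cb CQ rQ A h₀ τ μ : ℝ} (hCα : ∀ᵐ w ∂F₀, |α₀ w.2.2| ≤ Cα) (hCv0 : 0 ≤ Cv)
    (hCv : ∀ᵐ w ∂F₀,
      (F₀[fun w : Obs 𝒳 𝒵 => (w.1 - γ₀ w.2.1) ^ 2 | instrumentSigma 𝒳 𝒵]) w ≤ Cv)
    (hCb0 : 0 ≤ Cb) (hb : ∀ᵐ w ∂F₀, ∀ k, |S.b k w.2.2| ≤ Cb)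
    (h_quad : ∀ γ : 𝒳 → ℝ, IsSquareIntegrable F₀ γ → msNorm F₀ (γ - γ₀) ≤ rQ →
        Integrable (fun w => m w γ) F₀ ∧
        |∫ w, (m w γ - m w γ₀ - gateaux m w γ₀ (γ - γ₀)) ∂F₀| ≤ CQ * msNorm F₀ (γ - γ₀) ^ 2)
    {ρ₀ : Fin S.p → ℝ} (hA : ∑ k, |ρ₀ k| ≤ A)
    (hh₀ : ∫ w, (α₀ w.2.2 - ∑ k, S.b k w.2.2 * ρ₀ k) ^ 2 ∂F₀ ≤ h₀)
    {w : Fin n → Obs 𝒳 𝒵} (hτ : ∑ k, |S.rhoHat ℓ w k - ρ₀ k| ≤ τ)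
    (hr : msNorm F₀ (S.gammaHat ℓ w - γ₀) ≤ rQ) (hμ0 : 0 ≤ μ)
    (hμ : ∫⁻ x, ENNReal.ofReal ((m x (S.gammaHat ℓ w) - g x) ^ 2) ∂F₀ ≤ ENNReal.ofReal μ) :
    MemLp (scoreError m g γ₀ α₀ S ℓ w) 2 F₀ ∧
    ∫ x, scoreError m g γ₀ α₀ S ℓ w x ^ 2 ∂F₀
      ≤ 4 * (μ + Cα ^ 2 * msNorm F₀ (S.gammaHat ℓ w - γ₀) ^ 2
        + Cv * (2 * (Cb * τ) ^ 2 + 2 * h₀)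
        + (Cb * (τ + A) + Cα) ^ 2 * msNorm F₀ (S.gammaHat ℓ w - γ₀) ^ 2) ∧
    |∫ x, scoreError m g γ₀ α₀ S ℓ w x ∂F₀|
      ≤ CQ * msNorm F₀ (S.gammaHat ℓ w - γ₀) ^ 2
        + Real.sqrt (2 * (Cb * τ) ^ 2 + 2 * h₀) * msNorm F₀ (S.gammaHat ℓ w - γ₀) := by
  set γ := S.gammaHat ℓ w with hγ
  have hγs : IsSquareIntegrable F₀ γ := hS.gammaHat_sq ℓ w
  have hΔ := hγs.sub hγ₀
  set u : Obs 𝒳 𝒵 → ℝ := fun x => m x γ - g x with hu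
  have hum : Measurable u :=
    ((hS.measurable_m_gammaHat ℓ).comp (measurable_const.prodMk measurable_id)).sub hg
  -- Consistency of `m(·, γ̂)` is given as a bound on a lower integral, so square integrability is
  -- deduced from its finiteness.
  have husq : Integrable (fun x => u x ^ 2) F₀ :=
    (lintegral_ofReal_ne_top_iff_integrable (hum.pow_const 2).aestronglyMeasurable
      (ae_of_all _ fun x => sq_nonneg _)).1 (ne_top_of_le_ne_top ENNReal.ofReal_ne_top hμ)
  have huL : MemLp u 2 F₀ := (memLp_two_iff_integrable_sq hum.aestronglyMeasurable).2 husq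
  have huμ : ∫ x, u x ^ 2 ∂F₀ ≤ μ := by
    rw [integral_eq_lintegral_of_nonneg_ae (ae_of_all _ fun x => sq_nonneg _)
      husq.aestronglyMeasurable]
    exact ENNReal.toReal_le_of_le_ofReal hμ0 hμ
  set β : 𝒵 → ℝ := fun z => S.alphaHat ℓ w z - α₀ z with hβ
  have hαm : Measurable fun z => S.alphaHat ℓ w z :=
    Finset.measurable_fun_sum _ fun k _ => (hS.measurable_b k).mul_const _
  have hβm : Measurable β := hαm.sub hα₀
  have hτ0 : 0 ≤ τ := (Finset.sum_nonneg fun _ _ => abs_nonneg _).trans hτ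
  have hρ : ∑ k, |S.rhoHat ℓ w k| ≤ τ + A := by
    refine le_trans ?_ (add_le_add hτ hA)
    rw [← Finset.sum_add_distrib]
    refine Finset.sum_le_sum fun k _ => ?_
    have := abs_add_le (S.rhoHat ℓ w k - ρ₀ k) (ρ₀ k)
    rwa [sub_add_cancel] at this
  have hK : ∀ᵐ x ∂F₀, |β x.2.2| ≤ Cb * (τ + A) + Cα := by
    filter_upwards [hb, hCα] with x hx hx'
    refine (abs_sub _ _).trans (add_le_add ?_ hx')
    exact (abs_instrument_comb_le hx _).trans (mul_le_mul_of_nonneg_left hρ hCb0)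
  have hα₀L : MemLp (fun x : Obs 𝒳 𝒵 => α₀ x.2.2) 2 F₀ :=
    MemLp.of_bound (hα₀.comp measurable_snd.snd).aestronglyMeasurable Cα hCα
  have hβint : ∫ x, β x.2.2 ^ 2 ∂F₀ ≤ 2 * (Cb * τ) ^ 2 + 2 * h₀ := by
    have hβL : MemLp (fun x : Obs 𝒳 𝒵 => β x.2.2) 2 F₀ :=
      MemLp.of_bound (hβm.comp measurable_snd.snd).aestronglyMeasurable _ hK
    have happ := (hα₀L.sub (memLp_instrument_comb hS.measurable_b hb ρ₀)).integrable_sq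
    have happ' : Integrable (fun x : Obs 𝒳 𝒵 =>
        2 * (α₀ x.2.2 - ∑ k, S.b k x.2.2 * ρ₀ k) ^ 2) F₀ := happ.const_mul 2
    calc ∫ x, β x.2.2 ^ 2 ∂F₀
        ≤ ∫ x, (2 * (Cb * τ) ^ 2 + 2 * (α₀ x.2.2 - ∑ k, S.b k x.2.2 * ρ₀ k) ^ 2) ∂F₀ := by
          refine integral_mono_ae hβL.integrable_sq ((integrable_const _).add happ') ?_
          filter_upwards [hb] with x hx
          -- Coefficient error plus approximation error: the former is bounded uniformly by `Cb *
          -- τ`, the latter in mean square.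
          have e : β x.2.2 = ∑ k, S.b k x.2.2 * (S.rhoHat ℓ w k - ρ₀ k)
              - (α₀ x.2.2 - ∑ k, S.b k x.2.2 * ρ₀ k) := by
            simp only [hβ, alphaHat, mul_sub, Finset.sum_sub_distrib]
            ring
          have h1 : |∑ k, S.b k x.2.2 * (S.rhoHat ℓ w k - ρ₀ k)| ≤ Cb * τ :=
            (abs_instrument_comb_le hx _).trans (mul_le_mul_of_nonneg_left hτ hCb0)
          have h2 := sq_le_sq' (abs_le.1 h1).1 (abs_le.1 h1).2
          rw [e]
          generalize ∑ k, S.b k x.2.2 * (S.rhoHat ℓ w k - ρ₀ k) = y at h2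
          generalize α₀ x.2.2 - ∑ k, S.b k x.2.2 * ρ₀ k = z
          nlinarith [sq_nonneg (y + z)]
      _ = 2 * (Cb * τ) ^ 2 + 2 * ∫ x, (α₀ x.2.2 - ∑ k, S.b k x.2.2 * ρ₀ k) ^ 2 ∂F₀ := by
          rw [integral_add (integrable_const _) happ', integral_const, integral_const_mul]
          simp
      _ ≤ _ := by linarith
  obtain ⟨b1, b2, b3⟩ := score_error_bounds huL hε_sq hΔ hβm hα₀ h_exog hCv hCα hK
  -- With `Δ = γ - γ₀`, the correction terms differ by `-α₀ Δ + β ε - β Δ`; the first of these is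
  -- set against `u`.
  have hf : scoreError m g γ₀ α₀ S ℓ w = fun x => u x - α₀ x.2.2 * (γ - γ₀) x.2.1
      + (β x.2.2 * (x.1 - γ₀ x.2.1) - β x.2.2 * (γ - γ₀) x.2.1) := by
    ext x
    change u x + (S.alphaHat ℓ w x.2.2 * (x.1 - γ x.2.1) - α₀ x.2.2 * (x.1 - γ₀ x.2.1))
      = u x - α₀ x.2.2 * (γ x.2.1 - γ₀ x.2.1)
        + ((S.alphaHat ℓ w x.2.2 - α₀ x.2.2) * (x.1 - γ₀ x.2.1)
          - (S.alphaHat ℓ w x.2.2 - α₀ x.2.2) * (γ x.2.1 - γ₀ x.2.1))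
    ring
  rw [hf]
  refine ⟨b1, b2.trans ?_, b3.trans ?_⟩
  · gcongr
  · obtain ⟨q1, q2⟩ := h_quad γ hγs hr
    obtain ⟨r1, r2⟩ := h_riesz _ hΔ
    -- By the Riesz identity `E[α₀ Δ]` is the mean of the linear term of `m`, so only the quadratic
    -- remainder is left of `E[u - α₀ Δ]`.
    have e : ∫ x, (m x γ - m x γ₀ - gateaux m x γ₀ (γ - γ₀)) ∂F₀
        = ∫ x, u x ∂F₀ - ∫ x, α₀ x.2.2 * (γ - γ₀) x.2.1 ∂F₀ := by
      have q3 : Integrable (fun x => m x γ - m x γ₀) F₀ := q1.sub hm_int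
      rw [integral_sub q3 r1, r2]
      congr 1
      refine integral_congr_ae ?_
      filter_upwards [hgm] with x hx
      simp only [hu, hx]
    rw [e] at q2
    refine add_le_add q2 ?_
    exact mul_le_mul_of_nonneg_right (Real.sqrt_le_sqrt hβint) (Real.sqrt_nonneg _)

end CrossFit

/-! ### Negligibility of the cross-fitted score errors. -/

section Negligible

variable {Ω 𝒳 𝒵 : Type*} [MeasurableSpace Ω] [MeasurableSpace 𝒳] [MeasurableSpace 𝒵]
  {P : Measure Ω} [IsProbabilityMeasure P] {F₀ : Measure (Obs 𝒳 𝒵)} [IsProbabilityMeasure F₀]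
  {m : Obs 𝒳 𝒵 → (𝒳 → ℝ) → ℝ}

set_option maxHeartbeats 1000000 in
/-- The normalized sum and the mean square of the score errors over a fold are asymptotically
negligible. -/
theorem eventually_measure_scoreError_le
    {W : ℕ → Ω → Obs 𝒳 𝒵} (hW_indep : iIndepFun W P) (hW_law : ∀ i, HasLaw (W i) F₀ P)
    {g : Obs 𝒳 𝒵 → ℝ} {γ₀ : 𝒳 → ℝ} {α₀ : 𝒵 → ℝ} (hg : Measurable g)
    (hgm : g =ᵐ[F₀] fun w => m w γ₀) (hγ₀ : IsSquareIntegrable F₀ γ₀) (hα₀ : Measurable α₀)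
    (hm_int : Integrable (fun w => m w γ₀) F₀)
    (hε_sq : MemLp (fun w : Obs 𝒳 𝒵 => w.1 - γ₀ w.2.1) 2 F₀)
    (h_exog : F₀[fun w : Obs 𝒳 𝒵 => w.1 - γ₀ w.2.1 | instrumentSigma 𝒳 𝒵] =ᵐ[F₀] 0)
    (h_riesz : ∀ ζ : 𝒳 → ℝ, IsSquareIntegrable F₀ ζ →
      Integrable (fun w => gateaux m w γ₀ ζ) F₀ ∧
        ∫ w, gateaux m w γ₀ ζ ∂F₀ = ∫ w, α₀ w.2.2 * ζ w.2.1 ∂F₀)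
    {L : ℕ} {S : ∀ n, CrossFit 𝒳 𝒵 L n} (hS : ∀ n, (S n).IsDoubleCrossFitPGMM F₀ m) {ℓ : Fin L}
    {Cα Cv Cb CQ rQ A C : ℝ} (hCα : ∀ᵐ w ∂F₀, |α₀ w.2.2| ≤ Cα) (hCv0 : 0 ≤ Cv)
    (hCv : ∀ᵐ w ∂F₀,
      (F₀[fun w : Obs 𝒳 𝒵 => (w.1 - γ₀ w.2.1) ^ 2 | instrumentSigma 𝒳 𝒵]) w ≤ Cv)
    (hCb0 : 0 ≤ Cb) (hb : ∀ n, ∀ᵐ w ∂F₀, ∀ k, |(S n).b k w.2.2| ≤ Cb)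
    (hCQ : 0 < CQ) (hrQ : 0 < rQ)
    (h_quad : ∀ γ : 𝒳 → ℝ, IsSquareIntegrable F₀ γ → msNorm F₀ (γ - γ₀) ≤ rQ →
        Integrable (fun w => m w γ) F₀ ∧
        |∫ w, (m w γ - m w γ₀ - gateaux m w γ₀ (γ - γ₀)) ∂F₀| ≤ CQ * msNorm F₀ (γ - γ₀) ^ 2)
    {κ : ℕ → ℝ} (hκ_nonneg : ∀ n, 0 ≤ κ n) {s : ℕ → ℕ} (hs : ∀ n, 1 ≤ s n)
    {ρ₀ : ∀ n, Fin (S n).p → ℝ} (h_sparse : ∀ᶠ n in atTop, ∑ k, |ρ₀ n k| ≤ A ∧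
        ∫ w, (α₀ w.2.2 - ∑ k, (S n).b k w.2.2 * ρ₀ n k) ^ 2 ∂F₀
          ≤ C * s n * epsRate (S n).q n (κ n) ^ 2)
    (hρ : IsBigOInProb P (fun n ω => ∑ k, |(S n).rhoHat ℓ (sample W n ω) k - ρ₀ n k|)
      (fun n => s n * (S n).lam))
    (hγ_rate : IsBigOInProb P
      (fun n ω => msNorm F₀ ((S n).gammaHat ℓ (sample W n ω) - γ₀)) κ)
    (hγ_quarter : TendstoInMeasure P
      (fun (n : ℕ) ω => (n : ℝ) ^ (1 / 4 : ℝ) *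
        msNorm F₀ ((S n).gammaHat ℓ (sample W n ω) - γ₀)) atTop (fun _ => 0))
    (hm_consist : ∀ δ : ℝ≥0∞, 0 < δ → Tendsto (fun n => P {ω | δ ≤
      ∫⁻ w, ENNReal.ofReal ((m w ((S n).gammaHat ℓ (sample W n ω)) - m w γ₀) ^ 2) ∂F₀})
      atTop (𝓝 0))
    (h_rate_q : (fun n : ℕ => Real.sqrt (Real.log (S n).q / n)) =o[atTop] fun n => (S n).lam)
    (h_rate_κ : κ =o[atTop] fun n => (S n).lam)
    (h_rate_s : Tendsto (fun n => (s n : ℝ) * (S n).lam) atTop (𝓝 0))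
    (h_rate_prod : Tendsto (fun n : ℕ => Real.sqrt n * ((s n : ℝ) * (S n).lam) * κ n)
      atTop (𝓝 0)) {δ : ℝ} (hδ : 0 < δ) {ε : ℝ≥0∞} (hε : 0 < ε) :
    ∀ᶠ n : ℕ in atTop,
      P {ω | δ * Real.sqrt n ≤ |∑ i ∈ (S n).block ℓ,
        CrossFit.scoreError m g γ₀ α₀ (S n) ℓ (sample W n ω) (sample W n ω i)|} ≤ ε ∧
      P {ω | δ * n ≤ ∑ i ∈ (S n).block ℓ,
        CrossFit.scoreError m g γ₀ α₀ (S n) ℓ (sample W n ω) (sample W n ω i) ^ 2} ≤ ε := by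
  -- Four shares pay for leaving the good event `G`, the fifth for Chebyshev or Markov on it.
  set ε' : ℝ≥0∞ := ε / 5 with hε'
  have hε'0 : 0 < ε' := ENNReal.div_pos hε.ne' (by norm_num)
  have hbudget : ε' + ε' + ε' + ε' + ε' = ε := by
    have : ε' + ε' + ε' + ε' + ε' = 5 * ε' := by ring
    rw [this, hε', ENNReal.mul_div_cancel (by norm_num) (by norm_num)]
  obtain ⟨K₁, hK₁, ev₁⟩ := hγ_rate ε' hε'0
  obtain ⟨K₂, hK₂, ev₂⟩ := hρ ε' hε'0
  obtain ⟨x, hx, hxε⟩ := exists_pos_ofReal_le hε'0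
  have hlam : ∀ n, 0 < (S n).lam := fun n => (hS n).lam_pos
  have hr_le : ∀ᶠ n : ℕ in atTop, Real.sqrt (Real.log (S n).q / n) ≤ (S n).lam := by
    filter_upwards [h_rate_q.bound one_pos] with n hn
    rwa [Real.norm_of_nonneg (Real.sqrt_nonneg _), Real.norm_of_nonneg (hlam n).le, one_mul] at hn
  have hκ_le : ∀ᶠ n in atTop, κ n ≤ (S n).lam := by
    filter_upwards [h_rate_κ.bound one_pos] with n hn
    rwa [Real.norm_of_nonneg (hκ_nonneg n), Real.norm_of_nonneg (hlam n).le, one_mul] at hn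
  obtain ⟨n₀, hn₀⟩ := h_sparse.exists
  have hA : 0 ≤ A := (Finset.sum_nonneg fun _ _ => abs_nonneg _).trans hn₀.1
  -- Every ingredient is driven below one level `η`. `D` carries the coefficients of `η` in the
  -- variance and the scaled squared bias, and `D η ≤ τ` puts both the Chebyshev bound (factor `δ ^
  -- 2`) and the Markov bound (factor `δ`) below `x`.
  set τ := min (δ ^ 2 * x) (δ * x) with hτ
  have hτ0 : 0 < τ := by positivity
  set K := Cb * (K₂ + A) + Cα with hK
  set H := 2 * (Cb * K₂) ^ 2 + 2 * max C 0 with hH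
  have hH0 : 0 ≤ H := by positivity
  set D := 4 * (1 + Cα ^ 2 + Cv + K ^ 2) + (CQ + 1) ^ 2 with hD
  have hD0 : 0 < D := by positivity
  set η := min 1 (min rQ (τ / D)) with hη
  have hη0 : 0 < η := by positivity
  have hη1 : η ≤ 1 := min_le_left _ _
  have hη2 : η ^ 2 ≤ η := pow_le_of_le_one hη0.le hη1 two_ne_zero
  have hηr : η ≤ rQ := (min_le_right _ _).trans (min_le_left _ _)
  have hηD : D * η ≤ τ := by
    have : η ≤ τ / D := (min_le_right _ _).trans (min_le_right _ _)
    rwa [le_div_iff₀ hD0, mul_comm] at this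
  have ev₃ := (tendstoInMeasure_const_iff_eventually_le.1 hγ_quarter) η hη0 ε' hε'0
  have ev₄ := (ENNReal.tendsto_nhds_zero.1 (hm_consist (ENNReal.ofReal η) (by simpa using hη0)))
    ε' hε'0
  have lim₁ : Tendsto (fun n => H * ((s n : ℝ) * (S n).lam) ^ 2) atTop (𝓝 0) := by
    simpa using (h_rate_s.pow 2).const_mul H
  have lim₂ : Tendsto (fun n : ℕ => Real.sqrt H * K₁ *
      (Real.sqrt n * ((s n : ℝ) * (S n).lam) * κ n)) atTop (𝓝 0) := by
    simpa using h_rate_prod.const_mul (Real.sqrt H * K₁)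
  filter_upwards [ev₁, ev₂, ev₃, ev₄, h_sparse, hr_le, hκ_le, eventually_ge_atTop 1,
    lim₁.eventually_lt_const hη0, lim₂.eventually_lt_const hη0,
    h_rate_s.eventually_lt_const one_pos] with n e₁ e₂ e₃ e₄ eSp er eκ en1 el₁ el₂ el₃
  obtain ⟨hρA, hρe⟩ := eSp
  have hSn := hS n
  have hn0 : (0 : ℝ) < n := by exact_mod_cast en1
  have hs1 : (1 : ℝ) ≤ s n := by exact_mod_cast hs n
  have hlamn := hlam n
  have hsl0 : 0 ≤ (s n : ℝ) * (S n).lam := by positivity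
  have hκn := hκ_nonneg n
  have heps : epsRate (S n).q n (κ n) ≤ (S n).lam := max_le er eκ
  have heps0 : 0 ≤ epsRate (S n).q n (κ n) := le_max_of_le_right hκn
  -- Besides `ε_n ≤ λ`, `s ≥ 1` gives `s λ² ≤ (s λ)²`, so the approximation error shares the rate of
  -- the coefficient error.
  have hIerr : ∫ w, (α₀ w.2.2 - ∑ k, (S n).b k w.2.2 * ρ₀ n k) ^ 2 ∂F₀
      ≤ max C 0 * (s n * (S n).lam) ^ 2 := by
    refine hρe.trans ?_
    calc C * s n * epsRate (S n).q n (κ n) ^ 2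
        ≤ max C 0 * s n * (S n).lam ^ 2 := by
          gcongr; exact le_max_left _ _
      _ = max C 0 * (s n * (S n).lam ^ 2) := by ring
      _ ≤ max C 0 * ((s n) ^ 2 * (S n).lam ^ 2) := by
          gcongr
          exact le_self_pow₀ hs1 two_ne_zero
      _ = _ := by ring
  set G : Set (Fin n → Obs 𝒳 𝒵) := {w | msNorm F₀ ((S n).gammaHat ℓ w - γ₀) ≤ K₁ * κ n ∧
    (n : ℝ) ^ (1 / 4 : ℝ) * msNorm F₀ ((S n).gammaHat ℓ w - γ₀) ≤ η ∧
    ∫⁻ x, ENNReal.ofReal ((m x ((S n).gammaHat ℓ w) - g x) ^ 2) ∂F₀ ≤ ENNReal.ofReal η ∧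
    ∑ k, |(S n).rhoHat ℓ w k - ρ₀ n k| ≤ K₂ * (s n * (S n).lam)} with hG
  have hGm : MeasurableSet G := by
    have m1 := measurable_msNorm_sub (F₀ := F₀) (hSn.measurable_gammaHat ℓ) hγ₀.1
    have m2 : Measurable fun w => ∫⁻ x, ENNReal.ofReal ((m x ((S n).gammaHat ℓ w) - g x) ^ 2) ∂F₀ :=
      Measurable.lintegral_prod_right'
        (f := fun s : (Fin n → Obs 𝒳 𝒵) × Obs 𝒳 𝒵 =>
          ENNReal.ofReal ((m s.2 ((S n).gammaHat ℓ s.1) - g s.2) ^ 2))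
        (((hSn.measurable_m_gammaHat ℓ).sub (hg.comp measurable_snd)).pow_const 2).ennreal_ofReal
    have m3 : Measurable fun w => ∑ k, |(S n).rhoHat ℓ w k - ρ₀ n k| :=
      Finset.measurable_fun_sum _ fun k _ =>
        (((measurable_pi_apply k).comp (hSn.measurable_rhoHat ℓ)).sub_const _).abs
    exact (measurableSet_le m1 measurable_const).inter
      ((measurableSet_le (m1.const_mul _) measurable_const).inter
        ((measurableSet_le m2 measurable_const).inter (measurableSet_le m3 measurable_const)))
  -- All four conditions in `G` involve only `γ̂_ℓ` and `ρ̂_ℓ`, so `G` can be conditioned on without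
  -- touching the fold.
  have hGdep : DependsOn (· ∈ G) (((S n).block ℓ : Finset (Fin n)) : Set (Fin n))ᶜ := by
    rw [CrossFit.compl_block_coe]
    intro w w' h
    simp only [hG, Set.mem_ofPred_eq, hSn.dependsOn_gammaHat ℓ h, hSn.dependsOn_rhoHat ℓ h]
  set v := 4 * (1 + Cα ^ 2 + Cv + K ^ 2) * η with hv
  have hv0 : 0 ≤ v := by positivity
  set b := (CQ + 1) * η / Real.sqrt n with hbdef
  have hsqrt : 0 < Real.sqrt n := Real.sqrt_pos.2 hn0
  have hmom : ∀ w ∈ G, MemLp (CrossFit.scoreError m g γ₀ α₀ (S n) ℓ w) 2 F₀ ∧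
      ∫ x, CrossFit.scoreError m g γ₀ α₀ (S n) ℓ w x ^ 2 ∂F₀ ≤ v ∧
      |∫ x, CrossFit.scoreError m g γ₀ α₀ (S n) ℓ w x ∂F₀| ≤ b := by
    rintro w ⟨g₁, g₂, g₃, g₄⟩
    set y := msNorm F₀ ((S n).gammaHat ℓ w - γ₀) with hy
    have hy0 : 0 ≤ y := Real.sqrt_nonneg _
    have hn4 : 1 ≤ (n : ℝ) ^ (1 / 4 : ℝ) :=
      Real.one_le_rpow (by exact_mod_cast en1) (by norm_num)
    have hyη : y ≤ η := (le_mul_of_one_le_left hy0 hn4).trans g₂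
    obtain ⟨b1, b2, b3⟩ := CrossFit.scoreError_moments hSn hg hgm hγ₀ hα₀ hm_int hε_sq h_exog
      h_riesz hCα hCv0 hCv hCb0 (hb n) h_quad hρA hIerr g₄ (hyη.trans hηr) hη0.le g₃
    have hHeq : 2 * (Cb * (K₂ * (s n * (S n).lam))) ^ 2 + 2 * (max C 0 * (s n * (S n).lam) ^ 2)
        = H * (s n * (S n).lam) ^ 2 := by rw [hH]; ring
    rw [hHeq, ← hy] at b2 b3
    refine ⟨b1, b2.trans ?_, b3.trans ?_⟩
    · have hyy : y ^ 2 ≤ η := (pow_le_pow_left₀ hy0 hyη 2).trans hη2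
      have hCα0 : 0 ≤ Cα := by
        obtain ⟨w, hw⟩ := hCα.exists
        exact (abs_nonneg _).trans hw
      have hKK : (Cb * (K₂ * (s n * (S n).lam) + A) + Cα) ^ 2 ≤ K ^ 2 := by
        rw [hK]
        gcongr
        exact mul_le_of_le_one_right hK₂.le el₃.le
      calc 4 * (η + Cα ^ 2 * y ^ 2 + Cv * (H * (s n * (S n).lam) ^ 2)
            + (Cb * (K₂ * (s n * (S n).lam) + A) + Cα) ^ 2 * y ^ 2)
          ≤ 4 * (η + Cα ^ 2 * η + Cv * η + K ^ 2 * η) := by gcongr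
        _ = v := by rw [hv]; ring
    · rw [hbdef, le_div_iff₀ hsqrt]
      -- The scaled bias: `√n y²` is the square of `n^{1/4} y`, and `√n s λ y` falls to the product
      -- rate.
      have hroot : ((n : ℝ) ^ (1 / 4 : ℝ)) ^ 2 = Real.sqrt n := by
        rw [← Real.rpow_natCast, ← Real.rpow_mul hn0.le, Real.sqrt_eq_rpow]
        norm_num
      rw [Real.sqrt_mul hH0, Real.sqrt_sq hsl0]
      have i1 : y ^ 2 * Real.sqrt n ≤ η := by
        calc y ^ 2 * Real.sqrt n = ((n : ℝ) ^ (1 / 4 : ℝ) * y) ^ 2 := by rw [← hroot]; ring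
          _ ≤ η ^ 2 := pow_le_pow_left₀ (by positivity) g₂ 2
          _ ≤ η := hη2
      have i2 : Real.sqrt H * (s n * (S n).lam) * y * Real.sqrt n ≤ η := by
        calc Real.sqrt H * (s n * (S n).lam) * y * Real.sqrt n
            ≤ Real.sqrt H * (s n * (S n).lam) * (K₁ * κ n) * Real.sqrt n := by gcongr
          _ = Real.sqrt H * K₁ * (Real.sqrt n * ((s n : ℝ) * (S n).lam) * κ n) := by ring
          _ ≤ η := el₂.le
      calc (CQ * y ^ 2 + Real.sqrt H * (s n * (S n).lam) * y) * Real.sqrt n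
          = CQ * (y ^ 2 * Real.sqrt n) + Real.sqrt H * (s n * (S n).lam) * y * Real.sqrt n := by
            ring
        _ ≤ CQ * η + η := by gcongr
        _ = (CQ + 1) * η := by ring
  have hcard : (#((S n).block ℓ) : ℝ) ≤ n := by exact_mod_cast card_finset_fin_le _
  have hmeas := CrossFit.measurable_scoreError (ℓ := ℓ) hSn hg hγ₀.1 hα₀
  have hdep := CrossFit.dependsOn_scoreError (ℓ := ℓ) (g := g) (γ₀ := γ₀) (α₀ := α₀) hSn
  have c₁ := pi_measure_le_abs_sum_le F₀ hmeas hdep hGm hGdep (t := δ * Real.sqrt n)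
    (by positivity) hmom
  have c₂ := pi_measure_le_sum_sq_le F₀ hmeas hdep hGm hGdep (t := δ * n)
    (by positivity) fun w hw => ⟨(hmom w hw).1, (hmom w hw).2.1⟩
  have d₁ : ENNReal.ofReal ((#((S n).block ℓ) * v + (#((S n).block ℓ) * b) ^ 2)
      / (δ * Real.sqrt n) ^ 2) ≤ ε' := by
    refine (ENNReal.ofReal_le_ofReal ?_).trans hxε
    rw [div_le_iff₀ (by positivity), mul_pow δ, Real.sq_sqrt hn0.le]
    have hb0 : 0 ≤ b := by positivity
    have hnb : (n * b) ^ 2 = n * ((CQ + 1) ^ 2 * η ^ 2) := by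
      rw [hbdef, mul_pow, div_pow, Real.sq_sqrt hn0.le]
      field_simp
    calc #((S n).block ℓ) * v + (#((S n).block ℓ) * b) ^ 2
        ≤ n * v + (n * b) ^ 2 := by gcongr
      _ = n * (v + (CQ + 1) ^ 2 * η ^ 2) := by rw [hnb]; ring
      _ ≤ n * (v + (CQ + 1) ^ 2 * η) := by gcongr
      _ = n * (D * η) := by rw [hv, hD]; ring
      _ ≤ n * (δ ^ 2 * x) :=
          mul_le_mul_of_nonneg_left (hηD.trans (min_le_left _ _)) hn0.le
      _ = x * (δ ^ 2 * n) := by ring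
  have d₂ : ENNReal.ofReal (#((S n).block ℓ) * v / (δ * n)) ≤ ε' := by
    refine (ENNReal.ofReal_le_ofReal ?_).trans hxε
    rw [div_le_iff₀ (by positivity)]
    have hvD : v ≤ D * η := by
      have : 0 ≤ (CQ + 1) ^ 2 * η := by positivity
      rw [hv, hD, add_mul]
      linarith
    calc #((S n).block ℓ) * v ≤ n * (δ * x) :=
          mul_le_mul hcard (hvD.trans (hηD.trans (min_le_right _ _))) hv0 hn0.le
      _ = x * (δ * n) := by ring
  have hbad : P {ω | sample W n ω ∉ G} ≤ ε' + ε' + ε' + ε' := by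
    refine le_trans (measure_mono ?_) ((measure_union_le _ _).trans (add_le_add
      ((measure_union_le _ _).trans (add_le_add ((measure_union_le _ _).trans
        (add_le_add e₁ e₂)) e₃)) e₄))
    intro ω hω
    by_contra hnot
    simp only [Set.mem_union, Set.mem_ofPred_eq, not_or, not_lt, not_le, sub_zero] at hnot
    obtain ⟨⟨⟨n₁, n₂⟩, n₃⟩, n₄⟩ := hnot
    refine hω ⟨(le_abs_self _).trans n₁, (le_abs_self _).trans n₃.le, ?_,
      (le_abs_self _).trans n₂⟩
    refine le_trans (le_of_eq (lintegral_congr_ae ?_)) n₄.le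
    filter_upwards [hgm] with x hx
    rw [hx]
  constructor
  · refine (measure_mono (t := {ω | sample W n ω ∉ G} ∪ {ω | sample W n ω ∈ {w | w ∈ G ∧
      δ * Real.sqrt n ≤ |∑ i ∈ (S n).block ℓ,
        CrossFit.scoreError m g γ₀ α₀ (S n) ℓ w (w i)|}}) fun ω hω => ?_).trans
      ((measure_union_le _ _).trans ?_)
    · by_cases h : sample W n ω ∈ G
      · exact Or.inr ⟨h, hω⟩
      · exact Or.inl h
    · rw [← hbudget]
      exact add_le_add hbad ((measure_sample_mem_le hW_indep hW_law n _).trans (c₁.trans d₁))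
  · refine (measure_mono (t := {ω | sample W n ω ∉ G} ∪ {ω | sample W n ω ∈ {w | w ∈ G ∧
      δ * n ≤ ∑ i ∈ (S n).block ℓ,
        CrossFit.scoreError m g γ₀ α₀ (S n) ℓ w (w i) ^ 2}}) fun ω hω => ?_).trans
      ((measure_union_le _ _).trans ?_)
    · by_cases h : sample W n ω ∈ G
      · exact Or.inr ⟨h, hω⟩
      · exact Or.inl h
    · rw [← hbudget]
      exact add_le_add hbad ((measure_sample_mem_le hW_indep hW_law n _).trans (c₂.trans d₂))

end Negligible

/-! ### Averages of i.i.d. variables perturbed by a negligible remainder -/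

section Perturbed

variable {Ω : Type*} [MeasurableSpace Ω] {P : Measure Ω} [IsProbabilityMeasure P]
  {X : ℕ → Ω → ℝ}

/-- Chebyshev's inequality for sums of centered i.i.d. variables, uniformly in the number of
summands. -/
theorem exists_measure_lt_abs_sum_le (hX : MemLp (X 0) 2 P) (hind : iIndepFun X P)
    (hid : ∀ i, IdentDistrib (X i) (X 0) P P) (h0 : ∫ ω, X 0 ω ∂P = 0) {ε : ℝ≥0∞} (hε : 0 < ε) :
    ∃ K : ℝ, 0 < K ∧ ∀ n : ℕ, 1 ≤ n →
      P {ω | K * Real.sqrt n < |∑ i : Fin n, X i ω|} ≤ ε := by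
  obtain ⟨r, hr, hrε⟩ := exists_pos_ofReal_le hε
  have hV := variance_nonneg (X 0) P
  -- Chebyshev needs `Var / K² ≤ r`; the added `1` keeps `K` positive when the variance is zero.
  refine ⟨Real.sqrt (Var[X 0; P] / r) + 1, by positivity, fun n hn => ?_⟩
  set K := Real.sqrt (Var[X 0; P] / r) + 1 with hK
  have hK0 : 0 < K := by positivity
  have hn0 : (0 : ℝ) < n := by exact_mod_cast hn
  have hL : ∀ i, MemLp (X i) 2 P := fun i => (hid i).memLp_iff.2 hX
  have hvar : Var[∑ i : Fin n, X i; P] = n * Var[X 0; P] := by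
    rw [IndepFun.variance_sum (X := fun i : Fin n => X i) (fun i _ => hL i) fun i _ j _ hij =>
      hind.indepFun (Fin.val_injective.ne hij)]
    simp [(hid _).variance_eq]
  have hmean : ∫ ω, (∑ i : Fin n, X i) ω ∂P = 0 := by
    simp only [Finset.sum_apply]
    rw [integral_finsetSum (f := fun (i : Fin n) ω => X i ω) _ fun i _ => (hL i).integrable one_le_two]
    simp [(hid _).integral_eq, h0]
  have hch := meas_ge_le_variance_div_sq (memLp_finsetSum' Finset.univ fun (i : Fin n) _ => hL i)
    (c := K * Real.sqrt n) (by positivity)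
  rw [hmean, hvar] at hch
  refine (measure_mono fun ω hω => ?_).trans (hch.trans
    ((ENNReal.ofReal_le_ofReal ?_).trans hrε))
  · have h : K * Real.sqrt n < |∑ i : Fin n, X i ω| := hω
    simpa using h.le
  · rw [div_le_iff₀ (by positivity), mul_pow, Real.sq_sqrt hn0.le]
    have hKr : Var[X 0; P] / r ≤ K ^ 2 := by
      have h := Real.sq_sqrt (div_nonneg hV hr.le)
      have h' := Real.sqrt_nonneg (Var[X 0; P] / r)
      nlinarith
    rw [div_le_iff₀ hr] at hKr
    nlinarith

variable {R : ∀ n : ℕ, Ω → Fin n → ℝ}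

/-- Root-`n` rate of the perturbed average. -/
theorem isBigOInProb_inv_mul_sum_add (hX : MemLp (X 0) 2 P) (hind : iIndepFun X P)
    (hid : ∀ i, IdentDistrib (X i) (X 0) P P) (h0 : ∫ ω, X 0 ω ∂P = 0)
    (hR : ∀ δ : ℝ, 0 < δ → ∀ ε : ℝ≥0∞, 0 < ε →
      ∀ᶠ n : ℕ in atTop, P {ω | δ * Real.sqrt n ≤ |∑ i, R n ω i|} ≤ ε) :
    IsBigOInProb P (fun n ω => (n : ℝ)⁻¹ * ∑ i : Fin n, (X i ω + R n ω i))
      (fun n => (Real.sqrt n)⁻¹) := by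
  intro ε hε
  obtain ⟨K, hK, hK'⟩ := exists_measure_lt_abs_sum_le hX hind hid h0 (ENNReal.half_pos hε.ne')
  refine ⟨K + 1, by positivity, ?_⟩
  filter_upwards [hR 1 one_pos _ (ENNReal.half_pos hε.ne'), eventually_ge_atTop 1] with n h1 h2
  have hn0 : (0 : ℝ) < n := by exact_mod_cast h2
  rw [← ENNReal.add_halves ε]
  refine (measure_mono fun ω hω => ?_).trans
    ((measure_union_le _ _).trans (add_le_add (hK' n h2) h1))
  by_contra hnot
  simp only [Set.mem_union, Set.mem_ofPred_eq, not_or, not_lt, not_le, one_mul] at hnot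
  have h : (K + 1) * (Real.sqrt n)⁻¹ < |(n : ℝ)⁻¹ * ∑ i : Fin n, (X i ω + R n ω i)| := hω
  rw [Finset.sum_add_distrib, abs_mul, abs_of_pos (inv_pos.2 hn0)] at h
  have h3 : |∑ i : Fin n, X i ω + ∑ i, R n ω i| ≤ (K + 1) * Real.sqrt n :=
    (abs_add_le _ _).trans (by linarith [hnot.1, hnot.2.le])
  have h4 := mul_le_mul_of_nonneg_left h3 (inv_pos.2 hn0).le
  have h5 : (n : ℝ)⁻¹ * ((K + 1) * Real.sqrt n) = (K + 1) * (Real.sqrt n)⁻¹ := by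
    have hs : 0 < Real.sqrt n := Real.sqrt_pos.2 hn0
    field_simp
    rw [Real.sq_sqrt hn0.le]
  linarith

/-- Central limit theorem for the perturbed average. -/
theorem tendstoInDistribution_inv_mul_sum_add (hX : MemLp (X 0) 2 P) (hind : iIndepFun X P)
    (hid : ∀ i, IdentDistrib (X i) (X 0) P P) (h0 : ∫ ω, X 0 ω ∂P = 0)
    (hR : ∀ δ : ℝ, 0 < δ → ∀ ε : ℝ≥0∞, 0 < ε →
      ∀ᶠ n : ℕ in atTop, P {ω | δ * Real.sqrt n ≤ |∑ i, R n ω i|} ≤ ε)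
    (hmeas : ∀ n, AEMeasurable (fun ω => ∑ i : Fin n, (X i ω + R n ω i)) P) :
    TendstoInDistribution
      (fun (n : ℕ) ω => Real.sqrt n * ((n : ℝ)⁻¹ * ∑ i : Fin n, (X i ω + R n ω i)))
      atTop (id : ℝ → ℝ) (fun _ => P) (gaussianReal 0 (∫ ω, X 0 ω ^ 2 ∂P).toNNReal) := by
  have hvar : Var[X 0; P] = ∫ ω, X 0 ω ^ 2 ∂P :=
    variance_of_integral_eq_zero hX.aestronglyMeasurable.aemeasurable h0
  have hclt := tendstoInDistribution_inv_sqrt_mul_sum_sub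
    (Y := (id : ℝ → ℝ)) (P' := gaussianReal 0 Var[X 0; P].toNNReal) HasLaw.id hX hind hid
  rw [hvar] at hclt
  -- Slutsky: the difference from the i.i.d. normalized sum is `(∑ R) / √n`.
  refine tendstoInDistribution_of_tendstoInMeasure_sub _ _ hclt ?_ fun n =>
    ((hmeas n).const_mul _).const_mul _
  refine tendstoInMeasure_const_iff_eventually_le.2 fun η hη ε hε => ?_
  filter_upwards [hR η hη ε hε, eventually_ge_atTop 1] with n h1 h2
  refine (measure_mono fun ω hω => ?_).trans h1
  have hn0 : (0 : ℝ) < n := by exact_mod_cast h2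
  have hs : 0 < Real.sqrt n := Real.sqrt_pos.2 hn0
  have h := (show η ≤ |_| from hω)
  change η ≤ |_ - (0 : ℝ)| at h
  simp only [Pi.sub_apply, h0, mul_zero, sub_zero, Finset.sum_add_distrib,
    Finset.sum_range] at h
  have e : Real.sqrt n * ((n : ℝ)⁻¹ * (∑ i : Fin n, X i ω + ∑ i, R n ω i))
      - (Real.sqrt n)⁻¹ * ∑ i : Fin n, X i ω = (∑ i, R n ω i) / Real.sqrt n := by
    field_simp
    rw [Real.sq_sqrt hn0.le]
    ring
  rw [e, abs_div, abs_of_pos hs, le_div_iff₀ hs] at h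
  exact h

/-- A deterministic bound for the effect of a perturbation on a sum of squares. -/
theorem abs_sum_add_sq_sub_sum_sq_le {ι : Type*} (t : Finset ι) (x r : ι → ℝ) (D : ℝ) {τ : ℝ}
    (hτ : 0 < τ) :
    |∑ i ∈ t, (x i + r i - D) ^ 2 - ∑ i ∈ t, x i ^ 2|
      ≤ τ * ∑ i ∈ t, x i ^ 2 + (1 + τ⁻¹) * (2 * ∑ i ∈ t, r i ^ 2 + 2 * (#t * D ^ 2)) := by
  have hpt : ∀ i, |(x i + r i - D) ^ 2 - x i ^ 2|
      ≤ τ * x i ^ 2 + (1 + τ⁻¹) * (2 * r i ^ 2 + 2 * D ^ 2) := by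
    intro i
    set e := r i - D with he
    have h1 : e ^ 2 ≤ 2 * r i ^ 2 + 2 * D ^ 2 := by nlinarith [sq_nonneg (r i + D)]
    -- Weighted Young inequality: `τ` keeps the multiple of `x i ^ 2` small, at the price of `τ⁻¹`
    -- on the perturbation.
    have h2 : |2 * (x i * e)| ≤ τ * x i ^ 2 + τ⁻¹ * e ^ 2 := by
      have e1 : τ * (τ⁻¹ * e ^ 2) = e ^ 2 := by field_simp
      have e2 : τ * x i ^ 2 + τ⁻¹ * e ^ 2 - 2 * (x i * e) = τ⁻¹ * (τ * x i - e) ^ 2 := by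
        field_simp; ring
      have e3 : τ * x i ^ 2 + τ⁻¹ * e ^ 2 + 2 * (x i * e) = τ⁻¹ * (τ * x i + e) ^ 2 := by
        field_simp; ring
      have p1 : 0 ≤ τ⁻¹ * (τ * x i - e) ^ 2 := by positivity
      have p2 : 0 ≤ τ⁻¹ * (τ * x i + e) ^ 2 := by positivity
      rw [abs_le]
      constructor <;> linarith
    have h3 : (x i + r i - D) ^ 2 - x i ^ 2 = 2 * (x i * e) + e ^ 2 := by rw [he]; ring
    rw [h3]
    refine (abs_add_le _ _).trans ?_
    rw [abs_of_nonneg (sq_nonneg e)]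
    have h4 : (1 + τ⁻¹) * e ^ 2 ≤ (1 + τ⁻¹) * (2 * r i ^ 2 + 2 * D ^ 2) := by gcongr
    linarith
  rw [← Finset.sum_sub_distrib]
  refine (Finset.abs_sum_le_sum_abs _ _).trans ((Finset.sum_le_sum fun i _ => hpt i).trans
    (le_of_eq ?_))
  simp only [Finset.sum_add_distrib, ← Finset.mul_sum, Finset.sum_const, nsmul_eq_mul]

/-- Consistency of the empirical second moment of the perturbed, recentered variables. -/
theorem tendstoInMeasure_inv_mul_sum_sq (hX : MemLp (X 0) 2 P) (hind : iIndepFun X P)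
    (hid : ∀ i, IdentDistrib (X i) (X 0) P P)
    (hR : ∀ δ : ℝ, 0 < δ → ∀ ε : ℝ≥0∞, 0 < ε →
      ∀ᶠ n : ℕ in atTop, P {ω | δ * n ≤ ∑ i, R n ω i ^ 2} ≤ ε)
    {D : ℕ → Ω → ℝ} (hD : TendstoInMeasure P D atTop (fun _ => 0)) :
    TendstoInMeasure P
      (fun (n : ℕ) ω => (n : ℝ)⁻¹ * ∑ i : Fin n, (X i ω + R n ω i - D n ω) ^ 2) atTop
      (fun _ => ∫ ω, X 0 ω ^ 2 ∂P) := by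
  have hsq : Measurable fun x : ℝ => x ^ 2 := by fun_prop
  have hL : ∀ i, MemLp (X i) 2 P := fun i => (hid i).memLp_iff.2 hX
  have hlln : TendstoInMeasure P (fun (n : ℕ) ω => (∑ i ∈ Finset.range n, X i ω ^ 2) / n) atTop
      (fun _ => ∫ ω, X 0 ω ^ 2 ∂P) := by
    refine tendstoInMeasure_of_tendsto_ae (fun n => ?_)
      (strong_law_ae_real (fun i ω => X i ω ^ 2) hX.integrable_sq
        (fun i j hij => (hind.indepFun hij).comp hsq hsq) fun i => (hid i).comp hsq)
    simp only [div_eq_mul_inv]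
    exact (Finset.aestronglyMeasurable_fun_sum _ fun i _ =>
      (hL i).integrable_sq.aestronglyMeasurable).mul_const _
  set V := ∫ ω, X 0 ω ^ 2 ∂P with hV
  have hV0 : 0 ≤ V := integral_nonneg fun _ => sq_nonneg _
  rw [tendstoInMeasure_const_iff_eventually_le] at hlln hD ⊢
  intro η hη ε hε
  -- `τ (V + 1) = η / 4` and `4 (1 + τ⁻¹) B = η / 4`, so the perturbation costs at most `η / 2` and
  -- the law of large numbers less than `η / 4`. The `1` in the minimum below yields `M ≤ V + 1`.
  set τ := η / (4 * (V + 1)) with hτ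
  have hτ0 : 0 < τ := by positivity
  set B := η / (16 * (1 + τ⁻¹)) with hB
  have hB0 : 0 < B := by positivity
  have hε3 : 0 < ε / 3 := ENNReal.div_pos hε.ne' (by norm_num)
  filter_upwards [hlln (min 1 (η / 4)) (by positivity) _ hε3, hR B hB0 _ hε3,
    hD (Real.sqrt B) (Real.sqrt_pos.2 hB0) _ hε3, eventually_ge_atTop 1] with n h1 h2 h3 h4
  have hn0 : (0 : ℝ) < n := by exact_mod_cast h4
  rw [← ENNReal.add_thirds ε]
  refine (measure_mono fun ω hω => ?_).trans ((measure_union_le _ _).trans (add_le_add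
    ((measure_union_le _ _).trans (add_le_add h1 h2)) h3))
  by_contra hnot
  simp only [Set.mem_union, Set.mem_ofPred_eq, not_or, not_le, sub_zero] at hnot
  obtain ⟨⟨n1, n2⟩, n3⟩ := hnot
  have h : η ≤ |(n : ℝ)⁻¹ * ∑ i : Fin n, (X i ω + R n ω i - D n ω) ^ 2 - V| := hω
  rw [Finset.sum_range] at n1
  have n4 := n1.trans_le (min_le_left _ _)
  have n5 := n1.trans_le (min_le_right _ _)
  set M := (∑ i : Fin n, X i ω ^ 2) / n with hM
  have hM1 : M ≤ V + 1 := by linarith [(abs_lt.1 n4).2]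
  have hD2 : D n ω ^ 2 ≤ B := by
    rw [← sq_abs, ← Real.sq_sqrt hB0.le]
    exact pow_le_pow_left₀ (abs_nonneg _) n3.le 2
  have hdet := abs_sum_add_sq_sub_sum_sq_le Finset.univ (fun i : Fin n => X i ω) (R n ω) (D n ω) hτ0
  rw [Finset.card_univ, Fintype.card_fin] at hdet
  have hMn : ∑ i : Fin n, X i ω ^ 2 = n * M := by rw [hM]; field_simp
  rw [hMn] at hdet
  have hb : τ * (n * M) + (1 + τ⁻¹) * (2 * ∑ i, R n ω i ^ 2 + 2 * (n * D n ω ^ 2))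
      ≤ n * (η / 2) := by
    calc τ * (n * M) + (1 + τ⁻¹) * (2 * ∑ i, R n ω i ^ 2 + 2 * (n * D n ω ^ 2))
        ≤ τ * (n * (V + 1)) + (1 + τ⁻¹) * (2 * (B * n) + 2 * (n * B)) := by gcongr
      _ = n * (η / 2) := by
          have e1 : τ * (V + 1) = η / 4 := by rw [hτ]; field_simp
          have e2 : (1 + τ⁻¹) * B = η / 16 := by rw [hB]; field_simp
          linear_combination (n : ℝ) * e1 + 4 * (n : ℝ) * e2
  have hfin : |(n : ℝ)⁻¹ * ∑ i : Fin n, (X i ω + R n ω i - D n ω) ^ 2 - M| ≤ η / 2 := by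
    have e : (n : ℝ)⁻¹ * ∑ i : Fin n, (X i ω + R n ω i - D n ω) ^ 2 - M
        = (n : ℝ)⁻¹ * (∑ i : Fin n, (X i ω + R n ω i - D n ω) ^ 2 - n * M) := by
      field_simp
    rw [e, abs_mul, abs_of_pos (inv_pos.2 hn0), inv_mul_le_iff₀ hn0]
    exact hdet.trans hb
  have := abs_sub_le ((n : ℝ)⁻¹ * ∑ i : Fin n, (X i ω + R n ω i - D n ω) ^ 2) M V
  linarith

end Perturbed

/-! ### Asymptotic normality of the debiased estimator -/

namespace CrossFit

variable {𝒳 𝒵 : Type*} {L n : ℕ} {m : Obs 𝒳 𝒵 → (𝒳 → ℝ) → ℝ} {g : Obs 𝒳 𝒵 → ℝ} {γ₀ : 𝒳 → ℝ}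
  {α₀ : 𝒵 → ℝ}

theorem sum_block_eq_sum_fold (S : CrossFit 𝒳 𝒵 L n) (f : Fin L → Fin n → ℝ) :
    ∑ ℓ, ∑ i ∈ S.block ℓ, f ℓ i = ∑ i, f (S.fold i) i := by
  rw [← sum_sum_block_eq (S := S) fun i => f (S.fold i) i]
  refine Finset.sum_congr rfl fun ℓ _ => Finset.sum_congr rfl fun i hi => ?_
  rw [mem_block.1 hi]

/-- The estimation error is the average of the influence function and of the score errors. -/
theorem thetaHat_sub (S : CrossFit 𝒳 𝒵 L n) (hn : 1 ≤ n) (θ : ℝ) (w : Fin n → Obs 𝒳 𝒵) :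
    S.thetaHat m w - θ = (n : ℝ)⁻¹ * ∑ i,
      ((g (w i) - θ + α₀ (w i).2.2 * ((w i).1 - γ₀ (w i).2.1))
        + scoreError m g γ₀ α₀ S (S.fold i) w (w i)) := by
  have hn0 : (n : ℝ) ≠ 0 := by exact_mod_cast (by lia : n ≠ 0)
  have h : θ = (n : ℝ)⁻¹ * ∑ _i : Fin n, θ := by
    rw [Finset.sum_const, Finset.card_univ, Fintype.card_fin, nsmul_eq_mul, ← mul_assoc,
      inv_mul_cancel₀ hn0, one_mul]
  rw [thetaHat, sum_block_eq_sum_fold S fun ℓ i => m (w i) (S.gammaHat ℓ w)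
      + S.alphaHat ℓ w (w i).2.2 * ((w i).1 - S.gammaHat ℓ w (w i).2.1)]
  nth_rewrite 1 [h]
  rw [← mul_sub, ← Finset.sum_sub_distrib]
  congr 1
  refine Finset.sum_congr rfl fun i _ => ?_
  rw [scoreError]
  ring

/-- Centring at `θ̂` instead of `θ` is a common shift by `θ̂ - θ`, which makes `V̂` the empirical
second moment of a perturbed, recentred i.i.d. sequence. The identity is termwise, so `n = 0` needs
no exclusion. -/
theorem VHat_eq (S : CrossFit 𝒳 𝒵 L n) (θ : ℝ) (w : Fin n → Obs 𝒳 𝒵) :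
    S.VHat m w = (n : ℝ)⁻¹ * ∑ i,
      ((g (w i) - θ + α₀ (w i).2.2 * ((w i).1 - γ₀ (w i).2.1))
        + scoreError m g γ₀ α₀ S (S.fold i) w (w i) - (S.thetaHat m w - θ)) ^ 2 := by
  rw [VHat, sum_block_eq_sum_fold S fun ℓ i => (m (w i) (S.gammaHat ℓ w) - S.thetaHat m w
      + S.alphaHat ℓ w (w i).2.2 * ((w i).1 - S.gammaHat ℓ w (w i).2.1)) ^ 2]
  congr 1
  refine Finset.sum_congr rfl fun i _ => ?_
  rw [scoreError]
  ring

end CrossFit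

/-- Fold-wise negligible score errors are negligible over the whole sample. -/
theorem eventually_measure_sum_fold_le {Ω 𝒳 𝒵 : Type*} [MeasurableSpace Ω] {P : Measure Ω} {L : ℕ}
    (hL : 0 < L) {S : ∀ n, CrossFit 𝒳 𝒵 L n} {f : ∀ n, Ω → Fin L → Fin n → ℝ} {t : ℕ → ℝ} {φ : ℝ → ℝ}
    (hφ : ∀ a b, φ (a + b) ≤ φ a + φ b) (hφ0 : φ 0 = 0)
    (h : ∀ ℓ, ∀ δ : ℝ, 0 < δ → ∀ ε : ℝ≥0∞, 0 < ε →
      ∀ᶠ n in atTop, P {ω | δ * t n ≤ φ (∑ i ∈ (S n).block ℓ, f n ω ℓ i)} ≤ ε)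
    (δ : ℝ) (hδ : 0 < δ) (ε : ℝ≥0∞) (hε : 0 < ε) :
    ∀ᶠ n in atTop, P {ω | δ * t n ≤ φ (∑ i, f n ω ((S n).fold i) i)} ≤ ε := by
  have hL0 : (0 : ℝ) < L := by exact_mod_cast hL
  have hεL : 0 < ε / L := ENNReal.div_pos hε.ne' (by simp)
  -- If every fold stays below `δ / L * t n`, subadditivity keeps the total below `δ * t n`; `φ` is
  -- the absolute value for the sums and the identity for the sums of squares.
  have hev := eventually_all.2 fun ℓ => h ℓ (δ / L) (by positivity) (ε / L) hεL
  filter_upwards [hev] with n hn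
  refine (measure_mono fun ω hω => ?_).trans ((measure_iUnion_fin_le_mul hn).trans
    ENNReal.mul_div_le)
  by_contra hnot
  simp only [Set.mem_iUnion, Set.mem_ofPred_eq, not_exists, not_le] at hnot
  have h1 : δ * t n ≤ φ (∑ i, f n ω ((S n).fold i) i) := hω
  rw [← CrossFit.sum_block_eq_sum_fold] at h1
  have h2 := h1.trans (Finset.le_sum_of_subadditive φ hφ0.le hφ Finset.univ
    fun ℓ => ∑ i ∈ (S n).block ℓ, f n ω ℓ i)
  have h3 := Finset.sum_lt_sum_of_nonempty (s := (Finset.univ : Finset (Fin L)))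
    ⟨⟨0, hL⟩, Finset.mem_univ _⟩ fun ℓ _ => hnot ℓ
  rw [Finset.sum_const, Finset.card_univ, Fintype.card_fin, nsmul_eq_mul] at h3
  have h4 : (L : ℝ) * (δ / L * t n) = δ * t n := by field_simp
  linarith

/-! ### Assembly of the limit theorem. -/

theorem mainTheorem5
    {Ω 𝒳 𝒵 : Type*} [MeasurableSpace Ω] [MeasurableSpace 𝒳] [MeasurableSpace 𝒵]
    (P : Measure Ω) [IsProbabilityMeasure P]
    (F₀ : Measure (Obs 𝒳 𝒵)) [IsProbabilityMeasure F₀]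
    -- i.i.d. observations with law `F₀`
    (W : ℕ → Ω → Obs 𝒳 𝒵) (hW_indep : iIndepFun W P) (hW_law : ∀ i, HasLaw (W i) F₀ P)
    -- the nonparametric IV model `Y = γ₀(X) + ε`, `E[ε | Z] = 0`
    (γ₀ : 𝒳 → ℝ) (hγ₀ : IsSquareIntegrable F₀ γ₀)
    (hε_sq : MemLp (fun w : Obs 𝒳 𝒵 => w.1 - γ₀ w.2.1) 2 F₀)
    (h_exog : F₀[fun w : Obs 𝒳 𝒵 => w.1 - γ₀ w.2.1 | instrumentSigma 𝒳 𝒵] =ᵐ[F₀] 0)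
    -- the functional: Gateaux differentiable, with a derivative linear in the direction
    (m : Obs 𝒳 𝒵 → (𝒳 → ℝ) → ℝ)
    (h_diff : ∀ γ ζ : 𝒳 → ℝ, IsSquareIntegrable F₀ γ → IsSquareIntegrable F₀ ζ →
      ∀ᵐ w ∂F₀, DifferentiableAt ℝ (fun τ : ℝ => m w (γ + τ • ζ)) 0)
    (h_lin : ∀ γ ζ₁ ζ₂ : 𝒳 → ℝ, IsSquareIntegrable F₀ γ → IsSquareIntegrable F₀ ζ₁ →
      IsSquareIntegrable F₀ ζ₂ → ∀ c₁ c₂ : ℝ, ∀ᵐ w ∂F₀,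
        gateaux m w γ (c₁ • ζ₁ + c₂ • ζ₂) = c₁ * gateaux m w γ ζ₁ + c₂ * gateaux m w γ ζ₂)
    -- the Riesz representer of the derivative at `γ₀`
    (α₀ : 𝒵 → ℝ) (hα₀_meas : Measurable α₀)
    (h_riesz : ∀ ζ : 𝒳 → ℝ, IsSquareIntegrable F₀ ζ →
      Integrable (fun w => gateaux m w γ₀ ζ) F₀ ∧
        ∫ w, gateaux m w γ₀ ζ ∂F₀ = ∫ w, α₀ w.2.2 * ζ w.2.1 ∂F₀)
    -- boundedness of `α₀` and of `E[(Y - γ₀(X))² | Z]`, and `E[m(W, γ₀)²] < ∞`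
    (hα₀_bdd : ∃ C : ℝ, ∀ᵐ w ∂F₀, |α₀ w.2.2| ≤ C)
    (h_condVar : ∃ C : ℝ, ∀ᵐ w ∂F₀,
      (F₀[fun w : Obs 𝒳 𝒵 => (w.1 - γ₀ w.2.1) ^ 2 | instrumentSigma 𝒳 𝒵]) w ≤ C)
    (hm_sq : MemLp (fun w => m w γ₀) 2 F₀)
    -- the procedure: `L ≥ 2` folds of asymptotically equal size, double cross-fitted PGMM
    (L : ℕ) (hL : 2 ≤ L) (S : ∀ n, CrossFit 𝒳 𝒵 L n)
    (hS : ∀ n, (S n).IsDoubleCrossFitPGMM F₀ m)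
    (h_folds : ∀ ℓ, Tendsto (fun n : ℕ => ((S n).blockSize ℓ : ℝ) / n) atTop (𝓝 (1 / (L : ℝ))))
    -- rates: `κ_n` for `γ̂`, sparsity `s̄_n`
    (κ : ℕ → ℝ) (hκ_nonneg : ∀ n, 0 ≤ κ n) (s : ℕ → ℕ) (hs : ∀ n, 1 ≤ s n)
    -- weight matrices
    (Om : ∀ n, Matrix (Fin (S n).q) (Fin (S n).q) ℝ)
    (hOm_rate : ∀ ℓ, IsBigOInProb P
      (fun n ω => rowSumNorm ((S n).OmegaHat ℓ (sample W n ω) - Om n))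
      (fun n => Real.sqrt (Real.log (S n).q / n)))
    (hOm_bdd : ∃ C : ℝ, ∀ᶠ n in atTop, rowSumNorm (Om n) ≤ C)
    -- bounded dictionaries
    (hb_bdd : ∃ C : ℝ, ∀ n, ∀ᵐ w ∂F₀, ∀ k, |(S n).b k w.2.2| ≤ C)
    (hd_bdd : ∃ C : ℝ, ∀ n, ∀ᵐ w ∂F₀, ∀ j, |(S n).d j w.2.1| ≤ C)
    -- sparse approximation of `α₀`
    (h_sparse : ∃ C A : ℝ, ∀ᶠ n in atTop, ∃ ρ : Fin (S n).p → ℝ,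
      (Finset.univ.filter fun k => ρ k ≠ 0).card ≤ s n ∧ ∑ k, |ρ k| ≤ A ∧
        ∫ w, (α₀ w.2.2 - ∑ k, (S n).b k w.2.2 * ρ k) ^ 2 ∂F₀
          ≤ C * s n * epsRate (S n).q n (κ n) ^ 2)
    -- bounded largest eigenvalue, and restricted eigenvalue bounded away from zero
    (h_maxEig : ∃ C : ℝ, ∀ᶠ n in atTop, ∀ e : ℝ,
      Module.End.HasEigenvalue (Matrix.toLin' ((S n).popHessian F₀ (Om n))) e → e ≤ C)
    (h_restrEig : ∃ c : ℝ, 0 < c ∧ ∀ᶠ n in atTop,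
      (c : EReal) ≤ restrictedEigenvalueSq ((S n).popHessian F₀ (Om n)) (s n))
    -- boundedness and Lipschitz continuity in mean of the derivative near `γ₀`
    (h_deriv : ∃ C r : ℝ, 0 < C ∧ 0 < r ∧ ∀ γ : 𝒳 → ℝ, IsSquareIntegrable F₀ γ →
      msNorm F₀ (γ - γ₀) ≤ r → ∀ n,
        (∀ᵐ w ∂F₀, ∀ j, |gateaux m w γ ((S n).d j)| ≤ C) ∧
        ∀ j, |∫ w, (gateaux m w γ ((S n).d j) - gateaux m w γ₀ ((S n).d j)) ∂F₀|
          ≤ C * msNorm F₀ (γ - γ₀))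
    -- quadratic linearization remainder
    (h_quad : ∃ C r : ℝ, 0 < C ∧ 0 < r ∧ ∀ γ : 𝒳 → ℝ, IsSquareIntegrable F₀ γ →
      msNorm F₀ (γ - γ₀) ≤ r →
        Integrable (fun w => m w γ) F₀ ∧
        |∫ w, (m w γ - m w γ₀ - gateaux m w γ₀ (γ - γ₀)) ∂F₀| ≤ C * msNorm F₀ (γ - γ₀) ^ 2)
    -- convergence of the first-stage estimators
    (hγ_rate : ∀ ℓ, IsBigOInProb P
      (fun n ω => msNorm F₀ ((S n).gammaHat ℓ (sample W n ω) - γ₀)) κ)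
    (hγ₂_rate : ∀ ℓ ℓ', ℓ ≠ ℓ' → IsBigOInProb P
      (fun n ω => msNorm F₀ ((S n).gammaHat₂ ℓ ℓ' (sample W n ω) - γ₀)) κ)
    (hγ_quarter : ∀ ℓ, TendstoInMeasure P
      (fun (n : ℕ) ω => (n : ℝ) ^ (1 / 4 : ℝ) *
        msNorm F₀ ((S n).gammaHat ℓ (sample W n ω) - γ₀)) atTop (fun _ => 0))
    (hm_consist : ∀ ℓ, ∀ δ : ℝ≥0∞, 0 < δ → Tendsto (fun n => P {ω | δ ≤
      ∫⁻ w, ENNReal.ofReal ((m w ((S n).gammaHat ℓ (sample W n ω)) - m w γ₀) ^ 2) ∂F₀})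
      atTop (𝓝 0))
    -- relations between the rates, with `κ^α_n = s̄_n λ_n`
    (h_rate_q : (fun n : ℕ => Real.sqrt (Real.log (S n).q / n)) =o[atTop] fun n => (S n).lam)
    (h_rate_κ : κ =o[atTop] fun n => (S n).lam)
    (h_rate_s : Tendsto (fun n => (s n : ℝ) * (S n).lam) atTop (𝓝 0))
    (h_rate_prod : Tendsto (fun n : ℕ => Real.sqrt n * ((s n : ℝ) * (S n).lam) * κ n)
      atTop (𝓝 0)) :
    Integrable (fun w => psiZero F₀ m γ₀ α₀ w ^ 2) F₀ ∧
    IsBigOInProb P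
      (fun n ω => (S n).thetaHat m (sample W n ω) - thetaZero F₀ m γ₀)
      (fun n => (Real.sqrt n)⁻¹) ∧
    TendstoInDistribution
      (fun (n : ℕ) ω => Real.sqrt n * ((S n).thetaHat m (sample W n ω) - thetaZero F₀ m γ₀))
      atTop (id : ℝ → ℝ) (fun _ => P)
      (gaussianReal 0 (∫ w, psiZero F₀ m γ₀ α₀ w ^ 2 ∂F₀).toNNReal) ∧
    TendstoInMeasure P (fun n ω => (S n).VHat m (sample W n ω)) atTop
      (fun _ => ∫ w, psiZero F₀ m γ₀ α₀ w ^ 2 ∂F₀) := by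
  obtain ⟨Cα, hCα⟩ := hα₀_bdd
  obtain ⟨Cv, hCv0, hCv⟩ : ∃ C : ℝ, 0 ≤ C ∧ ∀ᵐ w ∂F₀,
      (F₀[fun w : Obs 𝒳 𝒵 => (w.1 - γ₀ w.2.1) ^ 2 | instrumentSigma 𝒳 𝒵]) w ≤ C := by
    obtain ⟨C, hC⟩ := h_condVar
    exact ⟨max C 0, le_max_right _ _, hC.mono fun w hw => hw.trans (le_max_left _ _)⟩
  obtain ⟨Cb, hCb0, hb⟩ : ∃ C : ℝ, 0 ≤ C ∧ ∀ n, ∀ᵐ w ∂F₀, ∀ k, |(S n).b k w.2.2| ≤ C := by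
    obtain ⟨C, hC⟩ := hb_bdd
    exact ⟨max C 0, le_max_right _ _,
      fun n => (hC n).mono fun w hw k => (hw k).trans (le_max_left _ _)⟩
  obtain ⟨COm, hCOm⟩ := hOm_bdd
  obtain ⟨Cd, hd⟩ := hd_bdd
  obtain ⟨C, A, h_sparse⟩ := h_sparse
  obtain ⟨c, hc, h_restrEig⟩ := h_restrEig
  obtain ⟨CD, rD, hCD, hrD, h_deriv⟩ := h_deriv
  obtain ⟨CQ, rQ, hCQ, hrQ, h_quad⟩ := h_quad
  obtain ⟨ρ₀, hρ₀⟩ := Filter.skolem.1 h_sparse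
  have hα₀L : MemLp (fun w : Obs 𝒳 𝒵 => α₀ w.2.2) 2 F₀ :=
    MemLp.of_bound (hα₀_meas.comp measurable_snd.snd).aestronglyMeasurable Cα hCα
  -- a measurable version of the influence function
  set g : Obs 𝒳 𝒵 → ℝ := hm_sq.1.mk _ with hg_def
  have hg : Measurable g := hm_sq.1.stronglyMeasurable_mk.measurable
  have hgm : g =ᵐ[F₀] fun w => m w γ₀ := hm_sq.1.ae_eq_mk.symm
  set θ := thetaZero F₀ m γ₀ with hθ
  set ψ : Obs 𝒳 𝒵 → ℝ := fun w => g w - θ + α₀ w.2.2 * (w.1 - γ₀ w.2.1) with hψ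
  have hψm : Measurable ψ :=
    (hg.sub_const θ).add ((hα₀_meas.comp measurable_snd.snd).mul
      (measurable_fst.sub (hγ₀.1.comp measurable_snd.fst)))
  have hψ0 : ψ =ᵐ[F₀] psiZero F₀ m γ₀ α₀ := by
    filter_upwards [hgm] with w hw
    simp only [hψ, psiZero, hw, hθ]
  have hαε : MemLp (fun w : Obs 𝒳 𝒵 => α₀ w.2.2 * (w.1 - γ₀ w.2.1)) 2 F₀ :=
    MemLp.two_mul_of_ae_bound hε_sq (hα₀_meas.comp measurable_snd.snd).aestronglyMeasurable hCα
  have hgL : MemLp g 2 F₀ := (memLp_congr_ae hgm).2 hm_sq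
  have hψL : MemLp ψ 2 F₀ := (hgL.sub (memLp_const θ)).add hαε
  have hψsq : ∫ w, ψ w ^ 2 ∂F₀ = ∫ w, psiZero F₀ m γ₀ α₀ w ^ 2 ∂F₀ := by
    refine integral_congr_ae ?_
    filter_upwards [hψ0] with w hw
    rw [hw]
  -- Exogeneity against the bounded function `α₀` removes the correction term from the mean.
  have hψmean : ∫ w, ψ w ∂F₀ = 0 := by
    have h1 : Integrable (fun w => g w - θ) F₀ :=
      (hgL.integrable one_le_two).sub (integrable_const θ)
    rw [hψ, integral_add h1 (hαε.integrable one_le_two),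
      integral_instrument_mul_eq_zero (hε_sq.integrable one_le_two) h_exog hα₀_meas hCα,
      integral_sub (hgL.integrable one_le_two) (integrable_const θ), integral_congr_ae hgm]
    simp [hθ, thetaZero]
  -- the influence function along the sample
  set X : ℕ → Ω → ℝ := fun i ω => ψ (W i ω) with hX
  have hXind : iIndepFun X P := hW_indep.comp (fun _ => ψ) fun _ => hψm
  have hXid : ∀ i, IdentDistrib (X i) (X 0) P P := fun i =>
    IdentDistrib.comp ⟨(hW_law i).aemeasurable, (hW_law 0).aemeasurable,
      (hW_law i).map_eq.trans (hW_law 0).map_eq.symm⟩ hψm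
  have hint : ∀ f : Obs 𝒳 𝒵 → ℝ, Measurable f → ∫ ω, f (W 0 ω) ∂P = ∫ w, f w ∂F₀ := by
    intro f hf
    rw [← (hW_law 0).map_eq, integral_map (hW_law 0).aemeasurable hf.aestronglyMeasurable]
  have hXL : MemLp (X 0) 2 P := by
    have h : MemLp ψ 2 (P.map (W 0)) := by rwa [(hW_law 0).map_eq]
    exact h.comp_of_map (hW_law 0).aemeasurable
  have hX0 : ∫ ω, X 0 ω ∂P = 0 := (hint ψ hψm).trans hψmean
  have hXsq : ∫ ω, X 0 ω ^ 2 ∂P = ∫ w, psiZero F₀ m γ₀ α₀ w ^ 2 ∂F₀ :=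
    (hint (fun w => ψ w ^ 2) (hψm.pow_const 2)).trans hψsq
  -- the remainder
  set R : ∀ n, Ω → Fin n → ℝ := fun n ω i =>
    CrossFit.scoreError m g γ₀ α₀ (S n) ((S n).fold i) (sample W n ω) (sample W n ω i) with hR
  have hneg := fun ℓ δ (hδ : (0 : ℝ) < δ) ε (hε : (0 : ℝ≥0∞) < ε) =>
    eventually_measure_scoreError_le hW_indep hW_law hg hgm hγ₀ hα₀_meas
      (hm_sq.integrable one_le_two) hε_sq h_exog h_riesz hS hCα hCv0 hCv hCb0 hb hCQ hrQ h_quad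
      hκ_nonneg hs (hρ₀.mono fun n hn => hn.2)
      (isBigOInProb_sum_abs_rhoHat_sub hW_indep hW_law hγ₀ hα₀L h_riesz hL hS (h_folds ℓ)
        hκ_nonneg hs (hOm_rate ℓ) hCOm hb hd hρ₀ hc h_restrEig hCD hrD h_deriv (hγ₂_rate ℓ)
        h_rate_q h_rate_κ h_rate_s)
      (hγ_rate ℓ) (hγ_quarter ℓ) (hm_consist ℓ) h_rate_q h_rate_κ h_rate_s h_rate_prod hδ hε
  have hR1 : ∀ δ : ℝ, 0 < δ → ∀ ε : ℝ≥0∞, 0 < ε →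
      ∀ᶠ n : ℕ in atTop, P {ω | δ * Real.sqrt n ≤ |∑ i, R n ω i|} ≤ ε :=
    eventually_measure_sum_fold_le (by lia) (S := S) (φ := fun x => |x|)
      (t := fun n => Real.sqrt n)
      (f := fun n ω ℓ i =>
        CrossFit.scoreError m g γ₀ α₀ (S n) ℓ (sample W n ω) (sample W n ω i))
      abs_add_le abs_zero fun ℓ δ hδ ε hε => (hneg ℓ δ hδ ε hε).mono fun n hn => hn.1
  have hR2 : ∀ δ : ℝ, 0 < δ → ∀ ε : ℝ≥0∞, 0 < ε →
      ∀ᶠ n : ℕ in atTop, P {ω | δ * n ≤ ∑ i, R n ω i ^ 2} ≤ ε :=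
    eventually_measure_sum_fold_le (by lia) (S := S) (φ := fun x => x) (t := fun n => n)
      (f := fun n ω ℓ i =>
        CrossFit.scoreError m g γ₀ α₀ (S n) ℓ (sample W n ω) (sample W n ω i) ^ 2)
      (fun _ _ => le_rfl) rfl fun ℓ δ hδ ε hε => (hneg ℓ δ hδ ε hε).mono fun n hn => hn.2
  have hθn : ∀ n, 1 ≤ n → ∀ ω, (S n).thetaHat m (sample W n ω) - θ
      = (n : ℝ)⁻¹ * ∑ i : Fin n, (X i ω + R n ω i) := fun n hn ω =>
    (S n).thetaHat_sub hn θ (sample W n ω)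
  have hbigO : IsBigOInProb P (fun n ω => (S n).thetaHat m (sample W n ω) - θ)
      (fun n => (Real.sqrt n)⁻¹) := by
    intro ε hε
    obtain ⟨K, hK, hev⟩ := isBigOInProb_inv_mul_sum_add hXL hXind hXid hX0 hR1 ε hε
    refine ⟨K, hK, ?_⟩
    filter_upwards [hev, eventually_ge_atTop 1] with n h1 h2
    simp only [hθn n h2]
    exact h1
  have hsqrt : Tendsto (fun n : ℕ => (Real.sqrt n)⁻¹) atTop (𝓝 0) :=
    (Real.tendsto_sqrt_atTop.comp tendsto_natCast_atTop_atTop).inv_tendsto_atTop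
  have hmeas : ∀ n, AEMeasurable (fun ω => ∑ i : Fin n, (X i ω + R n ω i)) P := by
    intro n
    have hm : Measurable fun w : Fin n → Obs 𝒳 𝒵 => ∑ i, (ψ (w i)
        + CrossFit.scoreError m g γ₀ α₀ (S n) ((S n).fold i) w (w i)) :=
      Finset.measurable_fun_sum _ fun i _ => (hψm.comp (measurable_pi_apply i)).add
        ((CrossFit.measurable_scoreError (hS n) hg hγ₀.1 hα₀_meas).comp
          (measurable_id.prodMk (measurable_pi_apply i)))
    exact hm.comp_aemeasurable (hasLaw_sample hW_indep hW_law n).aemeasurable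
  refine ⟨?_, hbigO, ?_, ?_⟩
  · refine hψL.integrable_sq.congr ?_
    filter_upwards [hψ0] with w hw
    rw [hw]
  · rw [← hXsq]
    convert tendstoInDistribution_inv_mul_sum_add hXL hXind hXid hX0 hR1 hmeas using 3 with n ω
    -- The averaging identity fails at `n = 0`, where `θ̂ = 0`, but there the factor `√n`
    -- annihilates both sides.
    rcases Nat.eq_zero_or_pos n with rfl | hn
    · simp
    · rw [hθn n hn ω]
  · rw [← hXsq]
    -- The recentring `θ̂ - θ` vanishes in probability by the root-`n` rate already proved.
    convert tendstoInMeasure_inv_mul_sum_sq hXL hXind hXid hR2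
      (hbigO.tendstoInMeasure_zero hsqrt) using 3 with n ω
    exact (S n).VHat_eq θ (sample W n ω)
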